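/- Let $w=(w_j)_{j\ge 0}$ be a probability distribution on $\{0,1,2,\dots\}$ with $\sum_j j w_j=1$, $\sum_j e^{aj}w_j<\infty$ for some $a>0$, and $w_1\ne 1$. Let $\theta(t)=\sum_{j\ge 0} w_jt^j$ have radius of convergence $\rho$, let $\widehat\psi(t)=t\theta'(t)/(\theta(t)-w_0)$ and $\widehat\nu=\lim_{t\uparrow\rho}\widehat\psi(t)\in[1,\infty]$, and let $m\ge 1$ be the least positive integer with $w_m>0$. Let $\alpha\in(0,1-1/\widehat\nu)$ with $\alpha>1-1/m$ (automatic if $w_1>0$). Then there is an $\alpha$-shifted offspring distribution $w^*$, i.e. a probability distribution with mean $1$, $w^*_0=\alpha$, and $w^*_j=Cw_jt^{j-1}$ for $j\ge 1$ with some constants $C,t>0$. Let $w^*$ be such a distribution and put $\widehat w^*_0=0$, $\widehat w^*_j=w^*_j/(1-\alpha)$ for $j\ge 1$. Let $\Omega_{k,n}$ be the set of ordered rooted trees with $n$ vertices, $k$ of them leaves. Write $(k,n)\in PP(w)$ if the Galton--Watson tree with offspring distribution $w$ lies in $\Omega_{k,n}$ with positive probability, and let $\mathcal P_{k,n}$ be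 its law conditioned on this event. Let $\sigma(T)$ be the sequence of the numbers of children of the vertices of $T$ in depth-first order. Algorithm A, for given $k,n$: (1) Generate $(\xi'_1,\dots,\xi'_{n-k})$ distributed as $n-k$ i.i.d. variables with law $\widehat w^*$ conditioned to have the sum $n-1$. This is done by generating multinomial vectors $(N_1,N_2,\dots)$ with parameters $(n-k;\widehat w_1^*,\widehat w_2^*,\dots)$, one binomial component after the other, until $\sum_j jN_j=n-1$ (a vector with draws left after the cells $1,\dots,n$ is rejected at once), and then randomly permuting the array that contains each $j$ exactly $N_j$ times. (2) Append $k$ zeros and apply a uniform random permutation. (3) Let $(y_1,\dots,y_n)$ be the result, and let $\hat\jmath$ be the first time at which the path $W_j=\sum_{i\le j}(y_i-1)$, $0\le j\le n$, attains its minimum; form $(\xi_1,\dots,\xi_n)=(y_{\hat\jmath+1},\dots,y_n,y_1,\dots,y_{\hat\jmath})$. (4) Output the tree $T=\sigma^{-1}(\xi_1,\dots,\xi_n)$. The running time is the number of elementary steps on a random access machine with exact real and integer arithmetic: arithmetic operations (a power $x^i$ counting as three), comparisons, accesses to an array or a linked list (the values $w^*_j$ being given as a table), coin flips with a computed bias,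 and draws of uniform random elements of $\{0,\dots,M-1\}$. A binomial variate is generated by sequential search from its centre, with probabilities computed from a table of factorials; permutations are generated by random transpositions; $\hat\jmath$ is found by a scan of the path, and the tree is built with a stack. For every $(k,n)\in PP(w)$, step (1) produces a sample with the stated conditional law, and the output $T$ of the algorithm has the law $\mathcal P_{k,n}$. Moreover, if $k=\alpha n+O(1)$, then the expected running time is $O(n)$: for every $B$ there is a constant $C$ such that it is at most $Cn$ for all $(k,n)\in PP(w)$ with $|k-\alpha n|\le B$. -/

import Mathlib

open scoped ENNReal NNReal Topology

namespace ConditionedGW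

/-! ### Ordered rooted trees and their degree sequences -/

/-- Finite ordered rooted trees: a root together with the ordered list of the subtrees
of its children. -/
inductive OTree : Type
  | node : List OTree → OTree

mutual
/-- `σ(T)`: the numbers of children of the vertices, in depth-first (preorder) order;
one entry per vertex. -/
def OTree.degrees : OTree → List ℕ
  | .node cs => cs.length :: OTree.forestDegrees cs
/-- Concatenation of the degree sequences of a list of trees. -/
def OTree.forestDegrees : List OTree → List ℕ
  | [] => []
  | t :: ts => t.degrees ++ OTree.forestDegrees ts
end

/-- Number of vertices. -/
def OTree.numVertices (t : OTree) : ℕ := t.degrees.length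

/-- Number of leaves (vertices without children). -/
def OTree.numLeaves (t : OTree) : ℕ := t.degrees.count 0

/-! ### Galton--Watson trees -/

mutual
/-- Individuals carry Ulam--Harris labels, the `i`-th child of `u` being `i :: u` (with `i`
counted from `0`), and `L u` is the number of children of `u`.  `IsFamilyTree L u t` says that
`t` is the family tree of the descendants of `u`. -/
def IsFamilyTree (L : List ℕ → ℕ) : List ℕ → OTree → Prop
  | u, .node cs => L u = cs.length ∧ IsFamilyForest L u 0 cs
/-- The trees in the list are the family trees of the children `i, i + 1, …` of `u`. -/
def IsFamilyForest (L : List ℕ → ℕ) : List ℕ → ℕ → List OTree → Prop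
  | _, _, [] => True
  | u, i, t :: ts => IsFamilyTree L (i :: u) t ∧ IsFamilyForest L u (i + 1) ts
end

/-- The law of the offspring numbers in a Galton--Watson process: independent, all with
distribution `w`. -/
noncomputable def gwMeasure (w : PMF ℕ) : MeasureTheory.Measure (List ℕ → ℕ) :=
  MeasureTheory.Measure.infinitePi (fun _ : List ℕ => w.toMeasure)

/-- The event that the family tree is `t`. -/
def familyTreeIs (t : OTree) : Set (List ℕ → ℕ) := {L | IsFamilyTree L [] t}

/-- The event that the family tree belongs to `Ω_{k,n}`: it has `k` leaves and `n` vertices. -/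
def familyTreeIn (k n : ℕ) : Set (List ℕ → ℕ) :=
  {L | ∃ t : OTree, t.numLeaves = k ∧ t.numVertices = n ∧ IsFamilyTree L [] t}

/-- `(k, n) ∈ PP(w)`. -/
def PP (w : PMF ℕ) (k n : ℕ) : Prop := gwMeasure w (familyTreeIn k n) ≠ 0

/-- The conditional law `𝒫_{k,n}`: the probability of the tree `t`. -/
noncomputable def condTreeLaw (w : PMF ℕ) (k n : ℕ) (t : OTree) : ℝ≥0∞ :=
  ProbabilityTheory.cond (gwMeasure w) (familyTreeIn k n) (familyTreeIs t)

/-! ### The shifted offspring distribution -/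

/-- The radius of convergence `ρ` of `θ(t) = ∑ w_i t ^ i`. -/
noncomputable def radius (w : PMF ℕ) : ℝ≥0∞ :=
  (FormalMultilinearSeries.ofScalars ℝ (fun i => (w i).toReal)).radius

/-- `ψ̂(t) = t θ'(t) / (θ(t) - w_0)`. -/
noncomputable def psiHat (w : PMF ℕ) (t : ℝ≥0∞) : ℝ≥0∞ :=
  (∑' i : ℕ, (i : ℝ≥0∞) * w i * t ^ i) / (∑' i : ℕ, if i = 0 then 0 else w i * t ^ i)

/-- `ν̂ = lim_{t ↑ ρ} ψ̂(t) ∈ [0, ∞]`.  Since `ψ̂` is monotone on `(0, ρ)` the limit exists, so it is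
the upper limit. -/
noncomputable def nuHat (w : PMF ℕ) : ℝ≥0∞ :=
  Filter.limsup (psiHat w) (𝓝[<] (radius w))

/-- `v` is the `α`-shifted offspring distribution of `w`: a probability distribution of mean `1`
with `v_0 = α` and `v_j = C w_j t ^ (j - 1)` for `j ≥ 1`, for some constants `C, t > 0`. -/
def IsAlphaShift (w : PMF ℕ) (α : ℝ) (v : PMF ℕ) : Prop :=
  v 0 = ENNReal.ofReal α ∧
  ∑' j : ℕ, (j : ℝ≥0∞) * v j = 1 ∧
  ∃ C t : ℝ, 0 < C ∧ 0 < t ∧ ∀ j : ℕ, 1 ≤ j → v j = ENNReal.ofReal (C * t ^ (j - 1)) * w j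

/-- `ŵ*`: the distribution `v` restricted to the positive integers and normalized (`v_0 = α`). -/
noncomputable def hatStar (α : ℝ) (v : PMF ℕ) (j : ℕ) : ℝ≥0∞ :=
  if j = 0 then 0 else v j / (1 - ENNReal.ofReal α)

/-- The law of `N` independent variables with weights `p`, conditioned to have the sum `s`. -/
noncomputable def condSumLaw (p : ℕ → ℝ≥0∞) (N s : ℕ) (ξ : Fin N → ℕ) : ℝ≥0∞ :=
  if ∑ i, ξ i = s then
    (∏ i, p (ξ i)) / ∑' η : {η : Fin N → ℕ // ∑ i, η i = s}, ∏ i, p (η.1 i)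
  else 0

/-! ### Randomized computations with a step count

Programs run on a random access machine with exact real and integer arithmetic: a unit of time
pays for one arithmetic operation or comparison, one access to an array or a linked list, or
one random draw. -/

/-- A randomized computation with result in `β`: the probability that it halts with a given result
after a given number of steps.  The total mass is the probability that it halts. -/
def RandComp (β : Type) : Type := β × ℕ → ℝ≥0∞

open Classical in
/-- Return a result without spending time. -/
noncomputable def RandComp.ret {β : Type} (b : β) : RandComp β := fun o => if o = (b, 0) then 1 else 0

/-- Run `x`, then run `f` on its result with fresh randomness; the step counts add up. -/
noncomputable def RandComp.andThen {β γ : Type} (x : RandComp β) (f : β → RandComp γ) : RandComp γ := fun o =>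
  ∑' b : β, ∑ c ∈ Finset.HasAntidiagonal.antidiagonal o.2, x (b, c.1) * f b (o.1, c.2)

noncomputable instance : Monad RandComp where
  pure := RandComp.ret
  bind := RandComp.andThen

/-- The law of the result. -/
noncomputable def RandComp.law {β : Type} (x : RandComp β) (b : β) : ℝ≥0∞ := ∑' c : ℕ, x (b, c)

/-- The expected running time; runs which do not halt count as infinitely long. -/
noncomputable def RandComp.expTime {β : Type} (x : RandComp β) : ℝ≥0∞ :=
  (∑' o : β × ℕ, x o * (o.2 : ℝ≥0∞)) + (1 - ∑' o : β × ℕ, x o) * ⊤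

open Classical in
/-- One elementary operation, with the result `b`. -/
noncomputable def step {β : Type} (b : β) : RandComp β := fun o => if o = (b, 1) then 1 else 0

/-- One unit of time for bookkeeping (loop control, linked-list or pointer operations). -/
noncomputable def tick : RandComp Unit := step ()

/-- Read an entry of an array. -/
noncomputable def readAt {β : Type} (a : ℕ → β) (i : ℕ) : RandComp β := step (a i)

/-- Write an entry of an array. -/
noncomputable def writeAt {β : Type} (a : ℕ → β) (i : ℕ) (b : β) : RandComp (ℕ → β) :=
  step (Function.update a i b)

/-- Draw a biased coin: `true` if a uniform number in `[0, 1]` is below `r`. -/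
noncomputable def coin (r : ℝ) : RandComp Bool := fun o =>
  if o.2 = 1 then
    (if o.1 = true then min 1 (ENNReal.ofReal r) else 1 - min 1 (ENNReal.ofReal r))
  else 0

/-- Draw a uniform element of `{0, …, m - 1}`. -/
noncomputable def uniformBelow (m : ℕ) : RandComp ℕ := fun o =>
  if o.2 = 1 ∧ o.1 < m then (m : ℝ≥0∞)⁻¹ else 0

/-- At most `i` runs of `body`, up to the first successful one. -/
noncomputable def repeatAtMost {β : Type} (body : RandComp (Option β)) : ℕ → RandComp β
  | 0 => fun _ => 0
  | i + 1 => do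
      match ← body with
      | some b => pure b
      | none => repeatAtMost body i

/-- Run `body` again and again, up to the first successful run. -/
noncomputable def repeatUntil {β : Type} (body : RandComp (Option β)) : RandComp β := fun o =>
  ⨆ i : ℕ, repeatAtMost body i o

/-! ### Generating multinomial vectors -/

/-- The table of the factorials `0!, …, m!`. -/
noncomputable def factTable : ℕ → RandComp (ℕ → ℝ)
  | 0 => writeAt (fun _ => 0) 0 1
  | m + 1 => do
      tick
      let F ← factTable m
      let y ← readAt F m
      let z ← step (y * ((m + 1 : ℕ) : ℝ))
      writeAt F (m + 1) z

/-- A power, paid for as `exp (i * log x)`. -/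
noncomputable def power (x : ℝ) (i : ℕ) : RandComp ℝ := do
  tick
  tick
  step (x ^ i)

/-- The probability of `x` under the binomial distribution with parameters `m` and `q`, computed
with a table `F` of factorials. -/
noncomputable def binomialWeight (F : ℕ → ℝ) (m : ℕ) (q : ℝ) (x : ℕ) : RandComp ℝ := do
  let y ← step (m - x)
  let fm ← readAt F m
  let fx ← readAt F x
  let fy ← readAt F y
  let d ← step (fx * fy)
  let c ← step (fm / d)
  let u ← power q x
  let q' ← step (1 - q)
  let u' ← power q' y
  let cu ← step (c * u)
  step (cu * u')

/-- Sequential search for a binomial variate.  The candidates are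
`c, c + 1, c - 1, c + 2, c - 2, …`, with number `i` tested next, those outside `{0, …, m}` being
skipped, and `R` is the probability of the candidates that are not yet tested. -/
noncomputable def binomialSearch (F : ℕ → ℝ) (m : ℕ) (q : ℝ) (c : ℕ) : ℕ → ℕ → ℝ → RandComp ℕ
  | 0, _, _ => pure c
  | fuel + 1, i, R => do
      let i' ← step (i + 1)
      let h ← step (i' / 2)
      let even ← step (i % 2 == 0)
      let x ← if even then step ((c : ℤ) - h) else step ((c : ℤ) + h)
      let nonneg ← step (decide (0 ≤ x))
      let small ← step (decide (x ≤ m))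
      if nonneg && small then do
        let b ← binomialWeight F m q x.toNat
        let r ← step (b / R)
        let hit ← coin r
        if hit then pure x.toNat
        else do
          let R' ← step (R - b)
          binomialSearch F m q c fuel i' R'
      else binomialSearch F m q c fuel i' R

/-- A binomial variate with parameters `m` and `q`: sequential search from the centre. -/
noncomputable def binomial (F : ℕ → ℝ) (m : ℕ) (q : ℝ) : RandComp ℕ := do
  let mean ← step ((m : ℝ) * q)
  let c ← step ⌊mean⌋₊
  binomialSearch F m q c (2 * m + 1) 0 1

/-- One trial.  With `N` as the initial value of `m`, generate a multinomial vector
`(N_1, N_2, …)` with `N` draws and cell probabilities `p_j = v_j / (1 - α)` one binomial component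
after the other, and accept it if `∑ j N_j = n - 1`.  Here `j` is the current cell, `m` the number
of draws that are left, `T` the probability of the cells `j, j + 1, …`, and `S` the current sum.
If draws are left after the cells `1, …, n`, then `∑ j N_j > n - 1` and the vector is rejected. -/
noncomputable def trial (α : ℝ) (v : ℕ → ℝ) (F : ℕ → ℝ) (n : ℕ) :
    ℕ → ℕ → ℕ → ℝ → ℕ → List (ℕ × ℕ) → RandComp (Option (List (ℕ × ℕ)))
  | 0, _, _, _, _, _ => pure none
  | fuel + 1, j, m, T, S, counts => do
      tick
      let done ← step (decide (m = 0))
      if done then do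
        let s ← step (n - 1)
        let ok ← step (decide (S = s))
        if ok then pure (some counts) else pure none
      else do
        let a ← readAt v j
        let d ← step (1 - α)
        let p ← step (a / d)
        let q ← step (p / T)
        let x ← binomial F m q
        let counts' ← step ((j, x) :: counts)
        let m' ← step (m - x)
        let T' ← step (T - p)
        let y ← step (j * x)
        let S' ← step (S + y)
        let j' ← step (j + 1)
        trial α v F n fuel j' m' T' S' counts'

/-! ### Shuffling, shifting, and building the tree -/

/-- Write `x` copies of `j` into the array `a`, from the position `pos` on. -/
noncomputable def fill (j : ℕ) : ℕ → ℕ → (ℕ → ℕ) → RandComp (ℕ → ℕ)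
  | 0, _, a => pure a
  | x + 1, pos, a => do
      tick
      let a' ← writeAt a pos j
      let pos' ← step (pos + 1)
      fill j x pos' a'

/-- For each entry `(j, x)` of the list in turn, write `x` copies of `j` into the array. -/
noncomputable def expand : List (ℕ × ℕ) → ℕ → (ℕ → ℕ) → RandComp (ℕ → ℕ)
  | [], _, a => pure a
  | (j, x) :: counts, pos, a => do
      tick
      let a' ← fill j x pos a
      let pos' ← step (pos + x)
      expand counts pos' a'

/-- Random permutation of the entries `0, …, m - 1` of an array, by random transpositions
(Fisher--Yates). -/
noncomputable def shuffle : ℕ → (ℕ → ℕ) → RandComp (ℕ → ℕ)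
  | 0, a => pure a
  | m + 1, a => do
      tick
      let i ← uniformBelow (m + 1)
      let x ← readAt a i
      let y ← readAt a m
      let a₁ ← writeAt a i y
      let a₂ ← writeAt a₁ m x
      shuffle m a₂

/-- The first time at which the path with the steps `a_j - 1` attains its minimum: `j` is the
current time, `W` the current value, `least` the minimum so far, attained first at `best`. -/
noncomputable def firstMin (a : ℕ → ℕ) : ℕ → ℕ → ℤ → ℤ → ℕ → RandComp ℕ
  | 0, _, _, _, best => pure best
  | fuel + 1, j, W, least, best => do
      tick
      let y ← readAt a j
      let z ← step ((y : ℤ) - 1)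
      let W' ← step (W + z)
      let j' ← step (j + 1)
      let lower ← step (decide (W' < least))
      if lower then firstMin a fuel j' W' W' j' else firstMin a fuel j' W' least best

/-- Cyclic shift by `s`: fill the first entries of `b` by `b_i = a_{(s + i) mod n}`. -/
noncomputable def cyclicShift (a : ℕ → ℕ) (n s : ℕ) : ℕ → (ℕ → ℕ) → RandComp (ℕ → ℕ)
  | 0, b => pure b
  | i + 1, b => do
      tick
      let r ← step (s + i)
      let r' ← step (r % n)
      let y ← readAt a r'
      let b' ← writeAt b i y
      cyclicShift a n s i b'

/-- Pop `d` trees from a stack; the popped trees and the rest of the stack. -/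
noncomputable def popTrees : ℕ → List OTree → RandComp (List OTree × List OTree)
  | 0, stack => pure ([], stack)
  | _ + 1, [] => pure ([], [])
  | d + 1, t :: stack => do
      tick
      let r ← popTrees d stack
      pure (t :: r.1, r.2)

/-- Read the degrees `b_{i - 1}, …, b_0` from the last to the first; a vertex with `d` children
takes the top `d` trees from the stack as its subtrees, and the new tree is pushed. -/
noncomputable def buildForest (b : ℕ → ℕ) : ℕ → List OTree → RandComp (List OTree)
  | 0, stack => pure stack
  | i + 1, stack => do
      tick
      let d ← readAt b i
      let r ← popTrees d stack
      let stack' ← step (OTree.node r.1 :: r.2)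
      buildForest b i stack'

/-- `σ⁻¹`: the tree with the preorder degree sequence `b_0, …, b_{n - 1}`. -/
noncomputable def buildTree (b : ℕ → ℕ) (n : ℕ) : RandComp OTree := do
  let stack ← buildForest b n []
  step (stack.headD (OTree.node []))

/-! ### The algorithm -/

/-- Step 1: a sample `ξ'_1, …, ξ'_{n - k}` (entries `0, …, n - k - 1` of the resulting array),
obtained by generating multinomial vectors until one has the right sum and by randomly permuting
the corresponding array.  The values `v_j` of the `α`-shifted distribution are given as a table. -/
noncomputable def sampleDegrees (α : ℝ) (v : ℕ → ℝ) (k n : ℕ) : RandComp (ℕ → ℕ) := do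
  let N ← step (n - k)
  let F ← factTable N
  let counts ← repeatUntil (trial α v F n n 1 N 1 0 [])
  let a ← expand counts 0 (fun _ => 0)
  shuffle N a

/-- The whole algorithm: the sample, a uniform permutation of the sample and `k` zeros,
the cyclic shift, and the tree. -/
noncomputable def algorithmA (α : ℝ) (v : ℕ → ℝ) (k n : ℕ) : RandComp OTree := do
  let a ← sampleDegrees α v k n
  let N ← step (n - k)
  let a₁ ← fill 0 k N a
  let a₂ ← shuffle n a₁
  let s ← firstMin a₂ n 0 0 0 0
  let b ← cyclicShift a₂ n s n (fun _ => 0)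
  buildTree b n

end ConditionedGW

open ConditionedGW

/-!
The proof treats a randomized computation as a measure on pairs (result, number of steps) and
computes, for each of the programs, its total mass, the law of its result and a bound of its mean
number of steps (`mass`, `law`, `cost`). For the deterministic loops all three are read off from an
exact description as `det b c`, "return `b` after `c` steps".

*The law.* Sequential search returns each candidate with the right conditional probability, so it
generates binomial variates (`law_binomial`), and a trial generates multinomial vectors
(`law_trial`). Expanding an accepted vector and shuffling it makes all arrangements of its entries
equally likely (`law_shuffle`), which gives independent entries conditioned on their sum
(`law_sampleDegrees_eq_condSumLaw`). With the zeros shuffled in, an array of `n` entries with the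
sum `n - 1` has a probability proportional to the product of the weights of its entries. By the
cycle lemma (`walk_rot_firstMin`, `isFirstMin_rot`) each tree comes from exactly the `n` cyclic
shifts of its degree sequence, so that the probability of a tree with `k` leaves and `n` vertices
is proportional to the product of its weights (`law_algorithmA`). The shift multiplies the
Galton--Watson weights of these trees by a common factor, and both laws have the total mass `1`
(`law_algorithmA_eq_condTreeLaw`).

*The running time.* Outside the repeated trials the algorithm takes linear time
(`cost_algorithmA_le`). The search for a binomial variate with `m` draws takes `O(√m)` steps on
average, the order of the standard deviation. In a trial with `N` draws the mean number of draws
left at the cell `j` is `N τ_j`, where the tail probabilities `τ_j` decrease geometrically, so that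
a trial costs `O(√N)` (`cost_trial_le`). It is accepted with the probability that the sum of `N`
independent variables is `n - 1`. This number is at bounded distance from the mean, so that the
probability is at least of order `1 / √n` by a local limit theorem (`exists_le_sumWeight`); hence
`O(√n)` trials of cost `O(√n)` suffice. The local limit theorem is proved by Fourier inversion: on
`[-π, π]` the Fourier series of the distribution is dominated by a Gaussian
(`exists_norm_fourier_le`), and rescaled powers converge to the Gaussian as in the central limit
theorem.

*The shift.* Conditioned on being positive, the distribution with weights proportional to `w_j t^j`
has the mean `psiHat w t`, and the shift requires this mean to be `1 / (1 - α)`. That value lies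
between the least positive element of the support, the mean at `t = 0`, and the limit `nuHat w`
(`exists_isAlphaShift`). Since `psiHat` is nondecreasing, the parameter of a shift is less than the
radius of convergence (`ofReal_lt_radius`), so that the weights of the shift decrease
geometrically.
-/

namespace ConditionedGW

/-! ### Calculus of randomized computations -/

section

open scoped Classical

namespace RandComp

variable {β γ : Type}

/-- The probability mass function of a randomized computation. -/
noncomputable def pmf (x : RandComp β) : β × ℕ → ℝ≥0∞ := x

/-- The total mass: the probability of halting. -/
noncomputable def mass (x : RandComp β) : ℝ≥0∞ := ∑' o : β × ℕ, x.pmf o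

/-- The expected number of steps, runs which do not halt being disregarded. -/
noncomputable def cost (x : RandComp β) : ℝ≥0∞ := ∑' o : β × ℕ, x.pmf o * (o.2 : ℝ≥0∞)

/-- The computation that returns `b` after exactly `c` steps. -/
noncomputable def det (b : β) (c : ℕ) : RandComp β := fun o => if o = (b, c) then 1 else 0

theorem pure_eq_det (b : β) : (pure b : RandComp β) = det b 0 := rfl

theorem step_eq_det (b : β) : step b = det b 1 := rfl

theorem readAt_eq_det (a : ℕ → β) (i : ℕ) : readAt a i = det (a i) 1 := rfl

theorem writeAt_eq_det (a : ℕ → β) (i : ℕ) (b : β) :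
    writeAt a i b = det (Function.update a i b) 1 := rfl

theorem tick_eq_det : tick = det () 1 := rfl

theorem bind_apply (x : RandComp β) (f : β → RandComp γ) (o : γ × ℕ) :
    (x >>= f).pmf o =
      ∑' b : β, ∑ c ∈ Finset.HasAntidiagonal.antidiagonal o.2, x.pmf (b, c.1) * (f b).pmf (o.1, c.2) := rfl

/-- Expectations under `x >>= f`: the step counts of the two stages add up. -/
theorem tsum_bind (x : RandComp β) (f : β → RandComp γ) (φ : γ × ℕ → ℝ≥0∞) :
    ∑' o, (x >>= f).pmf o * φ o = ∑' o, x.pmf o * ∑' o', (f o.1).pmf o' * φ (o'.1, o.2 + o'.2) := by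
  have h1 : ∀ o : γ × ℕ, (x >>= f).pmf o * φ o = ∑' b : β,
      ∑ c ∈ Finset.HasAntidiagonal.antidiagonal o.2,
        x.pmf (b, c.1) * (f b).pmf (o.1, c.2) * φ (o.1, c.1 + c.2) := by
    intro o
    rw [bind_apply, ← ENNReal.tsum_mul_right]
    refine tsum_congr fun b => ?_
    rw [Finset.sum_mul]
    refine Finset.sum_congr rfl fun c hc => ?_
    rw [Finset.HasAntidiagonal.mem_antidiagonal.1 hc]
  have h2 : ∀ (g : γ) (b : β), ∑' n : ℕ, ∑ c ∈ Finset.HasAntidiagonal.antidiagonal n,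
        x.pmf (b, c.1) * (f b).pmf (g, c.2) * φ (g, c.1 + c.2)
      = ∑' c₁ : ℕ, ∑' c₂ : ℕ, x.pmf (b, c₁) * (f b).pmf (g, c₂) * φ (g, c₁ + c₂) := by
    intro g b
    rw [← ENNReal.tsum_prod (f := fun c₁ c₂ => x.pmf (b, c₁) * (f b).pmf (g, c₂) * φ (g, c₁ + c₂)),
      ← (Finset.HasAntidiagonal.sigmaAntidiagonalEquivProd (A := ℕ)).tsum_eq, ENNReal.tsum_sigma']
    refine tsum_congr fun n => ?_
    rw [tsum_fintype]
    exact (Finset.sum_coe_sort (Finset.HasAntidiagonal.antidiagonal n)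
      (fun c => x.pmf (b, c.1) * (f b).pmf (g, c.2) * φ (g, c.1 + c.2))).symm
  simp_rw [h1]
  rw [ENNReal.tsum_prod']
  simp_rw [ENNReal.tsum_comm (α := ℕ) (β := β), h2]
  rw [ENNReal.tsum_comm, ENNReal.tsum_prod']
  refine tsum_congr fun b => ?_
  rw [ENNReal.tsum_comm]
  refine tsum_congr fun c₁ => ?_
  rw [← ENNReal.tsum_mul_left, ENNReal.tsum_prod']
  simp_rw [mul_assoc]

theorem law_eq_pmf (x : RandComp β) (b : β) : x.law b = ∑' c : ℕ, x.pmf (b, c) := rfl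

theorem tsum_law_mul (x : RandComp β) (g : β → ℝ≥0∞) :
    ∑' b, x.law b * g b = ∑' o, x.pmf o * g o.1 := by
  rw [ENNReal.tsum_prod']
  refine tsum_congr fun b => ?_
  rw [law_eq_pmf, ← ENNReal.tsum_mul_right]

theorem tsum_law (x : RandComp β) : ∑' b, x.law b = x.mass := by
  simpa [mass] using tsum_law_mul x (fun _ => 1)

theorem law_eq_tsum (x : RandComp β) (b : β) :
    x.law b = ∑' o, x.pmf o * (if o.1 = b then 1 else 0) := by
  rw [← tsum_law_mul x (fun b' => if b' = b then 1 else 0), tsum_eq_single b]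
  · simp
  · intro b' hb; simp [hb]

theorem law_bind (x : RandComp β) (f : β → RandComp γ) (b : γ) :
    (x >>= f).law b = ∑' a, x.law a * (f a).law b := by
  rw [law_eq_tsum, tsum_bind, tsum_law_mul]
  simp_rw [← law_eq_tsum]

theorem mass_bind (x : RandComp β) (f : β → RandComp γ) :
    (x >>= f).mass = ∑' a, x.law a * (f a).mass := by
  rw [tsum_law_mul]
  simpa [mass] using tsum_bind x f (fun _ => 1)

theorem mass_bind_eq_one {x : RandComp β} {f : β → RandComp γ} (hx : x.mass = 1)
    (hf : ∀ a, (f a).mass = 1) : (x >>= f).mass = 1 := by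
  rw [mass_bind]; simp [hf, tsum_law, hx]

theorem mass_bind_le_one {x : RandComp β} {f : β → RandComp γ} (hx : x.mass ≤ 1)
    (hf : ∀ a, (f a).mass ≤ 1) : (x >>= f).mass ≤ 1 := by
  rw [mass_bind]
  calc _ ≤ ∑' a, x.law a * 1 := by gcongr; exact hf _
    _ ≤ 1 := by simpa [tsum_law] using hx

theorem cost_bind_le {x : RandComp β} {f : β → RandComp γ} (hf : ∀ a, (f a).mass ≤ 1) :
    (x >>= f).cost ≤ x.cost + ∑' a, x.law a * (f a).cost := by
  rw [tsum_law_mul, cost, tsum_bind, cost, ← ENNReal.tsum_add]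
  refine ENNReal.tsum_le_tsum fun o => ?_
  rw [← mul_add]
  gcongr
  simp only [Nat.cast_add, mul_add, ENNReal.tsum_add, ENNReal.tsum_mul_right]
  refine add_le_add ?_ le_rfl
  exact mul_le_of_le_one_left' (hf o.1)

/-- The bound of `cost_bind_le` with a uniform bound of the second stage. -/
theorem cost_bind_le_add {x : RandComp β} {f : β → RandComp γ} (hx : x.mass ≤ 1)
    (hf : ∀ a, (f a).mass ≤ 1) {c d : ℝ≥0∞} (hc : x.cost ≤ c)
    (hd : ∀ a, x.law a ≠ 0 → (f a).cost ≤ d) :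
    (x >>= f).cost ≤ c + d := by
  refine (cost_bind_le hf).trans (add_le_add hc ?_)
  calc _ ≤ ∑' a, x.law a * d := by
        refine ENNReal.tsum_le_tsum fun a => ?_
        by_cases h : x.law a = 0
        · simp [h]
        · gcongr; exact hd a h
    _ = x.mass * d := by rw [ENNReal.tsum_mul_right, tsum_law]
    _ ≤ d := mul_le_of_le_one_left' hx

theorem pmf_det (b : β) (c : ℕ) (o : β × ℕ) : (det b c).pmf o = if o = (b, c) then 1 else 0 := rfl

theorem tsum_det_mul (b : β) (c : ℕ) (φ : β × ℕ → ℝ≥0∞) :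
    ∑' o, (det b c).pmf o * φ o = φ (b, c) := by
  rw [tsum_eq_single (b, c)]
  · simp [pmf_det]
  · intro o ho; simp [pmf_det, ho]

theorem mass_det (b : β) (c : ℕ) : (det b c).mass = 1 := by
  simpa [mass] using tsum_det_mul b c (fun _ => 1)

theorem cost_det (b : β) (c : ℕ) : (det b c).cost = c := tsum_det_mul b c _

theorem law_det (b : β) (c : ℕ) (b' : β) : (det b c).law b' = if b = b' then 1 else 0 := by
  rw [law_eq_tsum, tsum_det_mul b c (fun o => if o.1 = b' then 1 else 0)]

theorem law_det_bind (b : β) (c : ℕ) (f : β → RandComp γ) : (det b c >>= f).law = (f b).law := by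
  funext y
  rw [law_bind, tsum_eq_single b]
  · simp [law_det]
  · intro b' hb; simp [law_det, hb.symm]

theorem mass_det_bind (b : β) (c : ℕ) (f : β → RandComp γ) :
    (det b c >>= f).mass = (f b).mass := by
  rw [← tsum_law, law_det_bind, tsum_law]

theorem cost_det_bind_le {b : β} {c : ℕ} {f : β → RandComp γ} (hf : (f b).mass ≤ 1) :
    (det b c >>= f).cost ≤ c + (f b).cost := by
  rw [cost, tsum_bind, tsum_det_mul b c (fun o => ∑' o', (f o.1).pmf o' * ((o.2 + o'.2 : ℕ) : ℝ≥0∞))]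
  simp only [Nat.cast_add, mul_add, ENNReal.tsum_add, ENNReal.tsum_mul_right]
  refine add_le_add ?_ le_rfl
  exact mul_le_of_le_one_left' hf

theorem det_bind_det (b : β) (c : ℕ) (f : β → RandComp γ) {b' : γ} {c' : ℕ}
    (h : f b = det b' c') : (det b c >>= f) = det b' (c + c') := by
  suffices h : ∀ o, (det b c >>= f).pmf o = (det b' (c + c')).pmf o from funext h
  intro o
  rw [bind_apply, tsum_eq_single b]
  · rw [h]
    by_cases ho : o = (b', c + c')
    · subst ho
      rw [Finset.sum_eq_single (c, c')]
      · simp [pmf_det]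
      · rintro ⟨c1, c2⟩ _ hne
        have : ¬ (c1 = c ∧ c2 = c') := by simpa using hne
        by_cases h1 : c1 = c
        · have h2 : c2 ≠ c' := fun h2 => this ⟨h1, h2⟩
          simp [pmf_det, h2]
        · simp [pmf_det, h1]
      · intro hn; simp at hn
    · rw [show (det b' (c + c')).pmf o = 0 by simp [pmf_det, ho]]
      refine Finset.sum_eq_zero ?_
      rintro ⟨c1, c2⟩ hc
      rw [Finset.HasAntidiagonal.mem_antidiagonal] at hc
      by_cases h1 : c1 = c
      · by_cases h2 : (o.1, c2) = (b', c')
        · exfalso; apply ho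
          obtain ⟨o1, o2⟩ := o
          simp only [Prod.mk.injEq] at h2 ⊢
          simp only at hc
          exact ⟨h2.1, by rw [← hc, h1, h2.2]⟩
        · simp [pmf_det, h2]
      · simp [pmf_det, h1]
  · intro b'' hb
    refine Finset.sum_eq_zero fun c _ => ?_
    simp [pmf_det, hb]

theorem bind_eq_det {x : RandComp β} {f : β → RandComp γ} {b : β} {c : ℕ} {b' : γ} {c' : ℕ}
    (hx : x = det b c) (h : f b = det b' c') : (x >>= f) = det b' (c + c') := by
  rw [hx, det_bind_det b c f h]

/-- Spend `c` steps before running `y`. -/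
noncomputable def delay (c : ℕ) (y : RandComp β) : RandComp β :=
  fun o => if c ≤ o.2 then y.pmf (o.1, o.2 - c) else 0

theorem pmf_delay (c : ℕ) (y : RandComp β) (o : β × ℕ) :
    (delay c y).pmf o = if c ≤ o.2 then y.pmf (o.1, o.2 - c) else 0 := rfl

theorem det_bind (b : β) (c : ℕ) (f : β → RandComp γ) : (det b c >>= f) = delay c (f b) := by
  suffices h : ∀ o, (det b c >>= f).pmf o = (delay c (f b)).pmf o from funext h
  rintro ⟨g, n⟩
  rw [bind_apply, pmf_delay, tsum_eq_single b]
  · split_ifs with h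
    · rw [Finset.sum_eq_single (c, n - c)]
      · simp [pmf_det]
      · rintro ⟨c1, c2⟩ hc hne
        rw [Finset.HasAntidiagonal.mem_antidiagonal] at hc
        have h1 : c1 ≠ c := by
          rintro rfl
          simp only [ne_eq, Prod.mk.injEq, true_and] at hne
          simp only at hc
          omega
        simp [pmf_det, h1]
      · intro hn; exact absurd (by rw [Finset.HasAntidiagonal.mem_antidiagonal]; simp; omega) hn
    · refine Finset.sum_eq_zero ?_
      rintro ⟨c1, c2⟩ hc
      rw [Finset.HasAntidiagonal.mem_antidiagonal] at hc
      have h1 : c1 ≠ c := by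
        rintro rfl
        simp only at hc h
        omega
      simp [pmf_det, h1]
  · intro b' hb
    exact Finset.sum_eq_zero fun c _ => by simp [pmf_det, hb]

theorem delay_delay (c c' : ℕ) (y : RandComp β) : delay c (delay c' y) = delay (c + c') y := by
  suffices h : ∀ o, (delay c (delay c' y)).pmf o = (delay (c + c') y).pmf o from funext h
  rintro ⟨g, n⟩
  simp only [pmf_delay]
  by_cases h : c + c' ≤ n
  · rw [if_pos h, if_pos (by omega), if_pos (by omega), Nat.sub_sub]
  · rw [if_neg h]
    by_cases h' : c ≤ n
    · rw [if_pos h', if_neg (by omega)]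
    · rw [if_neg h']

theorem delay_det (c : ℕ) (b : β) (d : ℕ) : delay c (det b d) = det b (c + d) := by
  rw [← det_bind_det () c (fun _ => det b d) rfl, det_bind]

theorem law_delay (c : ℕ) (y : RandComp β) : (delay c y).law = y.law := by
  rw [← law_det_bind () c (fun _ => y), det_bind]

theorem mass_delay (c : ℕ) (y : RandComp β) : (delay c y).mass = y.mass := by
  rw [← mass_det_bind () c (fun _ => y), det_bind]

theorem cost_delay_le (c : ℕ) {y : RandComp β} (hy : y.mass ≤ 1) :
    (delay c y).cost ≤ c + y.cost := by
  have := cost_det_bind_le (b := ()) (c := c) (f := fun _ => y) hy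
  rwa [det_bind] at this

theorem expTime_eq_cost {x : RandComp β} (hx : x.mass = 1) : x.expTime = x.cost := by
  have : ∑' o : β × ℕ, x.pmf o = 1 := hx
  change x.cost + (1 - ∑' o : β × ℕ, x.pmf o) * ⊤ = x.cost
  simp [this]

theorem law_le_mass (x : RandComp β) (b : β) : x.law b ≤ x.mass := by
  rw [← tsum_law]; exact ENNReal.le_tsum b

/-! ### Repetition up to the first success -/

variable {body : RandComp (Option β)}

theorem pmf_repeatAtMost_zero (o : β × ℕ) : (repeatAtMost body 0).pmf o = 0 := rfl

theorem mass_repeatAtMost_le {body : RandComp (Option β)} (hb : body.mass = 1) (i : ℕ) :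
    (repeatAtMost body i).mass ≤ 1 := by
  induction i with
  | zero => simp [mass, pmf_repeatAtMost_zero]
  | succ i ih =>
    rw [repeatAtMost]
    refine mass_bind_le_one hb.le fun o => ?_
    cases o with
    | none => exact ih
    | some b => exact (mass_det b 0).le

theorem repeatAtMost_mono (body : RandComp (Option β)) :
    Monotone (fun i => (repeatAtMost body i).pmf) := by
  refine monotone_nat_of_le_succ fun i => ?_
  induction i with
  | zero => intro o; exact zero_le
  | succ i ih =>
    intro o
    beta_reduce
    rw [repeatAtMost, repeatAtMost]
    rw [bind_apply, bind_apply]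
    gcongr with b c
    cases b with
    | none => exact ih _
    | some b => exact le_rfl

theorem tsum_option (g : Option β → ℝ≥0∞) : ∑' o, g o = g none + ∑' b, g (some b) := by
  rw [← (Equiv.optionEquivSumPUnit.{0} β).symm.tsum_eq, ENNReal.summable.tsum_sum
    ENNReal.summable]
  simp [add_comm]

theorem tsum_iSup_of_monotone {ι : Type} (g : ℕ → ι → ℝ≥0∞) (hg : Monotone g) :
    ∑' o, ⨆ i, g i o = ⨆ i, ∑' o, g i o := by
  let _ : MeasurableSpace ι := ⊤
  simp_rw [← MeasureTheory.lintegral_count]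
  exact MeasureTheory.lintegral_iSup (fun _ => measurable_from_top) hg

theorem pmf_repeatUntil (o : β × ℕ) :
    (repeatUntil body).pmf o = ⨆ i, (repeatAtMost body i).pmf o := rfl

theorem tsum_repeatUntil (φ : β × ℕ → ℝ≥0∞) :
    ∑' o, (repeatUntil body).pmf o * φ o = ⨆ i, ∑' o, (repeatAtMost body i).pmf o * φ o := by
  rw [← tsum_iSup_of_monotone]
  · simp_rw [pmf_repeatUntil, ENNReal.iSup_mul]
  · intro i j hij o
    exact mul_le_mul_left (repeatAtMost_mono body hij o) _

theorem law_repeatAtMost (b : β) (i : ℕ) : (repeatAtMost body i).law b =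
    body.law (some b) * ∑ l ∈ Finset.range i, body.law none ^ l := by
  induction i with
  | zero => simp [law_eq_pmf, pmf_repeatAtMost_zero]
  | succ i ih =>
    rw [repeatAtMost, law_bind, tsum_option]
    simp only [pure_eq_det, law_det, ih]
    rw [tsum_eq_single b (by intro b' hb; simp [hb]), Finset.sum_range_succ' _ i]
    simp only [if_true, mul_one, pow_succ, ← Finset.sum_mul, pow_zero]
    ring

theorem law_repeatUntil (b : β) : (repeatUntil body).law b =
    body.law (some b) * (1 - body.law none)⁻¹ := by
  rw [law_eq_tsum, tsum_repeatUntil]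
  simp_rw [← law_eq_tsum, law_repeatAtMost, ← ENNReal.mul_iSup]
  rw [← ENNReal.tsum_eq_iSup_nat, ENNReal.tsum_geometric]

/-- The probability of success in one trial. -/
noncomputable def succ (body : RandComp (Option β)) : ℝ≥0∞ := ∑' b, body.law (some b)

theorem succ_eq (hb : body.mass = 1) : 1 - body.law none = succ body := by
  have h := tsum_law body
  rw [hb, tsum_option] at h
  have : body.law none ≠ ⊤ := ne_top_of_le_ne_top ENNReal.one_ne_top (hb ▸ law_le_mass body none)
  rw [← h, ENNReal.add_sub_cancel_left this, succ]

theorem succ_le_one (hb : body.mass = 1) : succ body ≤ 1 := by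
  rw [← succ_eq hb]; exact tsub_le_self

theorem mass_repeatUntil (hb : body.mass = 1) (hs : succ body ≠ 0) :
    (repeatUntil body).mass = 1 := by
  rw [← tsum_law]
  simp_rw [law_repeatUntil]
  rw [ENNReal.tsum_mul_right, succ_eq hb]
  exact ENNReal.mul_inv_cancel hs (ne_top_of_le_ne_top ENNReal.one_ne_top (succ_le_one hb))

/-- Wald's bound: the expected cost of one trial, divided by the probability of success. -/
theorem cost_repeatUntil_le (hb : body.mass = 1) :
    (repeatUntil body).cost ≤ body.cost * (succ body)⁻¹ := by
  have key : ∀ i, (repeatAtMost body i).cost ≤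
      body.cost * ∑ l ∈ Finset.range i, body.law none ^ l := by
    intro i
    induction i with
    | zero => simp [cost, pmf_repeatAtMost_zero]
    | succ i ih =>
      rw [repeatAtMost]
      refine (cost_bind_le ?_).trans ?_
      · intro o
        cases o with
        | none => exact mass_repeatAtMost_le hb i
        | some b => exact (mass_det b 0).le
      · rw [tsum_option]
        simp only [pure_eq_det, cost_det, Nat.cast_zero, mul_zero, tsum_zero, add_zero]
        rw [Finset.sum_range_succ' _ i]
        simp only [pow_succ, ← Finset.sum_mul, pow_zero, mul_add, mul_one]
        rw [add_comm]
        refine add_le_add ?_ le_rfl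
        calc _ ≤ body.law none * (body.cost * ∑ l ∈ Finset.range i, body.law none ^ l) := by gcongr
          _ = _ := by ring
  rw [cost, tsum_repeatUntil, ← succ_eq hb, ← ENNReal.tsum_geometric]
  refine iSup_le fun i => (key i).trans ?_
  gcongr
  exact ENNReal.sum_le_tsum _

end RandComp

end

/-! ### The deterministic loops -/

section

open scoped Classical
open RandComp

theorem factTable_eq (m : ℕ) :
    factTable m = det (fun i => if i ≤ m then (i.factorial : ℝ) else 0) (4 * m + 1) := by
  induction m with
  | zero =>
    rw [factTable, writeAt_eq_det]
    congr 1
    funext i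
    by_cases hi : i = 0
    · subst hi; simp
    · simp [hi]
  | succ m ih =>
    rw [factTable, ih]
    refine Eq.trans (bind_eq_det rfl (bind_eq_det rfl (det_bind_det _ _ _
      (bind_eq_det rfl rfl)))) ?_
    congr 1
    · funext i
      rcases lt_trichotomy i (m + 1) with h | h | h
      · simp [h.ne, Nat.lt_succ_iff.1 h, h.le]
      · subst h
        simp [Nat.factorial_succ, mul_comm]
      · simp [h.ne', not_le.2 h, not_le.2 ((Nat.lt_succ_self m).trans h)]
    · omega

theorem fill_eq (j x pos : ℕ) (a : ℕ → ℕ) :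
    fill j x pos a = det (fun i => if pos ≤ i ∧ i < pos + x then j else a i) (3 * x) := by
  induction x generalizing pos a with
  | zero =>
    rw [fill, pure_eq_det]
    congr 1
    funext i
    rw [if_neg (by omega)]
  | succ x ih =>
    rw [fill]
    refine Eq.trans (bind_eq_det rfl (bind_eq_det rfl (bind_eq_det rfl (ih _ _)))) ?_
    congr 1
    · funext i
      by_cases h : i = pos
      · subst h; simp
      · rw [Function.update_of_ne h]
        congr 1
        apply propext
        omega
    · omega

/-- The multiset of the entries `0, …, m - 1` of an array. -/
def entries (a : ℕ → ℕ) (m : ℕ) : Multiset ℕ := (Multiset.range m).map a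

/-- The multiset described by a list of pairs (value, multiplicity). -/
def ofCounts : List (ℕ × ℕ) → Multiset ℕ
  | [] => 0
  | (j, x) :: L => Multiset.replicate x j + ofCounts L

theorem entries_zero (a : ℕ → ℕ) : entries a 0 = 0 := rfl

theorem entries_succ (a : ℕ → ℕ) (m : ℕ) : entries a (m + 1) = a m ::ₘ entries a m := by
  simp [entries, Multiset.range_succ]

theorem entries_card (a : ℕ → ℕ) (m : ℕ) : (entries a m).card = m := by simp [entries]

theorem entries_congr {a b : ℕ → ℕ} {m : ℕ} (h : ∀ i < m, a i = b i) :
    entries a m = entries b m :=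
  Multiset.map_congr rfl fun i hi => h i (Multiset.mem_range.1 hi)

theorem entries_add (a : ℕ → ℕ) (m l : ℕ) :
    entries a (m + l) = entries a m + entries (fun i => a (m + i)) l := by
  induction l with
  | zero => simp [entries_zero]
  | succ l ih => rw [← add_assoc, entries_succ, ih, entries_succ, Multiset.add_cons]

theorem entries_const (j m : ℕ) : entries (fun _ => j) m = Multiset.replicate m j := by
  simp [entries]

theorem expand_eq (L : List (ℕ × ℕ)) (pos : ℕ) (a : ℕ → ℕ) :
    ∃ b : ℕ → ℕ, ∃ c : ℕ, expand L pos a = det b c ∧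
      c = 2 * L.length + 3 * (ofCounts L).card ∧
      (∀ i, i < pos ∨ pos + (ofCounts L).card ≤ i → b i = a i) ∧
      entries (fun i => b (pos + i)) (ofCounts L).card = ofCounts L := by
  induction L generalizing pos a with
  | nil => exact ⟨a, 0, by rw [expand, pure_eq_det], by simp [ofCounts], fun _ _ => rfl, rfl⟩
  | cons hd L ih =>
    obtain ⟨j, x⟩ := hd
    obtain ⟨b, c, h1, h2, h3, h4⟩ := ih (pos + x)
      (fun i => if pos ≤ i ∧ i < pos + x then j else a i)
    refine ⟨b, 1 + (3 * x + (1 + c)), ?_, ?_, ?_, ?_⟩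
    · rw [expand, fill_eq]
      exact bind_eq_det rfl (bind_eq_det rfl (bind_eq_det rfl h1))
    · simp only [h2, ofCounts, List.length_cons, Multiset.card_add, Multiset.card_replicate]; ring
    · intro i hi
      simp only [ofCounts, Multiset.card_add, Multiset.card_replicate] at hi
      rw [h3 i (by omega), if_neg (by omega)]
    · simp only [ofCounts, Multiset.card_add, Multiset.card_replicate]
      rw [entries_add]
      congr 1
      · rw [← entries_const]
        refine entries_congr fun i hi => ?_
        rw [h3 _ (by omega), if_pos (by omega)]
      · simp_rw [← add_assoc]; exact h4

/-- The path with the steps `a_j - 1`. -/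
def walk (a : ℕ → ℕ) (j : ℕ) : ℤ := ∑ i ∈ Finset.range j, ((a i : ℤ) - 1)

theorem walk_succ (a : ℕ → ℕ) (j : ℕ) : walk a (j + 1) = walk a j + ((a j : ℤ) - 1) :=
  Finset.sum_range_succ _ _

/-- `s` is the first time in `{0, …, n}` at which the path of `a` attains its minimum. -/
def IsFirstMin (a : ℕ → ℕ) (n s : ℕ) : Prop :=
  s ≤ n ∧ (∀ i ≤ n, walk a s ≤ walk a i) ∧ ∀ i < s, walk a s < walk a i

theorem IsFirstMin.unique {a : ℕ → ℕ} {n s s' : ℕ} (h : IsFirstMin a n s)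
    (h' : IsFirstMin a n s') : s = s' := by
  rcases lt_trichotomy s s' with hl | hl | hl
  · exact absurd (h.2.1 s' h'.1) (not_le.2 (h'.2.2 s hl))
  · exact hl
  · exact absurd (h'.2.1 s h.1) (not_le.2 (h.2.2 s' hl))

theorem firstMin_eq_aux (a : ℕ → ℕ) (fuel j best : ℕ) (h : IsFirstMin a j best) :
    ∃ s, firstMin a fuel j (walk a j) (walk a best) best = det s (6 * fuel) ∧
      IsFirstMin a (j + fuel) s := by
  induction fuel generalizing j best with
  | zero => exact ⟨best, by rw [firstMin, pure_eq_det], h⟩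
  | succ fuel ih =>
    by_cases hl : walk a (j + 1) < walk a best
    · obtain ⟨s, h1, h2⟩ := ih (j + 1) (j + 1) ⟨le_rfl, fun i hi => by
        rcases Nat.lt_or_ge j i with h' | h'
        · rw [show i = j + 1 by omega]
        · exact hl.le.trans (h.2.1 i h'), fun i hi => hl.trans_le (h.2.1 i (by omega))⟩
      refine ⟨s, ?_, by rwa [show j + (fuel + 1) = j + 1 + fuel by ring]⟩
      rw [firstMin]
      refine Eq.trans (bind_eq_det rfl (bind_eq_det rfl (bind_eq_det rfl (det_bind_det _ _ _
        (bind_eq_det rfl (bind_eq_det rfl (c' := 6 * fuel) (b' := s) ?_)))))) ?_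
      · rw [← walk_succ, if_pos (by simpa using hl), h1]
      · congr 1; ring
    · obtain ⟨s, h1, h2⟩ := ih (j + 1) best ⟨h.1.trans (Nat.le_succ j), fun i hi => by
        rcases Nat.lt_or_ge j i with h' | h'
        · rw [show i = j + 1 by omega]; exact not_lt.1 hl
        · exact h.2.1 i h', h.2.2⟩
      refine ⟨s, ?_, by rwa [show j + (fuel + 1) = j + 1 + fuel by ring]⟩
      rw [firstMin]
      refine Eq.trans (bind_eq_det rfl (bind_eq_det rfl (bind_eq_det rfl (det_bind_det _ _ _
        (bind_eq_det rfl (bind_eq_det rfl (c' := 6 * fuel) (b' := s) ?_)))))) ?_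
      · rw [← walk_succ, if_neg (by simpa using hl), h1]
      · congr 1; ring

theorem firstMin_eq (a : ℕ → ℕ) (n : ℕ) :
    ∃ s, firstMin a n 0 0 0 0 = det s (6 * n) ∧ IsFirstMin a n s := by
  obtain ⟨s, h1, h2⟩ := firstMin_eq_aux a n 0 0
    ⟨le_rfl, fun i hi => by rw [Nat.le_zero.1 hi], fun i hi => absurd hi (Nat.not_lt_zero i)⟩
  exact ⟨s, h1, by simpa using h2⟩

theorem cyclicShift_eq (a : ℕ → ℕ) (n s i : ℕ) (b : ℕ → ℕ) :
    cyclicShift a n s i b = det (fun l => if l < i then a ((s + l) % n) else b l) (5 * i) := by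
  induction i generalizing b with
  | zero => rw [cyclicShift, pure_eq_det]; simp
  | succ i ih =>
    rw [cyclicShift]
    refine Eq.trans (bind_eq_det rfl (bind_eq_det rfl (bind_eq_det rfl (det_bind_det _ _ _
        (bind_eq_det rfl (ih _)))))) ?_
    congr 1
    · funext l
      rcases lt_trichotomy l i with h | h | h
      · simp [h, h.trans (Nat.lt_succ_self i)]
      · subst h; simp
      · rw [if_neg (by omega), if_neg (by omega), Function.update_of_ne (by omega)]
    · ring

theorem popTrees_eq (d : ℕ) (stack : List OTree) :
    popTrees d stack = det (stack.take d, stack.drop d) (min d stack.length) := by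
  induction d generalizing stack with
  | zero => rw [popTrees, pure_eq_det]; simp
  | succ d ih =>
    cases stack with
    | nil => rw [popTrees, pure_eq_det]; simp
    | cons t stack =>
      rw [popTrees]
      refine Eq.trans (bind_eq_det rfl (bind_eq_det (ih stack) rfl)) ?_
      · congr 1
        simp only [List.length_cons]; omega

/-- The stack of trees obtained by reading the degrees `l` from the last to the first. -/
def parse (l : List ℕ) (stack : List OTree) : List OTree :=
  l.foldr (fun d st => OTree.node (st.take d) :: st.drop d) stack

theorem buildForest_eq (b : ℕ → ℕ) (i : ℕ) (stack : List OTree) :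
    ∃ c, buildForest b i stack = det (parse ((List.range i).map b) stack) c ∧
      c ≤ 4 * i + stack.length := by
  induction i generalizing stack with
  | zero => exact ⟨0, by rw [buildForest, pure_eq_det]; rfl, Nat.zero_le _⟩
  | succ i ih =>
    obtain ⟨c, h1, h2⟩ := ih (OTree.node (stack.take (b i)) :: stack.drop (b i))
    refine ⟨1 + (1 + (min (b i) stack.length + (1 + c))), ?_, ?_⟩
    · rw [buildForest]
      refine Eq.trans (bind_eq_det rfl (bind_eq_det rfl (bind_eq_det (popTrees_eq (b i) stack)
        (bind_eq_det rfl h1)))) ?_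
      rw [List.range_succ, List.map_append, parse, parse, List.foldr_append]
      rfl
    · simp only [List.length_cons, List.length_drop] at h2
      omega

theorem buildTree_eq (b : ℕ → ℕ) (n : ℕ) :
    ∃ c, buildTree b n =
      det ((parse ((List.range n).map b) []).headD (OTree.node [])) c ∧ c ≤ 4 * n + 1 := by
  obtain ⟨c, h1, h2⟩ := buildForest_eq b n []
  refine ⟨c + 1, ?_, by simpa using h2⟩
  rw [buildTree, h1]
  exact bind_eq_det rfl rfl

/-! ### The Fisher--Yates shuffle -/

/-- The number of permutations of a list with the entries `M` that fix the list. -/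
noncomputable def stab (M : Multiset ℕ) : ℕ := ∏ x ∈ M.toFinset, (M.count x).factorial

theorem stab_pos (M : Multiset ℕ) : 0 < stab M :=
  Finset.prod_pos fun _ _ => Nat.factorial_pos _

theorem stab_eq_prod {M : Multiset ℕ} {s : Finset ℕ} (hs : M.toFinset ⊆ s) :
    stab M = ∏ x ∈ s, (M.count x).factorial := by
  refine Finset.prod_subset hs fun x _ hx => ?_
  rw [Multiset.mem_toFinset] at hx
  simp [hx]

theorem stab_cons (x : ℕ) (M : Multiset ℕ) : stab (x ::ₘ M) = (M.count x + 1) * stab M := by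
  rw [stab, stab_eq_prod (M := M) (s := (x ::ₘ M).toFinset) (by
    intro y hy; simp at hy ⊢; exact Or.inr hy),
    ← Finset.mul_prod_erase _ _ (show x ∈ (x ::ₘ M).toFinset by simp),
    ← Finset.mul_prod_erase (a := x) _ (fun y => (M.count y).factorial)
      (show x ∈ (x ::ₘ M).toFinset by simp), ← mul_assoc]
  congr 1
  · simp [Nat.factorial_succ]
  · refine Finset.prod_congr rfl fun y hy => ?_
    rw [Multiset.count_cons_of_ne (Finset.ne_of_mem_erase hy)]

theorem law_uniformBelow (m i : ℕ) :
    (uniformBelow m).law i = if i < m then (m : ℝ≥0∞)⁻¹ else 0 := by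
  rw [law, tsum_eq_single 1]
  · simp [uniformBelow]
  · intro c hc; simp [uniformBelow, hc]

theorem mass_uniformBelow (m : ℕ) : (uniformBelow (m + 1)).mass = 1 := by
  rw [← tsum_law]
  simp_rw [law_uniformBelow]
  rw [tsum_eq_sum (s := Finset.range (m + 1)) (by intro i hi; simpa using hi),
    Finset.sum_congr rfl (g := fun _ => ((m + 1 : ℕ) : ℝ≥0∞)⁻¹)
      (by intro i hi; rw [if_pos (Finset.mem_range.1 hi)])]
  simp only [Finset.sum_const, Finset.card_range, nsmul_eq_mul]
  exact ENNReal.mul_inv_cancel (by simp) (by simp)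

theorem cost_uniformBelow (m : ℕ) : (uniformBelow (m + 1)).cost = 1 := by
  rw [← mass_uniformBelow m, cost, mass]
  refine tsum_congr fun o => ?_
  change uniformBelow (m + 1) o * _ = uniformBelow (m + 1) o
  by_cases h : o.2 = 1
  · simp [h]
  · simp [uniformBelow, h]

theorem law_shuffle_succ (m : ℕ) (a b : ℕ → ℕ) : (shuffle (m + 1) a).law b =
    ∑ i ∈ Finset.range (m + 1), ((m + 1 : ℕ) : ℝ≥0∞)⁻¹ *
      (shuffle m (Function.update (Function.update a i (a m)) m (a i))).law b := by
  rw [shuffle, tick_eq_det, law_det_bind, law_bind]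
  simp only [readAt_eq_det, writeAt_eq_det, law_det_bind, law_uniformBelow]
  rw [tsum_eq_sum (s := Finset.range (m + 1))
    (by intro i hi; rw [if_neg (by simpa using hi), zero_mul])]
  exact Finset.sum_congr rfl fun i hi => by rw [if_pos (Finset.mem_range.1 hi)]

theorem mass_shuffle (m : ℕ) (a : ℕ → ℕ) : (shuffle m a).mass = 1 := by
  induction m generalizing a with
  | zero => exact mass_det _ _
  | succ m ih =>
    rw [shuffle, tick_eq_det, mass_det_bind]
    refine mass_bind_eq_one (mass_uniformBelow m) fun i => ?_
    simp only [readAt_eq_det, writeAt_eq_det, mass_det_bind, ih]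

theorem cost_shuffle_le (m : ℕ) (a : ℕ → ℕ) : (shuffle m a).cost ≤ (6 * m : ℕ) := by
  induction m generalizing a with
  | zero => exact (cost_det _ _).le
  | succ m ih =>
    have h4 : ∀ i : ℕ, (readAt a i >>= fun x => readAt a m >>= fun y => writeAt a i y >>= fun a₁ =>
        writeAt a₁ m x >>= fun a₂ => shuffle m a₂).mass = 1 := fun i => by
      simp only [readAt_eq_det, writeAt_eq_det, mass_det_bind, mass_shuffle]
    rw [shuffle]
    refine le_trans (cost_det_bind_le (b := ()) (c := 1) (mass_bind_le_one (mass_uniformBelow m).le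
      fun i => (h4 i).le)) ?_
    have := cost_bind_le_add (c := 1) (d := (4 + 6 * m : ℕ)) (mass_uniformBelow m).le
      (fun i => (h4 i).le)
      (cost_uniformBelow m).le (fun i _ => by
        simp only [readAt_eq_det, writeAt_eq_det]
        refine (cost_det_bind_le (by simp only [mass_det_bind, mass_shuffle, le_refl])).trans ?_
        refine (add_le_add le_rfl (cost_det_bind_le
          (by simp only [mass_det_bind, mass_shuffle, le_refl]))).trans ?_
        refine (add_le_add le_rfl (add_le_add le_rfl (cost_det_bind_le
          (by simp only [mass_det_bind, mass_shuffle, le_refl])))).trans ?_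
        refine (add_le_add le_rfl (add_le_add le_rfl (add_le_add le_rfl (cost_det_bind_le
          (by simp only [mass_shuffle, le_refl]))))).trans ?_
        refine (add_le_add le_rfl (add_le_add le_rfl (add_le_add le_rfl (add_le_add le_rfl
          (ih _))))).trans ?_
        norm_cast
        omega)
    refine (add_le_add le_rfl this).trans ?_
    norm_cast
    omega

theorem entries_comp_swap (a : ℕ → ℕ) {i m : ℕ} (hi : i ≤ m) :
    entries (Function.update (Function.update a i (a m)) m (a i)) (m + 1) = entries a (m + 1) := by
  have h1 : Function.update (Function.update a i (a m)) m (a i) = a ∘ Equiv.swap i m := by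
    funext l
    by_cases hm : l = m
    · subst hm; simp
    · by_cases hl : l = i
      · subst hl; simp [hm]
      · simp [hm, hl, Equiv.swap_apply_of_ne_of_ne hl hm]
  have h2 : (Multiset.range (m + 1)).map (Equiv.swap i m) = Multiset.range (m + 1) := by
    have := Finset.map_perm (σ := Equiv.swap i m) (s := Finset.range (m + 1)) (by
      intro l hl
      by_contra h
      have h' : m < l := by simpa using h
      exact hl (Equiv.swap_apply_of_ne_of_ne (by omega) (by omega)))
    simpa using congrArg Finset.val this
  rw [entries, h1, ← Multiset.map_map, h2, entries]

/-- The shuffle makes all rearrangements of the entries equally likely. -/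
theorem law_shuffle (m : ℕ) (a b : ℕ → ℕ) : (shuffle m a).law b =
    if (∀ i, m ≤ i → b i = a i) ∧ entries a m = entries b m then
      (stab (entries b m) : ℝ≥0∞) / (m.factorial : ℝ≥0∞) else 0 := by
  induction m generalizing a with
  | zero =>
    rw [shuffle, pure_eq_det, law_det]
    have : (a = b) ↔ ((∀ i, 0 ≤ i → b i = a i) ∧ entries a 0 = entries b 0) := by
      simp only [Nat.zero_le, true_imp_iff, entries_zero, and_true]
      exact ⟨fun h => by simp [h], fun h => funext fun i => (h i).symm⟩
    rw [if_congr this rfl rfl]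
    simp [entries_zero, stab]
  | succ m ih =>
    rw [law_shuffle_succ]
    have key : ∀ i ∈ Finset.range (m + 1), ((m + 1 : ℕ) : ℝ≥0∞)⁻¹ *
        (shuffle m (Function.update (Function.update a i (a m)) m (a i))).law b =
        (if a i = b m then 1 else 0) * (if (∀ i, m + 1 ≤ i → b i = a i) ∧
          entries a (m + 1) = entries b (m + 1) then
          (stab (entries b m) : ℝ≥0∞) / ((m + 1).factorial : ℝ≥0∞) else 0) := by
      intro i hi
      have hi' : i ≤ m := Nat.lt_succ_iff.1 (Finset.mem_range.1 hi)
      have hE := entries_comp_swap a hi'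
      rw [ih]
      set a₂ := Function.update (Function.update a i (a m)) m (a i) with ha₂
      have hm : a₂ m = a i := by simp [ha₂]
      have hiff : ((∀ l, m ≤ l → b l = a₂ l) ∧ entries a₂ m = entries b m) ↔
          (a i = b m ∧ (∀ l, m + 1 ≤ l → b l = a l) ∧
            entries a (m + 1) = entries b (m + 1)) := by
        have hge : ∀ l, m + 1 ≤ l → a₂ l = a l := fun l hl => by
          rw [ha₂, Function.update_of_ne (by omega), Function.update_of_ne (by omega)]
        rw [← hE, entries_succ, entries_succ, hm]
        constructor
        · rintro ⟨h1, h2⟩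
          have h3 : a i = b m := by rw [h1 m le_rfl, hm]
          exact ⟨h3, fun l hl => by rw [h1 l (by omega), hge l hl], by rw [h2, h3]⟩
        · rintro ⟨h3, h1, h2⟩
          refine ⟨fun l hl => ?_, ?_⟩
          · rcases hl.eq_or_lt with h | h
            · rw [← h, hm, h3]
            · rw [h1 l h, hge l h]
          · rw [h3] at h2; exact (Multiset.cons_inj_right _).1 h2
      by_cases hc : a i = b m
      · rw [if_pos hc, one_mul, mul_ite, mul_zero]
        refine if_congr (hiff.trans (by simp [hc])) ?_ rfl
        rw [Nat.factorial_succ, Nat.cast_mul, div_eq_mul_inv, div_eq_mul_inv,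
          ENNReal.mul_inv (by simp) (by simp)]
        ring
      · rw [if_neg (fun h => hc (hiff.1 h).1), if_neg hc, mul_zero, zero_mul]
    rw [Finset.sum_congr rfl key, ← Finset.sum_mul]
    by_cases hC : (∀ i, m + 1 ≤ i → b i = a i) ∧ entries a (m + 1) = entries b (m + 1)
    · rw [if_pos hC, if_pos hC]
      have hcount : ∑ i ∈ Finset.range (m + 1), (if a i = b m then (1 : ℝ≥0∞) else 0)
          = ((entries a (m + 1)).count (b m) : ℕ) := by
        rw [entries, Multiset.count_map, Finset.sum_boole]
        simp only [eq_comm]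
        rfl
      rw [hcount, hC.2, entries_succ, stab_cons, Multiset.count_cons_self, ← mul_div_assoc]
      norm_cast
    · rw [if_neg hC, if_neg hC, mul_zero]

end

/-! ### Binomial variates by sequential search -/

section

open scoped Classical
open RandComp

/-- The weights of the binomial distribution with parameters `m` and `q`. -/
noncomputable def binWeight (m : ℕ) (q : ℝ) (x : ℕ) : ℝ := m.choose x * q ^ x * (1 - q) ^ (m - x)

theorem binWeight_nonneg {m : ℕ} {q : ℝ} (h0 : 0 ≤ q) (h1 : q ≤ 1) (x : ℕ) :
    0 ≤ binWeight m q x := by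
  have : 0 ≤ 1 - q := sub_nonneg.2 h1
  unfold binWeight; positivity

theorem binWeight_eq_bernstein (m : ℕ) (q : ℝ) (x : ℕ) :
    binWeight m q x = (bernsteinPolynomial ℝ m x).eval q := by
  simp [binWeight, bernsteinPolynomial]

theorem sum_binWeight (m : ℕ) (q : ℝ) : ∑ x ∈ Finset.range (m + 1), binWeight m q x = 1 := by
  simp_rw [binWeight_eq_bernstein]
  rw [← Polynomial.eval_finsetSum, bernsteinPolynomial.sum, Polynomial.eval_one]

theorem sum_binWeight_mul (m : ℕ) (q : ℝ) :
    ∑ x ∈ Finset.range (m + 1), binWeight m q x * x = m * q := by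
  have := congrArg (Polynomial.eval q) (bernsteinPolynomial.sum_smul ℝ m)
  rw [Polynomial.eval_finsetSum] at this
  simp only [nsmul_eq_mul, Polynomial.eval_mul, Polynomial.eval_natCast, Polynomial.eval_X,
    ← binWeight_eq_bernstein] at this
  rw [← this]
  exact Finset.sum_congr rfl fun x _ => mul_comm _ _

theorem sum_binWeight_sq (m : ℕ) (q : ℝ) :
    ∑ x ∈ Finset.range (m + 1), binWeight m q x * (x - m * q) ^ 2 = m * q * (1 - q) := by
  have := congrArg (Polynomial.eval q) (bernsteinPolynomial.variance ℝ m)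
  rw [Polynomial.eval_finsetSum] at this
  simp only [nsmul_eq_mul, Polynomial.eval_mul, Polynomial.eval_natCast, Polynomial.eval_X,
    ← binWeight_eq_bernstein, Polynomial.eval_pow, Polynomial.eval_sub, Polynomial.eval_one] at this
  rw [← this]
  exact Finset.sum_congr rfl fun x _ => by ring

/-- The mean deviation from the starting point of the search is of the order of the standard
deviation, by the inequality `2 d ≤ d ^ 2 / √m + √m`. -/
theorem sum_binWeight_abs_le {m : ℕ} (hm : 1 ≤ m) {q : ℝ} (h0 : 0 ≤ q) (h1 : q ≤ 1) :
    ∑ x ∈ Finset.range (m + 1), binWeight m q x * |(x : ℝ) - (⌊(m : ℝ) * q⌋₊ : ℝ)| ≤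
      2 * √(m : ℝ) := by
  set c : ℝ := (⌊(m : ℝ) * q⌋₊ : ℝ) with hc
  have hm' : (1 : ℝ) ≤ m := by exact_mod_cast hm
  have hs : 0 < √(m : ℝ) := Real.sqrt_pos.2 (by linarith)
  have hs2 : √(m : ℝ) * √(m : ℝ) = m := Real.mul_self_sqrt (by linarith)
  have hmq : 0 ≤ (m : ℝ) * q := by positivity
  have hc1 : c ≤ m * q := Nat.floor_le hmq
  have hc2 : (m : ℝ) * q < c + 1 := Nat.lt_floor_add_one _
  have hpt : ∀ x ∈ Finset.range (m + 1), binWeight m q x * |(x : ℝ) - c| ≤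
      (√(m : ℝ))⁻¹ * (binWeight m q x * (x - m * q) ^ 2) +
      ((√(m : ℝ))⁻¹ + √(m : ℝ) / 2) * binWeight m q x := by
    intro x _
    have hb := binWeight_nonneg (m := m) h0 h1 x
    have : |(x : ℝ) - c| ≤ (√(m : ℝ))⁻¹ * (x - m * q) ^ 2 + ((√(m : ℝ))⁻¹ + √(m : ℝ) / 2) := by
      have e1 : |(x : ℝ) - c| ^ 2 = (x - c) ^ 2 := sq_abs _
      have e2 : ((x : ℝ) - c) ^ 2 ≤ 2 * (x - m * q) ^ 2 + 2 := by
        nlinarith [sq_nonneg (((x : ℝ) - m * q) - (m * q - c))]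
      have e3 : |(x : ℝ) - c| * √(m : ℝ) ≤ (x - m * q) ^ 2 + 1 + m / 2 := by
        nlinarith [sq_nonneg (|(x : ℝ) - c| - √(m : ℝ))]
      have e4 : (√(m : ℝ))⁻¹ * (x - m * q) ^ 2 + ((√(m : ℝ))⁻¹ + √(m : ℝ) / 2) =
          ((x - m * q) ^ 2 + 1 + m / 2) / √(m : ℝ) := by
        rw [← hs2]; field_simp; simp; ring
      rw [e4, le_div_iff₀ hs]; exact e3
    calc _ ≤ binWeight m q x * ((√(m : ℝ))⁻¹ * (x - m * q) ^ 2 +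
          ((√(m : ℝ))⁻¹ + √(m : ℝ) / 2)) := by gcongr
      _ = _ := by ring
  refine (Finset.sum_le_sum hpt).trans ?_
  rw [Finset.sum_add_distrib, ← Finset.mul_sum, ← Finset.mul_sum, sum_binWeight_sq, sum_binWeight]
  have hs1 : 1 ≤ √(m : ℝ) := Real.one_le_sqrt.2 hm'
  have hi : (√(m : ℝ))⁻¹ ≤ √(m : ℝ) := (inv_le_one_of_one_le₀ hs1).trans hs1
  have hq : (m : ℝ) * q * (1 - q) ≤ m / 4 := by nlinarith [sq_nonneg (q - 1 / 2)]
  have : (√(m : ℝ))⁻¹ * (m * q * (1 - q)) ≤ √(m : ℝ) / 4 := by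
    calc _ ≤ (√(m : ℝ))⁻¹ * (m / 4) := by gcongr
      _ = _ := by rw [← hs2]; field_simp; simp
  linarith [inv_le_one_of_one_le₀ hs1]

theorem sum_binWeight_sqrt_le (m : ℕ) {q : ℝ} (h0 : 0 ≤ q) (h1 : q ≤ 1) :
    ∑ x ∈ Finset.range (m + 1), binWeight m q x * √((m - x : ℕ) : ℝ) ≤ √(m : ℝ) * √(1 - q) := by
  have hb := fun x => binWeight_nonneg (m := m) h0 h1 x
  have h := Real.sum_sqrt_mul_sqrt_le (Finset.range (m + 1)) (f := binWeight m q)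
    (g := fun x => binWeight m q x * ((m - x : ℕ) : ℝ)) hb
    (fun x => mul_nonneg (hb x) (Nat.cast_nonneg _))
  have e1 : ∀ x, √(binWeight m q x) * √(binWeight m q x * ((m - x : ℕ) : ℝ)) =
      binWeight m q x * √((m - x : ℕ) : ℝ) := fun x => by
    rw [Real.sqrt_mul (hb x), ← mul_assoc, Real.mul_self_sqrt (hb x)]
  simp_rw [e1] at h
  refine h.trans (le_of_eq ?_)
  rw [sum_binWeight, Real.sqrt_one, one_mul, ← Real.sqrt_mul (Nat.cast_nonneg m)]
  congr 1
  have e2 : ∀ x ∈ Finset.range (m + 1), binWeight m q x * ((m - x : ℕ) : ℝ) =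
      m * binWeight m q x - binWeight m q x * x := fun x hx => by
    rw [Nat.cast_sub (Nat.lt_succ_iff.1 (Finset.mem_range.1 hx))]; ring
  rw [Finset.sum_congr rfl e2, Finset.sum_sub_distrib, ← Finset.mul_sum, sum_binWeight,
    sum_binWeight_mul]
  ring

theorem law_coin_true (r : ℝ) : (coin r).law true = min 1 (ENNReal.ofReal r) := by
  rw [law, tsum_eq_single 1]
  · simp [coin]
  · intro c hc; simp [coin, hc]

theorem law_coin_false (r : ℝ) : (coin r).law false = 1 - min 1 (ENNReal.ofReal r) := by
  rw [law, tsum_eq_single 1]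
  · simp [coin]
  · intro c hc; simp [coin, hc]

theorem mass_coin (r : ℝ) : (coin r).mass = 1 := by
  rw [← tsum_law, tsum_bool, law_coin_true, law_coin_false]
  exact tsub_add_cancel_of_le (min_le_left _ _)

theorem cost_coin (r : ℝ) : (coin r).cost = 1 := by
  rw [← mass_coin r, cost, mass]
  refine tsum_congr fun o => ?_
  change coin r o * _ = coin r o
  by_cases h : o.2 = 1
  · simp [h]
  · simp [coin, h]

theorem binomialWeight_eq {F : ℕ → ℝ} {m : ℕ} (hF : ∀ i ≤ m, F i = i.factorial) (q : ℝ) {x : ℕ}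
    (hx : x ≤ m) : binomialWeight F m q x = det (binWeight m q x) 15 := by
  simp only [binomialWeight, power, tick_eq_det, step_eq_det, readAt_eq_det, det_bind,
    delay_det]
  rw [hF m le_rfl, hF x hx, hF (m - x) (Nat.sub_le _ _), binWeight, Nat.cast_choose ℝ hx]

/-- The candidate that is tested as number `i`. -/
def candidate (c i : ℕ) : ℤ :=
  if i % 2 = 0 then (c : ℤ) - ((i + 1) / 2 : ℕ) else (c : ℤ) + ((i + 1) / 2 : ℕ)

/-- The number of the candidate `x`. -/
def candidateIndex (c x : ℕ) : ℕ := if x ≤ c then 2 * (c - x) else 2 * (x - c) - 1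

theorem candidate_eq_iff {c i x : ℕ} : candidate c i = x ↔ i = candidateIndex c x := by
  unfold candidate candidateIndex
  split_ifs <;> omega

theorem binomialSearch_skip {F : ℕ → ℝ} {m : ℕ} {q : ℝ} {c i : ℕ} (fuel : ℕ) (R : ℝ)
    (h : ¬ (0 ≤ candidate c i ∧ candidate c i ≤ m)) :
    binomialSearch F m q c (fuel + 1) i R = delay 6 (binomialSearch F m q c fuel (i + 1) R) := by
  rw [binomialSearch]
  unfold candidate at h
  simp only [step_eq_det, det_bind, delay_delay]
  by_cases hi : i % 2 = 0
  · rw [if_pos hi] at h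
    rw [if_pos (by simpa using hi), if_neg (by simpa using h)]
    simp only [delay_delay]
  · rw [if_neg hi] at h
    rw [if_neg (by simpa using hi), if_neg (by simpa using h)]
    simp only [delay_delay]

theorem binomialSearch_test {F : ℕ → ℝ} {m : ℕ} (hF : ∀ i ≤ m, F i = i.factorial) {q : ℝ}
    {c i x : ℕ} (fuel : ℕ) (R : ℝ) (hx : x ≤ m) (h : candidate c i = x) :
    binomialSearch F m q c (fuel + 1) i R = delay 22 (coin (binWeight m q x / R) >>= fun hit =>
      if hit = true then pure x
      else delay 1 (binomialSearch F m q c fuel (i + 1) (R - binWeight m q x))) := by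
  rw [binomialSearch]
  unfold candidate at h
  simp only [step_eq_det, det_bind, delay_delay]
  have hx' : (x : ℤ) ≤ m := by exact_mod_cast hx
  by_cases hi : i % 2 = 0
  · rw [if_pos hi] at h
    rw [if_pos (by simpa using hi), h, if_pos (by simpa using hx), Int.toNat_natCast,
      binomialWeight_eq hF q hx]
    simp only [det_bind, delay_delay]
  · rw [if_neg hi] at h
    rw [if_neg (by simpa using hi), h, if_pos (by simpa using hx), Int.toNat_natCast,
      binomialWeight_eq hF q hx]
    simp only [det_bind, delay_delay]

/-- The probability of the candidate number `i`. -/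
noncomputable def candidateWeight (m : ℕ) (q : ℝ) (c i : ℕ) : ℝ :=
  ∑ x ∈ Finset.range (m + 1), if i = candidateIndex c x then binWeight m q x else 0

theorem candidateWeight_nonneg {m : ℕ} {q : ℝ} (h0 : 0 ≤ q) (h1 : q ≤ 1) (c i : ℕ) :
    0 ≤ candidateWeight m q c i :=
  Finset.sum_nonneg fun x _ => by
    split_ifs
    · exact binWeight_nonneg h0 h1 x
    · exact le_rfl

theorem candidateWeight_of_eq {m : ℕ} {q : ℝ} {c i x : ℕ} (hx : x ≤ m) (h : candidate c i = x) :
    candidateWeight m q c i = binWeight m q x := by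
  rw [candidateWeight, Finset.sum_eq_single x]
  · rw [if_pos (candidate_eq_iff.1 h)]
  · intro y _ hy
    rw [if_neg]
    intro h'
    have := candidate_eq_iff.2 h'
    rw [h] at this
    exact hy (by exact_mod_cast this.symm)
  · intro hn
    exact absurd (Finset.mem_range.2 (Nat.lt_succ_iff.2 hx)) hn

theorem candidateWeight_of_not {m : ℕ} {q : ℝ} {c i : ℕ}
    (h : ¬ (0 ≤ candidate c i ∧ candidate c i ≤ m)) : candidateWeight m q c i = 0 := by
  refine Finset.sum_eq_zero fun x hx => if_neg fun h' => h ?_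
  rw [candidate_eq_iff.2 h']
  exact ⟨Int.natCast_nonneg x, by exact_mod_cast Nat.lt_succ_iff.1 (Finset.mem_range.1 hx)⟩

section Search

variable {F : ℕ → ℝ} {m : ℕ} {q : ℝ} {c : ℕ}

theorem mass_binomialSearch (hF : ∀ i ≤ m, F i = i.factorial) (fuel i : ℕ) (R : ℝ) :
    (binomialSearch F m q c fuel i R).mass = 1 := by
  induction fuel generalizing i R with
  | zero => exact mass_det _ _
  | succ fuel ih =>
    by_cases h : 0 ≤ candidate c i ∧ candidate c i ≤ m
    · obtain ⟨x, hx⟩ := Int.eq_ofNat_of_zero_le h.1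
      have hxm : x ≤ m := by have := h.2; rw [hx] at this; exact_mod_cast this
      rw [binomialSearch_test hF fuel R hxm hx, mass_delay]
      refine mass_bind_eq_one (mass_coin _) fun hit => ?_
      cases hit
      · simp [mass_delay, ih]
      · simp [pure_eq_det, mass_det]
    · rw [binomialSearch_skip fuel R h, mass_delay, ih]

theorem ofReal_mul_coin_true {b R : ℝ} (hb : 0 ≤ b) (hbR : b ≤ R) :
    ENNReal.ofReal R * (coin (b / R)).law true = ENNReal.ofReal b := by
  rcases (hb.trans hbR).eq_or_lt with h | h
  · have : b = 0 := le_antisymm (h ▸ hbR) hb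
    simp [← h, this]
  · rw [law_coin_true, min_eq_right (by
      rw [← ENNReal.ofReal_one]
      exact ENNReal.ofReal_le_ofReal (div_le_one_of_le₀ hbR h.le)), ← ENNReal.ofReal_mul h.le,
      mul_div_cancel₀ _ h.ne']

theorem ofReal_mul_coin_false {b R : ℝ} (hb : 0 ≤ b) (hbR : b ≤ R) :
    ENNReal.ofReal R * (coin (b / R)).law false = ENNReal.ofReal (R - b) := by
  have h1 : (coin (b / R)).law true + (coin (b / R)).law false = 1 := by
    have := tsum_law (coin (b / R))
    rw [tsum_bool, mass_coin, add_comm] at this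
    exact this
  have h2 : ENNReal.ofReal b + ENNReal.ofReal R * (coin (b / R)).law false =
      ENNReal.ofReal b + ENNReal.ofReal (R - b) := by
    rw [← ofReal_mul_coin_true hb hbR, ← mul_add, h1, mul_one, ofReal_mul_coin_true hb hbR,
      ← ENNReal.ofReal_add hb (sub_nonneg.2 hbR), add_sub_cancel]
  exact (ENNReal.add_right_inj ENNReal.ofReal_ne_top).1 h2

/-- Sequential search hits each remaining candidate with its conditional probability.  The
identity is multiplied by the remaining probability `R`, so that it holds for `R = 0`, too. -/
theorem law_binomialSearch (hF : ∀ i ≤ m, F i = i.factorial) (h0 : 0 ≤ q) (h1 : q ≤ 1)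
    (fuel i : ℕ) (R : ℝ) (hR : R = ∑ l ∈ Finset.range fuel, candidateWeight m q c (i + l)) (x : ℕ) :
    ENNReal.ofReal R * (binomialSearch F m q c fuel i R).law x = ∑ l ∈ Finset.range fuel,
      if i + l = candidateIndex c x ∧ x ≤ m then ENNReal.ofReal (binWeight m q x) else 0 := by
  induction fuel generalizing i R with
  | zero => simp [hR]
  | succ fuel ih =>
    have hsh : ∀ l, i + (l + 1) = i + 1 + l := fun l => by ring
    rw [Finset.sum_range_succ', Finset.sum_congr rfl fun l _ => by rw [hsh l], add_zero] at hR
    rw [Finset.sum_range_succ', Finset.sum_congr rfl fun l _ => by rw [hsh l], add_zero]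
    have hR'0 : 0 ≤ ∑ l ∈ Finset.range fuel, candidateWeight m q c (i + 1 + l) :=
      Finset.sum_nonneg fun l _ => candidateWeight_nonneg h0 h1 _ _
    by_cases h : 0 ≤ candidate c i ∧ candidate c i ≤ m
    · obtain ⟨y, hy⟩ := Int.eq_ofNat_of_zero_le h.1
      have hym : y ≤ m := by have := h.2; rw [hy] at this; exact_mod_cast this
      rw [candidateWeight_of_eq hym hy] at hR
      have hb := binWeight_nonneg (m := m) h0 h1 y
      have hbR : binWeight m q y ≤ R := by linarith
      rw [binomialSearch_test hF fuel R hym hy, law_delay, law_bind, tsum_bool, mul_add,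
        ← mul_assoc, ← mul_assoc, ofReal_mul_coin_true hb hbR, ofReal_mul_coin_false hb hbR]
      simp only [Bool.false_eq_true, if_false, if_true, law_delay, pure_eq_det, law_det]
      rw [ih (i + 1) (R - binWeight m q y) (by rw [hR]; ring)]
      congr 1
      by_cases hxy : y = x
      · subst hxy
        rw [if_pos rfl, if_pos ⟨candidate_eq_iff.1 hy, hym⟩, mul_one]
      · rw [if_neg hxy, if_neg, mul_zero]
        rintro ⟨h', -⟩
        have := candidate_eq_iff.2 h'
        rw [hy] at this
        exact hxy (by exact_mod_cast this)
    · rw [candidateWeight_of_not h, add_zero] at hR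
      rw [binomialSearch_skip fuel R h, law_delay, ih (i + 1) R hR, if_neg, add_zero]
      rintro ⟨h', hx⟩
      apply h
      rw [candidate_eq_iff.2 h']
      exact ⟨Int.natCast_nonneg x, by exact_mod_cast hx⟩

theorem cost_binomialSearch_le (hF : ∀ i ≤ m, F i = i.factorial) (h0 : 0 ≤ q) (h1 : q ≤ 1)
    (fuel i : ℕ) (R : ℝ) (hR : R = ∑ l ∈ Finset.range fuel, candidateWeight m q c (i + l)) :
    ENNReal.ofReal R * (binomialSearch F m q c fuel i R).cost ≤
      ENNReal.ofReal (24 * ∑ l ∈ Finset.range fuel, candidateWeight m q c (i + l) * (l + 1)) := by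
  induction fuel generalizing i R with
  | zero => simp [hR]
  | succ fuel ih =>
    have hsh : ∀ l, i + (l + 1) = i + 1 + l := fun l => by ring
    have hw := fun j => candidateWeight_nonneg (m := m) h0 h1 c j
    have hR0 : 0 ≤ R := by rw [hR]; exact Finset.sum_nonneg fun l _ => hw _
    have hsplit : ∑ l ∈ Finset.range (fuel + 1), candidateWeight m q c (i + l) * (l + 1) =
        R + ∑ l ∈ Finset.range fuel, candidateWeight m q c (i + 1 + l) * (l + 1) := by
      rw [hR, Finset.sum_range_succ', Finset.sum_range_succ' (n := fuel),
        add_right_comm, ← Finset.sum_add_distrib]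
      congr 1
      · refine Finset.sum_congr rfl fun l _ => ?_
        rw [hsh l]; push_cast; ring
      · simp
    rw [hsplit, mul_add, ENNReal.ofReal_add (by positivity) (mul_nonneg (by norm_num)
      (Finset.sum_nonneg fun l _ => mul_nonneg (hw _) (by positivity)))]
    rw [Finset.sum_range_succ', Finset.sum_congr rfl fun l _ => by rw [hsh l], add_zero] at hR
    have hR'0 : 0 ≤ ∑ l ∈ Finset.range fuel, candidateWeight m q c (i + 1 + l) :=
      Finset.sum_nonneg fun l _ => hw _
    by_cases h : 0 ≤ candidate c i ∧ candidate c i ≤ m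
    · obtain ⟨y, hy⟩ := Int.eq_ofNat_of_zero_le h.1
      have hym : y ≤ m := by have := h.2; rw [hy] at this; exact_mod_cast this
      rw [candidateWeight_of_eq hym hy] at hR
      have hb := binWeight_nonneg (m := m) h0 h1 y
      have hbR : binWeight m q y ≤ R := by linarith
      have hm := mass_binomialSearch (q := q) (c := c) hF fuel (i + 1) (R - binWeight m q y)
      have hmass : ∀ hit : Bool, ((if hit = true then pure y else delay 1
          (binomialSearch F m q c fuel (i + 1) (R - binWeight m q y)) : RandComp ℕ)).mass = 1 := by
        intro hit
        cases hit
        · simp [mass_delay, hm]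
        · simp [pure_eq_det, mass_det]
      have hc1 : (binomialSearch F m q c (fuel + 1) i R).cost ≤ 24 + (coin (binWeight m q y / R)).law
          false * (binomialSearch F m q c fuel (i + 1) (R - binWeight m q y)).cost := by
        rw [binomialSearch_test hF fuel R hym hy]
        refine (cost_delay_le _ (mass_bind_le_one (mass_coin _).le fun hit =>
          (hmass hit).le)).trans ?_
        refine (add_le_add le_rfl (cost_bind_le fun hit => (hmass hit).le)).trans ?_
        rw [tsum_bool, cost_coin]
        simp only [Bool.false_eq_true, if_false, if_true, pure_eq_det, cost_det, Nat.cast_zero,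
          mul_zero, add_zero]
        have hl : (coin (binWeight m q y / R)).law false ≤ 1 := by
          rw [law_coin_false]; exact tsub_le_self
        calc _ ≤ ((22 : ℕ) : ℝ≥0∞) + (1 + (coin (binWeight m q y / R)).law false * (((1 : ℕ) : ℝ≥0∞)
              + (binomialSearch F m q c fuel (i + 1) (R - binWeight m q y)).cost)) := by
              gcongr; exact cost_delay_le _ hm.le
          _ ≤ ((22 : ℕ) : ℝ≥0∞) + (1 + (1 * ((1 : ℕ) : ℝ≥0∞) +
              (coin (binWeight m q y / R)).law false *
              (binomialSearch F m q c fuel (i + 1) (R - binWeight m q y)).cost)) := by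
              rw [mul_add]; gcongr
          _ = _ := by rw [one_mul, ← add_assoc, ← add_assoc]; norm_num
      calc _ ≤ ENNReal.ofReal R * (24 + (coin (binWeight m q y / R)).law false *
            (binomialSearch F m q c fuel (i + 1) (R - binWeight m q y)).cost) := by gcongr
        _ = ENNReal.ofReal (24 * R) + ENNReal.ofReal (R - binWeight m q y) *
            (binomialSearch F m q c fuel (i + 1) (R - binWeight m q y)).cost := by
            rw [mul_add, ← mul_assoc, ofReal_mul_coin_false hb hbR, mul_comm,
              ENNReal.ofReal_mul (by norm_num)]
            norm_num
        _ ≤ _ := by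
            gcongr
            exact ih (i + 1) _ (by rw [hR]; ring)
    · rw [candidateWeight_of_not h, add_zero] at hR
      rw [binomialSearch_skip fuel R h]
      calc _ ≤ ENNReal.ofReal R * (24 + (binomialSearch F m q c fuel (i + 1) R).cost) := by
            gcongr
            refine (cost_delay_le _ (mass_binomialSearch hF _ _ _).le).trans ?_
            gcongr
            norm_num
        _ = ENNReal.ofReal (24 * R) + ENNReal.ofReal R *
            (binomialSearch F m q c fuel (i + 1) R).cost := by
            rw [mul_add, mul_comm, ENNReal.ofReal_mul (by norm_num)]
            norm_num
        _ ≤ _ := by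
            gcongr
            exact ih (i + 1) _ hR

/-- All numbers `0, …, m` are among the first `2 m + 1` candidates. -/
theorem candidateIndex_lt (hc : c ≤ m) {x : ℕ} (hx : x ≤ m) : candidateIndex c x < 2 * m + 1 := by
  unfold candidateIndex; split_ifs <;> omega

theorem sum_candidateWeight (hc : c ≤ m) (g : ℕ → ℝ) :
    ∑ l ∈ Finset.range (2 * m + 1), candidateWeight m q c (0 + l) * g l =
      ∑ x ∈ Finset.range (m + 1), binWeight m q x * g (candidateIndex c x) := by
  simp_rw [candidateWeight, Finset.sum_mul]
  rw [Finset.sum_comm]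
  refine Finset.sum_congr rfl fun x hx => ?_
  have hx' := Nat.lt_succ_iff.1 (Finset.mem_range.1 hx)
  rw [Finset.sum_eq_single (candidateIndex c x)]
  · rw [zero_add, if_pos rfl]
  · intro l _ hl
    rw [zero_add, if_neg hl, zero_mul]
  · intro hn
    exact absurd (Finset.mem_range.2 (candidateIndex_lt hc hx')) hn

theorem floor_mul_le (h1 : q ≤ 1) : ⌊(m : ℝ) * q⌋₊ ≤ m := by
  refine Nat.floor_le_of_le ?_
  exact mul_le_of_le_one_right (Nat.cast_nonneg m) h1

theorem binomial_eq : binomial F m q =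
    delay 2 (binomialSearch F m q ⌊(m : ℝ) * q⌋₊ (2 * m + 1) 0 1) := by
  simp only [binomial, step_eq_det, det_bind, delay_delay]

theorem mass_binomial (hF : ∀ i ≤ m, F i = i.factorial) : (binomial F m q).mass = 1 := by
  rw [binomial_eq, mass_delay, mass_binomialSearch hF]

theorem one_eq_sum_candidateWeight (h1 : q ≤ 1) :
    (1 : ℝ) = ∑ l ∈ Finset.range (2 * m + 1), candidateWeight m q ⌊(m : ℝ) * q⌋₊ (0 + l) := by
  have := sum_candidateWeight (q := q) (floor_mul_le (m := m) h1) (fun _ => 1)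
  simp only [mul_one] at this
  rw [this, sum_binWeight]

theorem law_binomial (hF : ∀ i ≤ m, F i = i.factorial) (h0 : 0 ≤ q) (h1 : q ≤ 1) (x : ℕ) :
    (binomial F m q).law x = ENNReal.ofReal (binWeight m q x) := by
  have h := law_binomialSearch hF h0 h1 (2 * m + 1) 0 1 (one_eq_sum_candidateWeight h1) x
  rw [ENNReal.ofReal_one, one_mul] at h
  rw [binomial_eq, law_delay, h]
  by_cases hx : x ≤ m
  · rw [Finset.sum_eq_single (candidateIndex ⌊(m : ℝ) * q⌋₊ x)]
    · rw [if_pos ⟨zero_add _, hx⟩]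
    · intro l _ hl
      rw [if_neg (by rw [zero_add]; exact fun h => hl h.1)]
    · intro hn
      exact absurd (Finset.mem_range.2 (candidateIndex_lt (floor_mul_le h1) hx)) hn
  · rw [Finset.sum_eq_zero fun l _ => if_neg fun h => hx h.2, binWeight,
      Nat.choose_eq_zero_of_lt (not_le.1 hx)]
    simp

theorem cost_binomial_le (hF : ∀ i ≤ m, F i = i.factorial) (h0 : 0 ≤ q) (h1 : q ≤ 1)
    (hm : 1 ≤ m) : (binomial F m q).cost ≤ ENNReal.ofReal (130 * √(m : ℝ)) := by
  have h := cost_binomialSearch_le hF h0 h1 (2 * m + 1) 0 1 (one_eq_sum_candidateWeight h1)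
  rw [ENNReal.ofReal_one, one_mul,
    sum_candidateWeight (floor_mul_le h1) (fun l => (l : ℝ) + 1)] at h
  rw [binomial_eq]
  refine (cost_delay_le _ (mass_binomialSearch hF _ _ _).le).trans
    ((add_le_add le_rfl h).trans ?_)
  have hs1 : 1 ≤ √(m : ℝ) := Real.one_le_sqrt.2 (by exact_mod_cast hm)
  have hsum : ∑ x ∈ Finset.range (m + 1), binWeight m q x *
      ((candidateIndex ⌊(m : ℝ) * q⌋₊ x : ℝ) + 1) ≤ 2 * (2 * √(m : ℝ)) + 1 := by
    calc _ ≤ ∑ x ∈ Finset.range (m + 1), (2 * (binWeight m q x *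
          |(x : ℝ) - (⌊(m : ℝ) * q⌋₊ : ℝ)|) + binWeight m q x) := by
          refine Finset.sum_le_sum fun x _ => ?_
          have hb := binWeight_nonneg (m := m) h0 h1 x
          have : (candidateIndex ⌊(m : ℝ) * q⌋₊ x : ℝ) ≤ 2 * |(x : ℝ) - (⌊(m : ℝ) * q⌋₊ : ℝ)| := by
            unfold candidateIndex
            split_ifs with hx
            · rw [abs_sub_comm, abs_of_nonneg (sub_nonneg.2 (by exact_mod_cast hx))]
              push_cast [hx]; linarith
            · have hx' : ⌊(m : ℝ) * q⌋₊ ≤ x := (not_le.1 hx).le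
              rw [abs_of_nonneg (sub_nonneg.2 (by exact_mod_cast hx'))]
              calc _ ≤ ((2 * (x - ⌊(m : ℝ) * q⌋₊) : ℕ) : ℝ) := by exact_mod_cast Nat.sub_le _ _
                _ = _ := by push_cast [hx']; ring
          nlinarith
      _ ≤ _ := by
          rw [Finset.sum_add_distrib, ← Finset.mul_sum, sum_binWeight]
          linarith [sum_binWeight_abs_le hm h0 h1]
  rw [← ENNReal.ofReal_natCast, ← ENNReal.ofReal_add (by positivity) (by
    refine mul_nonneg (by norm_num) (Finset.sum_nonneg fun x _ => mul_nonneg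
      (binWeight_nonneg h0 h1 x) (by positivity)))]
  refine ENNReal.ofReal_le_ofReal ?_
  push_cast
  linarith

end Search

end

/-! ### One trial of the multinomial generator -/

section

open scoped Classical
open RandComp

theorem stab_zero : stab 0 = 1 := by simp [stab]

theorem stab_replicate_add {j : ℕ} {M : Multiset ℕ} (hj : j ∉ M) (x : ℕ) :
    stab (Multiset.replicate x j + M) = x.factorial * stab M := by
  induction x with
  | zero => simp
  | succ x ih =>
    rw [Multiset.replicate_succ, Multiset.cons_add, stab_cons, ih, Multiset.count_add,
      Multiset.count_replicate_self, Multiset.count_eq_zero_of_notMem hj, Nat.factorial_succ]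
    ring

theorem replicate_count_add_filter (j : ℕ) (M : Multiset ℕ) :
    Multiset.replicate (M.count j) j + M.filter (fun i => i ≠ j) = M := by
  rw [← Multiset.filter_eq']
  exact Multiset.filter_add_not (fun i => i = j) M

section Trial

variable {α : ℝ} {v F τ : ℕ → ℝ} {N : ℕ}

theorem trial_zero_draws (n fuel j : ℕ) (T : ℝ) (S : ℕ) (counts : List (ℕ × ℕ)) :
    trial α v F n (fuel + 1) j 0 T S counts = det (if S = n - 1 then some counts else none) 4 := by
  rw [trial]
  simp only [tick_eq_det, step_eq_det, det_bind, decide_true, if_true, delay_delay, pure_eq_det]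
  by_cases h : S = n - 1 <;> simp [h, delay_det]

theorem trial_step (n fuel j : ℕ) {m : ℕ} (hm : m ≠ 0) (T : ℝ) (S : ℕ)
    (counts : List (ℕ × ℕ)) :
    trial α v F n (fuel + 1) j m T S counts = delay 6 (binomial F m (v j / (1 - α) / T) >>= fun x =>
      delay 6 (trial α v F n fuel (j + 1) (m - x) (T - v j / (1 - α)) (S + j * x)
        ((j, x) :: counts))) := by
  rw [trial]
  simp only [tick_eq_det, step_eq_det, readAt_eq_det, det_bind, delay_delay]
  rw [if_neg (by simpa using hm)]
  simp only [delay_delay]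

theorem mass_trial (hF : ∀ i ≤ N, F i = i.factorial) (n fuel j : ℕ) {m : ℕ} (hm : m ≤ N) (T : ℝ)
    (S : ℕ) (counts : List (ℕ × ℕ)) : (trial α v F n fuel j m T S counts).mass = 1 := by
  induction fuel generalizing j m T S counts with
  | zero => exact mass_det _ _
  | succ fuel ih =>
    by_cases h : m = 0
    · subst h
      rw [trial_zero_draws, mass_det]
    · rw [trial_step n fuel j h, mass_delay]
      refine mass_bind_eq_one (mass_binomial fun i hi => hF i (hi.trans hm)) fun x => ?_
      rw [mass_delay, ih _ ((Nat.sub_le _ _).trans hm)]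

/-- `τ j` is the probability of the cells `j, j + 1, …`, the cell `i` having the probability
`v i / (1 - α)`. -/
structure IsTail (α : ℝ) (v τ : ℕ → ℝ) : Prop where
  lt_one : α < 1
  nonneg : ∀ j, 0 ≤ v j
  tail_nonneg : ∀ j, 0 ≤ τ j
  tail_succ : ∀ j, τ (j + 1) = τ j - v j / (1 - α)

namespace IsTail

theorem cell_nonneg (h : IsTail α v τ) (j : ℕ) : 0 ≤ v j / (1 - α) :=
  div_nonneg (h.nonneg j) (sub_nonneg.2 h.lt_one.le)

theorem cell_le (h : IsTail α v τ) (j : ℕ) : v j / (1 - α) ≤ τ j := by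
  have := h.tail_nonneg (j + 1)
  rw [h.tail_succ] at this
  linarith

theorem ratio_nonneg (h : IsTail α v τ) (j : ℕ) : 0 ≤ v j / (1 - α) / τ j :=
  div_nonneg (h.cell_nonneg j) (h.tail_nonneg j)

theorem ratio_le_one (h : IsTail α v τ) (j : ℕ) : v j / (1 - α) / τ j ≤ 1 :=
  div_le_one_of_le₀ (h.cell_le j) (h.tail_nonneg j)

theorem ratio_mul (h : IsTail α v τ) (j : ℕ) : v j / (1 - α) / τ j * τ j = v j / (1 - α) := by
  rcases eq_or_ne (τ j) 0 with h0 | h0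
  · have : v j / (1 - α) = 0 := le_antisymm (h0 ▸ h.cell_le j) (h.cell_nonneg j)
    rw [h0, mul_zero, this]
  · exact div_mul_cancel₀ _ h0

theorem one_sub_ratio_mul (h : IsTail α v τ) (j : ℕ) :
    (1 - v j / (1 - α) / τ j) * τ j = τ (j + 1) := by
  rw [sub_mul, h.ratio_mul, h.tail_succ, one_mul]

theorem binWeight_mul (h : IsTail α v τ) (j : ℕ) {m x : ℕ} (hx : x ≤ m) :
    binWeight m (v j / (1 - α) / τ j) x * τ j ^ m =
      m.choose x * (v j / (1 - α)) ^ x * τ (j + 1) ^ (m - x) := by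
  have : τ j ^ m = τ j ^ x * τ j ^ (m - x) := by rw [← pow_add, Nat.add_sub_cancel' hx]
  rw [binWeight, this, ← h.one_sub_ratio_mul j, mul_pow, ← h.ratio_mul j, mul_pow, h.ratio_mul j]
  ring

end IsTail

theorem le_of_binWeight_ne_zero {m x : ℕ} {q : ℝ} (h : binWeight m q x ≠ 0) : x ≤ m := by
  by_contra hx
  exact h (by rw [binWeight, Nat.choose_eq_zero_of_lt (not_le.1 hx)]; simp)

/-- An accepted vector describes a multiset of the right size and sum. -/
theorem exists_of_law_trial_ne_zero (hF : ∀ i ≤ N, F i = i.factorial) (hτ : IsTail α v τ) (n : ℕ)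
    (fuel j : ℕ) {m : ℕ} (hm : m ≤ N) (S : ℕ) (counts L : List (ℕ × ℕ))
    (hL : (trial α v F n fuel j m (τ j) S counts).law (some L) ≠ 0) :
    ∃ M : Multiset ℕ, ofCounts L = ofCounts counts + M ∧ (∀ i ∈ M, j ≤ i) ∧ M.card = m ∧
      S + M.sum = n - 1 ∧ L.length ≤ counts.length + fuel := by
  induction fuel generalizing j m S counts with
  | zero =>
    rw [trial, pure_eq_det, law_det] at hL
    simp at hL
  | succ fuel ih =>
    by_cases h : m = 0
    · subst h
      rw [trial_zero_draws, law_det] at hL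
      by_cases hS : S = n - 1
      · rw [if_pos hS] at hL
        have : counts = L := by by_contra h'; simp [h'] at hL
        exact ⟨0, by simp [this], by simp, by simp, by simpa using hS, by rw [this]; omega⟩
      · simp [hS] at hL
    · rw [trial_step n fuel j h, law_delay, law_bind] at hL
      obtain ⟨x, hx⟩ : ∃ x, ¬ ((binomial F m (v j / (1 - α) / τ j)).law x *
          (delay 6 (trial α v F n fuel (j + 1) (m - x) (τ j - v j / (1 - α)) (S + j * x)
            ((j, x) :: counts))).law (some L) = 0) := by
        by_contra! hall
        exact hL (ENNReal.tsum_eq_zero.2 hall)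
      rw [law_delay, law_binomial (fun i hi => hF i (hi.trans hm)) (hτ.ratio_nonneg j)
        (hτ.ratio_le_one j), ← hτ.tail_succ, mul_eq_zero, not_or] at hx
      have hxm : x ≤ m := le_of_binWeight_ne_zero fun h0 => hx.1 (by rw [h0, ENNReal.ofReal_zero])
      obtain ⟨M, h1, h2, h3, h4, h5⟩ := ih (j + 1) ((Nat.sub_le _ _).trans hm) _ _ hx.2
      refine ⟨Multiset.replicate x j + M, ?_, ?_, ?_, ?_, ?_⟩
      · rw [h1, ofCounts]; abel
      · intro i hi
        rcases Multiset.mem_add.1 hi with hi | hi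
        · exact (Multiset.eq_of_mem_replicate hi).ge
        · exact (Nat.le_succ j).trans (h2 i hi)
      · rw [Multiset.card_add, Multiset.card_replicate, h3]; omega
      · rw [Multiset.sum_add, Multiset.sum_replicate, smul_eq_mul, ← h4]; ring
      · simp only [List.length_cons] at h5; omega

/-- The multinomial law of the accepted vectors.  The identity is multiplied by a power of the
tail probability, which may be zero. -/
theorem law_trial (hF : ∀ i ≤ N, F i = i.factorial) (hτ : IsTail α v τ) (n : ℕ)
    (fuel j : ℕ) {m : ℕ} (hm : m ≤ N) (S : ℕ) (counts : List (ℕ × ℕ)) (hfuel : 1 ≤ fuel)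
    (M : Multiset ℕ) (hM : ∀ i ∈ M, j ≤ i ∧ i + 1 < j + fuel) (hcard : M.card = m)
    (hsum : S + M.sum = n - 1) :
    (stab M : ℝ≥0∞) * (ENNReal.ofReal (τ j ^ m) * ∑' L : List (ℕ × ℕ),
      if ofCounts L = ofCounts counts + M then
        (trial α v F n fuel j m (τ j) S counts).law (some L) else 0) =
    m.factorial * (M.map fun i => ENNReal.ofReal (v i / (1 - α))).prod := by
  induction fuel generalizing j m S counts M with
  | zero => omega
  | succ fuel ih =>
    by_cases h : m = 0
    · subst h
      obtain rfl := Multiset.card_eq_zero.1 hcard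
      have hS : S = n - 1 := by simpa using hsum
      rw [tsum_eq_single counts]
      · simp [trial_zero_draws, law_det, hS, stab_zero]
      · intro L hL
        simp [trial_zero_draws, law_det, hS, hL.symm]
    · obtain ⟨i₀, hi₀⟩ := Multiset.card_pos_iff_exists_mem.1 (by omega : 0 < M.card)
      have hfuel' : 1 ≤ fuel := by have := hM i₀ hi₀; omega
      set x₀ := M.count j with hx₀
      set M' := M.filter (fun i => i ≠ j) with hM'
      have hsplit : Multiset.replicate x₀ j + M' = M := replicate_count_add_filter j M
      have hxm : x₀ ≤ m := hcard ▸ Multiset.count_le_card j M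
      have hjM' : j ∉ M' := by simp [hM']
      have hcard' : M'.card = m - x₀ := by
        have := congrArg Multiset.card hsplit
        rw [Multiset.card_add, Multiset.card_replicate] at this
        omega
      have hsum' : S + j * x₀ + M'.sum = n - 1 := by
        have := congrArg Multiset.sum hsplit
        rw [Multiset.sum_add, Multiset.sum_replicate, smul_eq_mul] at this
        rw [← hsum, ← this]; ring
      have hFm : ∀ i ≤ m, F i = i.factorial := fun i hi => hF i (hi.trans hm)
      have IH := ih (j + 1) ((Nat.sub_le m x₀).trans hm) (S + j * x₀) ((j, x₀) :: counts) hfuel' M'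
        (fun i hi => by
          have h1 := hM i (Multiset.mem_of_mem_filter hi)
          have h2 : i ≠ j := (Multiset.mem_filter.1 hi).2
          omega) hcard' hsum'
      have hA : ∑' L : List (ℕ × ℕ), (if ofCounts L = ofCounts counts + M then
            (trial α v F n (fuel + 1) j m (τ j) S counts).law (some L) else 0) =
          ENNReal.ofReal (binWeight m (v j / (1 - α) / τ j) x₀) * ∑' L : List (ℕ × ℕ),
            (if ofCounts L = ofCounts ((j, x₀) :: counts) + M' then
            (trial α v F n fuel (j + 1) (m - x₀) (τ (j + 1)) (S + j * x₀)
              ((j, x₀) :: counts)).law (some L) else 0) := by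
        have e1 : ∀ L : List (ℕ × ℕ), (if ofCounts L = ofCounts counts + M then
            (trial α v F n (fuel + 1) j m (τ j) S counts).law (some L) else 0) =
            ∑' x, ENNReal.ofReal (binWeight m (v j / (1 - α) / τ j) x) *
            (if ofCounts L = ofCounts counts + M then
            (trial α v F n fuel (j + 1) (m - x) (τ (j + 1)) (S + j * x)
              ((j, x) :: counts)).law (some L) else 0) := by
          intro L
          split_ifs with hL
          · rw [trial_step n fuel j h, law_delay, law_bind]
            simp_rw [law_delay, law_binomial hFm (hτ.ratio_nonneg j) (hτ.ratio_le_one j),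
              ← hτ.tail_succ]
          · simp
        simp_rw [e1]
        rw [ENNReal.tsum_comm, tsum_eq_single x₀]
        · rw [ENNReal.tsum_mul_left]
          congr 1
          refine tsum_congr fun L => ?_
          have : ofCounts counts + M = ofCounts ((j, x₀) :: counts) + M' := by
            rw [← hsplit, ofCounts]; abel
          rw [this]
        · intro x hx
          refine ENNReal.tsum_eq_zero.2 fun L => ?_
          by_contra hne
          rw [mul_eq_zero, not_or] at hne
          have hL : ofCounts L = ofCounts counts + M := by
            by_contra h'; exact hne.2 (if_neg h')
          rw [if_pos hL] at hne
          obtain ⟨M₂, h1, h2, -⟩ := exists_of_law_trial_ne_zero hF hτ n fuel (j + 1)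
            ((Nat.sub_le _ _).trans hm) _ _ L hne.2
          rw [hL, ofCounts, add_comm (Multiset.replicate x j), add_assoc] at h1
          have h3 : M = Multiset.replicate x j + M₂ := add_left_cancel h1
          apply hx
          rw [hx₀, h3, Multiset.count_add, Multiset.count_replicate_self,
            Multiset.count_eq_zero_of_notMem, add_zero]
          intro hj
          exact absurd (h2 j hj) (by omega)
      have hstab : stab M = x₀.factorial * stab M' := by
        rw [← stab_replicate_add hjM', hsplit]
      have hprod : (M.map fun i => ENNReal.ofReal (v i / (1 - α))).prod =
          ENNReal.ofReal (v j / (1 - α)) ^ x₀ *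
            (M'.map fun i => ENNReal.ofReal (v i / (1 - α))).prod := by
        rw [← hsplit, Multiset.map_add, Multiset.prod_add, Multiset.map_replicate,
          Multiset.prod_replicate]
      have hfac : (m.factorial : ℝ≥0∞) = m.choose x₀ * x₀.factorial * (m - x₀).factorial := by
        exact_mod_cast (Nat.choose_mul_factorial_mul_factorial hxm).symm
      rw [hA, hstab, hprod, hfac]
      set A' := ∑' L : List (ℕ × ℕ), (if ofCounts L = ofCounts ((j, x₀) :: counts) + M' then
            (trial α v F n fuel (j + 1) (m - x₀) (τ (j + 1)) (S + j * x₀)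
              ((j, x₀) :: counts)).law (some L) else 0) with hA'
      have hw : ENNReal.ofReal (τ j ^ m) * (ENNReal.ofReal (binWeight m (v j / (1 - α) / τ j) x₀)
          * A') = m.choose x₀ * ENNReal.ofReal (v j / (1 - α)) ^ x₀ *
            (ENNReal.ofReal (τ (j + 1) ^ (m - x₀)) * A') := by
        have hc := hτ.cell_nonneg j
        rw [← mul_assoc, ← ENNReal.ofReal_mul (pow_nonneg (hτ.tail_nonneg j) m), mul_comm (τ j ^ m),
          hτ.binWeight_mul j hxm, ENNReal.ofReal_mul (by positivity),
          ENNReal.ofReal_mul (by positivity), ENNReal.ofReal_natCast, ENNReal.ofReal_pow hc]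
        ring
      rw [hw]
      calc _ = m.choose x₀ * x₀.factorial * ENNReal.ofReal (v j / (1 - α)) ^ x₀ *
            ((stab M' : ℝ≥0∞) * (ENNReal.ofReal (τ (j + 1) ^ (m - x₀)) * A')) := by
            push_cast; ring
        _ = _ := by rw [IH]; ring

/-- The expected cost of a trial: while draws are left, the search in the cell `j` costs
`O(√m_j)`, where the number `m_j` of draws left has the mean `N τ_j`, so that the expected cost of
the cell is `O(√(N τ_j))` by Jensen's inequality. -/
theorem cost_trial_le (hF : ∀ i ≤ N, F i = i.factorial) (hτ : IsTail α v τ) (n : ℕ)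
    (fuel j : ℕ) {m : ℕ} (hm : m ≤ N) (S : ℕ) (counts : List (ℕ × ℕ)) (hj : m = 0 ∨ 0 < τ j) :
    (trial α v F n fuel j m (τ j) S counts).cost ≤
      ENNReal.ofReal (5 + 150 * √(m : ℝ) * ((∑ l ∈ Finset.range fuel, √(τ (j + l))) / √(τ j))) := by
  induction fuel generalizing j m S counts with
  | zero =>
    rw [trial, pure_eq_det, cost_det]
    simp
  | succ fuel ih =>
    by_cases h : m = 0
    · subst h
      rw [trial_zero_draws, cost_det]
      simp
      norm_num
    · have hτj : 0 < τ j := hj.resolve_left h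
      have hs : 0 < √(τ j) := Real.sqrt_pos.2 hτj
      have hFm : ∀ i ≤ m, F i = i.factorial := fun i hi => hF i (hi.trans hm)
      have hm1 : 1 ≤ √(m : ℝ) := Real.one_le_sqrt.2 (by exact_mod_cast Nat.pos_of_ne_zero h)
      set q := v j / (1 - α) / τ j with hq
      have hq0 := hτ.ratio_nonneg j
      have hq1 := hτ.ratio_le_one j
      have hsub : ∀ x, m - x ≤ N := fun x => (Nat.sub_le _ _).trans hm
      rw [trial_step n fuel j h, ← hτ.tail_succ, ← hq]
      rw [← hq] at hq0 hq1
      set tails := ∑ l ∈ Finset.range fuel, √(τ (j + 1 + l)) with htails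
      have htails0 : 0 ≤ tails := Finset.sum_nonneg fun _ _ => Real.sqrt_nonneg _
      have hpt : ∀ x, (binomial F m q).law x * (delay 6 (trial α v F n fuel (j + 1) (m - x)
          (τ (j + 1)) (S + j * x) ((j, x) :: counts))).cost ≤ ENNReal.ofReal (binWeight m q x *
            (11 + 150 * √((m - x : ℕ) : ℝ) * (tails / √(τ (j + 1))))) := by
        intro x
        rw [law_binomial hFm hq0 hq1]
        by_cases hw : binWeight m q x = 0
        · rw [hw]; simp
        have hcond : m - x = 0 ∨ 0 < τ (j + 1) := by
          by_contra! hcon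
          have h0 : τ (j + 1) = 0 := le_antisymm hcon.2 (hτ.tail_nonneg _)
          have h1q : 1 - q = 0 := by
            have := hτ.one_sub_ratio_mul j
            rw [h0, ← hq] at this
            exact (mul_eq_zero.1 this).resolve_right hτj.ne'
          exact hw (by rw [binWeight, h1q, zero_pow hcon.1, mul_zero])
        rw [ENNReal.ofReal_mul (binWeight_nonneg hq0 hq1 x)]
        gcongr
        refine (cost_delay_le _ (mass_trial hF _ _ _ (hsub x) _ _ _).le).trans ?_
        refine (add_le_add le_rfl (ih (j + 1) (hsub x) _ _ hcond)).trans ?_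
        rw [← ENNReal.ofReal_natCast, ← ENNReal.ofReal_add (by positivity) (by positivity)]
        refine ENNReal.ofReal_le_ofReal (le_of_eq ?_)
        push_cast; ring
      have hsum : ∑' x, (binomial F m q).law x * (delay 6 (trial α v F n fuel (j + 1) (m - x)
          (τ (j + 1)) (S + j * x) ((j, x) :: counts))).cost ≤
          ENNReal.ofReal (11 + 150 * √(m : ℝ) * (tails / √(τ j))) := by
        refine (ENNReal.tsum_le_tsum hpt).trans ?_
        rw [tsum_eq_sum (s := Finset.range (m + 1))]
        · rw [← ENNReal.ofReal_sum_of_nonneg fun x _ =>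
            mul_nonneg (binWeight_nonneg hq0 hq1 x) (by positivity)]
          refine ENNReal.ofReal_le_ofReal ?_
          have e : ∀ x ∈ Finset.range (m + 1), binWeight m q x *
              (11 + 150 * √((m - x : ℕ) : ℝ) * (tails / √(τ (j + 1)))) = 11 * binWeight m q x +
              150 * (tails / √(τ (j + 1))) * (binWeight m q x * √((m - x : ℕ) : ℝ)) :=
            fun x _ => by ring
          rw [Finset.sum_congr rfl e, Finset.sum_add_distrib, ← Finset.mul_sum, ← Finset.mul_sum,
            sum_binWeight, mul_one]
          have hJ := sum_binWeight_sqrt_le m hq0 hq1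
          have hr : √(1 - q) = √(τ (j + 1)) / √(τ j) := by
            rw [← Real.sqrt_div' _ hτj.le, ← hτ.one_sub_ratio_mul j, ← hq,
              mul_div_cancel_right₀ _ hτj.ne']
          have hfrac : tails / √(τ (j + 1)) * √(τ (j + 1)) ≤ tails := by
            rcases eq_or_ne (√(τ (j + 1))) 0 with h0 | h0
            · rw [h0, mul_zero]; exact htails0
            · rw [div_mul_cancel₀ _ h0]
          gcongr 11 + ?_
          calc _ ≤ 150 * (tails / √(τ (j + 1))) * (√(m : ℝ) * √(1 - q)) := by gcongr
            _ = 150 * √(m : ℝ) * ((tails / √(τ (j + 1)) * √(τ (j + 1))) / √(τ j)) := by rw [hr]; ring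
            _ ≤ _ := by gcongr
        · intro x hx
          have : m < x := by simpa using hx
          rw [binWeight, Nat.choose_eq_zero_of_lt this]
          simp
      have hmass : ∀ x, (delay 6 (trial α v F n fuel (j + 1) (m - x)
          (τ (j + 1)) (S + j * x) ((j, x) :: counts))).mass = 1 := fun x => by
        rw [mass_delay, mass_trial hF _ _ _ (hsub x)]
      refine (cost_delay_le _ (mass_bind_le_one (mass_binomial hFm).le fun x =>
        (hmass x).le)).trans ?_
      refine (add_le_add le_rfl ((cost_bind_le fun x => (hmass x).le).trans
        (add_le_add (cost_binomial_le hFm hq0 hq1 (Nat.pos_of_ne_zero h)) hsum))).trans ?_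
      rw [← ENNReal.ofReal_natCast, ← ENNReal.ofReal_add (by positivity) (by positivity),
        ← ENNReal.ofReal_add (by positivity) (by positivity)]
      refine ENNReal.ofReal_le_ofReal ?_
      rw [Finset.sum_range_succ', add_zero, add_div, div_self hs.ne', mul_add]
      have hsh : ∑ l ∈ Finset.range fuel, √(τ (j + (l + 1))) = tails := by
        refine Finset.sum_congr rfl fun l _ => ?_
        rw [show j + (l + 1) = j + 1 + l by ring]
      rw [hsh]
      push_cast
      linarith

end Trial

end

/-! ### Degree sequences, parsing and cyclic shifts -/

section

/-- The sum of the numbers `1 - x`: the number of trees of a forest with these degrees. -/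
def excess (l : List ℕ) : ℤ := (l.map fun x => 1 - (x : ℤ)).sum

theorem excess_nil : excess [] = 0 := rfl

theorem excess_cons (x : ℕ) (l : List ℕ) : excess (x :: l) = 1 - x + excess l := by simp [excess]

theorem excess_append (l l' : List ℕ) : excess (l ++ l') = excess l + excess l' := by
  simp [excess]

mutual
theorem excess_degrees : ∀ t : OTree, excess t.degrees = 1
  | .node cs => by rw [OTree.degrees, excess_cons, excess_forestDegrees cs]; ring
theorem excess_forestDegrees : ∀ ts : List OTree, excess (OTree.forestDegrees ts) = ts.length
  | [] => rfl
  | t :: ts => by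
    rw [OTree.forestDegrees, excess_append, excess_degrees t, excess_forestDegrees ts]
    push_cast [List.length_cons]; ring
end

mutual
/-- The Łukasiewicz property of degree sequences, in terms of suffixes. -/
theorem one_le_excess_of_degrees : ∀ (t : OTree) (a b : List ℕ), t.degrees = a ++ b → b ≠ [] →
    1 ≤ excess b
  | .node cs, a, b, h, hb => by
    rw [OTree.degrees] at h
    rcases List.cons_eq_append_iff.1 h with ⟨-, h2⟩ | ⟨a', -, h2⟩
    · rw [h2, ← OTree.degrees, excess_degrees]
    · exact one_le_excess_of_forestDegrees cs a' b h2 hb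
theorem one_le_excess_of_forestDegrees : ∀ (ts : List OTree) (a b : List ℕ),
    OTree.forestDegrees ts = a ++ b → b ≠ [] → 1 ≤ excess b
  | [], a, b, h, hb => by
    rw [OTree.forestDegrees] at h
    exact absurd (List.append_eq_nil_iff.1 h.symm).2 hb
  | t :: ts, a, b, h, hb => by
    rw [OTree.forestDegrees] at h
    rcases List.append_eq_append_iff.1 h with ⟨a', -, h2⟩ | ⟨c', h1, h2⟩
    · exact one_le_excess_of_forestDegrees ts a' b h2 hb
    · rw [h2, excess_append, excess_forestDegrees]
      by_cases hc : c' = []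
      · subst hc
        rw [List.nil_append] at h2
        have := one_le_excess_of_forestDegrees ts [] b (by rw [h2, List.nil_append]) hb
        rw [h2, excess_forestDegrees] at this
        rw [excess_nil]; linarith
      · have := one_le_excess_of_degrees t a c' h1 hc
        have h0 : (0 : ℤ) ≤ ts.length := Int.natCast_nonneg _
        linarith
end

theorem parse_append (l l' : List ℕ) (st : List OTree) :
    parse (l ++ l') st = parse l (parse l' st) := List.foldr_append

theorem parse_cons (d : ℕ) (l : List ℕ) (st : List OTree) :
    parse (d :: l) st = OTree.node ((parse l st).take d) :: (parse l st).drop d := rfl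

mutual
theorem parse_degrees : ∀ (t : OTree) (st : List OTree), parse t.degrees st = t :: st
  | .node cs, st => by
    rw [OTree.degrees, parse_cons, parse_forestDegrees cs st, List.take_left, List.drop_left]
theorem parse_forestDegrees : ∀ (ts st : List OTree),
    parse (OTree.forestDegrees ts) st = ts ++ st
  | [], st => rfl
  | t :: ts, st => by
    rw [OTree.forestDegrees, parse_append, parse_forestDegrees ts st, parse_degrees t,
      List.cons_append]
end

theorem degrees_injective : Function.Injective OTree.degrees := fun t t' h => by
  have h1 := parse_degrees t []
  rw [h, parse_degrees] at h1
  exact (List.cons.inj h1).1.symm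

theorem forestDegrees_append (ts ts' : List OTree) : OTree.forestDegrees (ts ++ ts') =
    OTree.forestDegrees ts ++ OTree.forestDegrees ts' := by
  induction ts with
  | nil => rfl
  | cons t ts ih => rw [List.cons_append, OTree.forestDegrees, OTree.forestDegrees, ih,
      List.append_assoc]

theorem forestDegrees_parse (l : List ℕ) (h : ∀ a b, l = a ++ b → b ≠ [] → 1 ≤ excess b) :
    OTree.forestDegrees (parse l []) = l ∧ ((parse l []).length : ℤ) = excess l := by
  induction l with
  | nil => exact ⟨rfl, rfl⟩
  | cons d l ih =>
    obtain ⟨h1, h2⟩ := ih fun a b hab hb => h (d :: a) b (by rw [hab, List.cons_append]) hb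
    have h3 := h [] (d :: l) rfl (List.cons_ne_nil _ _)
    rw [excess_cons, ← h2] at h3
    have hd : d ≤ (parse l []).length := by omega
    rw [parse_cons]
    refine ⟨?_, ?_⟩
    · rw [OTree.forestDegrees, OTree.degrees, List.length_take, min_eq_left hd, List.cons_append,
        ← forestDegrees_append, List.take_append_drop, h1]
    · rw [List.length_cons, List.length_drop, excess_cons, ← h2]
      push_cast [hd]; ring

theorem degrees_parse_headD (l : List ℕ) (h : ∀ a b, l = a ++ b → b ≠ [] → 1 ≤ excess b)
    (h1 : excess l = 1) : ((parse l []).headD (OTree.node [])).degrees = l := by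
  obtain ⟨h2, h3⟩ := forestDegrees_parse l h
  rw [h1] at h3
  obtain ⟨t, ht⟩ := List.length_eq_one_iff.1 (by exact_mod_cast h3 : (parse l []).length = 1)
  rw [ht] at h2 ⊢
  rw [OTree.forestDegrees, OTree.forestDegrees, List.append_nil] at h2
  exact h2

theorem excess_map_range (a : ℕ → ℕ) (i l : ℕ) :
    excess ((List.range l).map fun j => a (i + j)) = walk a i - walk a (i + l) := by
  induction l with
  | zero => simp [excess]
  | succ l ih =>
    rw [List.range_succ, List.map_append, excess_append, ih, ← add_assoc, walk_succ]
    simp [excess]; ring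

theorem map_range_add (a : ℕ → ℕ) (i l : ℕ) : (List.range (i + l)).map a =
    (List.range i).map a ++ (List.range l).map fun j => a (i + j) := by
  rw [List.range_add, List.map_append, List.map_map]; rfl

theorem walk_zero (a : ℕ → ℕ) : walk a 0 = 0 := rfl

theorem walk_congr {a b : ℕ → ℕ} {j : ℕ} (h : ∀ i < j, a i = b i) : walk a j = walk b j :=
  Finset.sum_congr rfl fun i hi => by rw [h i (Finset.mem_range.1 hi)]

theorem walk_add (a : ℕ → ℕ) (i j : ℕ) :
    walk a (i + j) = walk a i + walk (fun l => a (i + l)) j := Finset.sum_range_add _ _ _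

theorem walk_eq_entries (a : ℕ → ℕ) (j : ℕ) : walk a j = ((entries a j).sum : ℤ) - j := by
  induction j with
  | zero => rfl
  | succ j ih =>
    rw [walk_succ, ih, entries_succ, Multiset.sum_cons]
    push_cast; ring

/-- An array whose path stays nonnegative before it ends at `-1` is a degree sequence. -/
theorem degrees_parse_of_walk {a : ℕ → ℕ} {n : ℕ} (h0 : ∀ i < n, 0 ≤ walk a i)
    (h1 : walk a n = -1) :
    ((parse ((List.range n).map a) []).headD (OTree.node [])).degrees = (List.range n).map a := by
  refine degrees_parse_headD _ (fun p s hps hs => ?_) ?_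
  · have hlen := congrArg List.length hps
    rw [List.length_map, List.length_range, List.length_append] at hlen
    have hspos : 0 < s.length := List.length_pos_of_ne_nil hs
    have h2 := map_range_add a p.length s.length
    rw [← hlen, hps] at h2
    have h3 := (List.append_inj h2 (by simp)).2
    rw [h3, excess_map_range, ← hlen, h1]
    have := h0 p.length (by omega)
    linarith
  · have := excess_map_range a 0 n
    simp only [zero_add, h1, walk_zero] at this
    simpa using this

/-- The degree sequence of a tree as an array. -/
def degreeArray (t : OTree) (i : ℕ) : ℕ := t.degrees.getD i 0

theorem map_degreeArray (t : OTree) : (List.range t.numVertices).map (degreeArray t) = t.degrees := by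
  refine List.ext_getElem (by simp [OTree.numVertices]) fun i h1 h2 => ?_
  simp [degreeArray, h2]

theorem walk_degreeArray (t : OTree) :
    (∀ i < t.numVertices, 0 ≤ walk (degreeArray t) i) ∧
      walk (degreeArray t) t.numVertices = -1 := by
  have hn : walk (degreeArray t) t.numVertices = -1 := by
    have := excess_map_range (degreeArray t) 0 t.numVertices
    simp only [zero_add, map_degreeArray, excess_degrees, walk_zero] at this
    linarith
  refine ⟨fun i hi => ?_, hn⟩
  have h1 := map_range_add (degreeArray t) i (t.numVertices - i)
  rw [Nat.add_sub_cancel' hi.le, map_degreeArray] at h1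
  have h2 := one_le_excess_of_degrees t _ _ h1 (by
    intro h
    have := congrArg List.length h
    simp at this
    omega)
  rw [excess_map_range, Nat.add_sub_cancel' hi.le, hn] at h2
  linarith

/-- The cyclic shift of the first `n` entries by `s`, followed by zeros. -/
def rot (n s : ℕ) (a : ℕ → ℕ) (l : ℕ) : ℕ := if l < n then a ((s + l) % n) else 0

theorem rot_of_lt {n s l : ℕ} (a : ℕ → ℕ) (h : l < n - s) : rot n s a l = a (s + l) := by
  rw [rot, if_pos (by omega), Nat.mod_eq_of_lt (by omega)]

theorem rot_of_ge {n s l : ℕ} (a : ℕ → ℕ) (hs : s ≤ n) (hl : l < s) :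
    rot n s a (n - s + l) = a l := by
  rw [rot, if_pos (by omega), show s + (n - s + l) = l + n by omega, Nat.add_mod_right,
    Nat.mod_eq_of_lt (by omega)]

theorem entries_rot {n s : ℕ} (a : ℕ → ℕ) (hs : s ≤ n) : entries (rot n s a) n = entries a n := by
  have h1 := entries_add (rot n s a) (n - s) s
  have h2 := entries_add a s (n - s)
  rw [Nat.sub_add_cancel hs] at h1
  rw [Nat.add_sub_cancel' hs] at h2
  rw [h1, h2, add_comm, entries_congr fun i hi => rot_of_ge a hs hi,
    entries_congr fun i hi => rot_of_lt a hi]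

theorem walk_rot_left {n s i : ℕ} (a : ℕ → ℕ) (hi : i ≤ n - s) :
    walk (rot n s a) i = walk a (s + i) - walk a s := by
  rw [walk_add, walk_congr fun l hl => rot_of_lt a (hl.trans_le hi)]; ring

theorem walk_rot_right {n s i : ℕ} (a : ℕ → ℕ) (hs : s ≤ n) (hi : i ≤ s) :
    walk (rot n s a) (n - s + i) = walk a n - walk a s + walk a i := by
  rw [walk_add, walk_rot_left a le_rfl, Nat.add_sub_cancel' hs,
    walk_congr fun l hl => rot_of_ge a hs (hl.trans_le hi)]

theorem rot_rot {n s : ℕ} {a : ℕ → ℕ} (hs : s ≤ n) (ha : ∀ i, n ≤ i → a i = 0) :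
    rot n (n - s) (rot n s a) = a := by
  funext l
  by_cases hl : l < n
  · rw [rot, if_pos hl, rot, if_pos (Nat.mod_lt _ (by omega))]
    congr 1
    rw [Nat.add_mod_mod, show s + (n - s + l) = l + n by omega, Nat.add_mod_right,
      Nat.mod_eq_of_lt hl]
  · rw [rot, if_neg hl, ha l (not_lt.1 hl)]

/-- The cycle lemma: after the shift by the first minimum, the path stays nonnegative before its
last step. -/
theorem walk_rot_firstMin {n s : ℕ} {a : ℕ → ℕ} (h1 : walk a n = -1) (hs : IsFirstMin a n s) :
    (∀ i < n, 0 ≤ walk (rot n s a) i) ∧ walk (rot n s a) n = -1 := by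
  constructor
  · intro i hi
    rcases le_or_gt i (n - s) with h | h
    · rw [walk_rot_left a h]
      linarith [hs.2.1 (s + i) (by have := hs.1; omega)]
    · obtain ⟨j, rfl⟩ : ∃ j, i = n - s + j := ⟨i - (n - s), by omega⟩
      have hj : j < s := by omega
      rw [walk_rot_right a hs.1 hj.le, h1]
      have := hs.2.2 j hj
      omega
  · have := walk_rot_right a hs.1 le_rfl
    rw [Nat.sub_add_cancel hs.1] at this
    rw [this, h1]; ring

/-- The converse of the cycle lemma: a cyclic shift of a degree sequence attains its first
minimum where the shift is undone. -/
theorem isFirstMin_rot {n r : ℕ} {a : ℕ → ℕ} (h0 : ∀ i < n, 0 ≤ walk a i) (h1 : walk a n = -1)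
    (hr : r < n) : IsFirstMin (rot n r a) n (n - r) := by
  have hmin : walk (rot n r a) (n - r) = -1 - walk a r := by
    rw [walk_rot_left a le_rfl, Nat.add_sub_cancel' hr.le, h1]
  refine ⟨Nat.sub_le _ _, fun i hi => ?_, fun i hi => ?_⟩
  · rw [hmin]
    rcases le_or_gt i (n - r) with h | h
    · rw [walk_rot_left a h]
      rcases (show r + i ≤ n by omega).eq_or_lt with h' | h'
      · rw [h', h1]
      · have := h0 _ h'; omega
    · obtain ⟨j, rfl⟩ : ∃ j, i = n - r + j := ⟨i - (n - r), by omega⟩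
      rw [walk_rot_right a hr.le (by omega), h1]
      have := h0 j (by omega); omega
  · rw [hmin, walk_rot_left a hi.le]
    have := h0 (r + i) (by omega); omega

/-- The tree that the algorithm builds from the array `a`. -/
noncomputable def treeOf (n : ℕ) (a : ℕ → ℕ) : OTree :=
  (parse ((List.range n).map (rot n (firstMin_eq a n).choose a)) []).headD (OTree.node [])

theorem treeOf_eq {n s : ℕ} {a : ℕ → ℕ} (hs : IsFirstMin a n s) : treeOf n a =
    (parse ((List.range n).map (rot n s a)) []).headD (OTree.node []) := by
  rw [treeOf, (firstMin_eq a n).choose_spec.2.unique hs]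

theorem degrees_treeOf {n s : ℕ} {a : ℕ → ℕ} (h1 : walk a n = -1) (hs : IsFirstMin a n s) :
    (treeOf n a).degrees = (List.range n).map (rot n s a) := by
  obtain ⟨h2, h3⟩ := walk_rot_firstMin h1 hs
  rw [treeOf_eq hs, degrees_parse_of_walk h2 h3]

theorem coe_degrees_treeOf {n : ℕ} {a : ℕ → ℕ} (h1 : walk a n = -1) :
    ((treeOf n a).degrees : Multiset ℕ) = entries a n := by
  obtain ⟨s, -, hs⟩ := firstMin_eq a n
  rw [degrees_treeOf h1 hs, ← entries_rot a hs.1]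
  rfl

theorem coe_degrees_eq_entries (t : OTree) :
    (t.degrees : Multiset ℕ) = entries (degreeArray t) t.numVertices := by
  conv_lhs => rw [← map_degreeArray t]
  rfl

theorem treeOf_rot_degreeArray (t : OTree) {r : ℕ} (hr : r < t.numVertices) :
    treeOf t.numVertices (rot t.numVertices r (degreeArray t)) = t := by
  obtain ⟨h0, h1⟩ := walk_degreeArray t
  have hs := isFirstMin_rot h0 h1 hr
  have hd : ∀ i, t.numVertices ≤ i → degreeArray t i = 0 := fun i hi => by
    rw [degreeArray, List.getD_eq_default _ _ hi]
  rw [treeOf_eq hs, rot_rot hr.le hd, map_degreeArray, parse_degrees]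
  rfl

theorem rot_degreeArray_injOn (t : OTree) : Set.InjOn
    (fun r => rot t.numVertices r (degreeArray t)) (Finset.range t.numVertices) := by
  intro r hr r' hr' h
  obtain ⟨h0, h1⟩ := walk_degreeArray t
  have hr := Finset.mem_range.1 (Finset.mem_coe.1 hr)
  have hr' := Finset.mem_range.1 (Finset.mem_coe.1 hr')
  have hs := isFirstMin_rot h0 h1 hr
  have hs' := isFirstMin_rot h0 h1 hr'
  simp only at h
  rw [← h] at hs'
  have := hs.unique hs'
  omega

/-- The arrays from which the algorithm builds `t` are the cyclic shifts of the degree sequence of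
`t`. -/
theorem exists_rot_of_treeOf_eq {t : OTree} {n : ℕ} {a : ℕ → ℕ} (hn : 1 ≤ n)
    (ha : ∀ i, n ≤ i → a i = 0) (h1 : walk a n = -1) (h : treeOf n a = t) :
    n = t.numVertices ∧ ∃ r < n, a = rot n r (degreeArray t) := by
  obtain ⟨s, -, hs⟩ := firstMin_eq a n
  have hd := degrees_treeOf h1 hs
  rw [h] at hd
  have hlen : n = t.numVertices := by rw [OTree.numVertices, hd]; simp
  have hs1 : 1 ≤ s := by
    by_contra h0
    have h00 : s = 0 := by omega
    have := hs.2.1 n le_rfl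
    rw [h00, h1, walk_zero] at this
    omega
  refine ⟨hlen, n - s, by omega, ?_⟩
  have hrot : rot n s a = degreeArray t := by
    funext l
    by_cases hl : l < n
    · have h2 := map_degreeArray t
      rw [hd, ← hlen] at h2
      have h3 := List.map_inj_left.1 h2 l (List.mem_range.2 hl)
      exact h3.symm
    · rw [rot, if_neg hl, degreeArray, List.getD_eq_default]
      rw [← OTree.numVertices, ← hlen]; exact not_lt.1 hl
  rw [← hrot, rot_rot hs.1 ha]

end

/-! ### The law of the sample -/

section

open scoped Classical
open RandComp

/-- The trial that `sampleDegrees` repeats, with the table of factorials filled in. -/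
noncomputable def degreeTrial (α : ℝ) (v : ℕ → ℝ) (k n : ℕ) : RandComp (Option (List (ℕ × ℕ))) :=
  trial α v (fun i => if i ≤ n - k then (i.factorial : ℝ) else 0) n n 1 (n - k) 1 0 []

/-- The probability of the cell `i`. -/
noncomputable def cellProb (α : ℝ) (v : ℕ → ℝ) (i : ℕ) : ℝ≥0∞ := ENNReal.ofReal (v i / (1 - α))

/-- The arrays that `sampleDegrees` may return: `n - k` positive entries with the sum `n - 1`, followed by
zeros. -/
def IsSample (k n : ℕ) (a : ℕ → ℕ) : Prop :=
  (∀ i, n - k ≤ i → a i = 0) ∧ (∀ i ∈ entries a (n - k), 1 ≤ i) ∧ (entries a (n - k)).sum = n - 1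

section Laws

variable {α : ℝ} {v τ : ℕ → ℝ} {k n : ℕ}

theorem table_eq (N : ℕ) :
    ∀ i ≤ N, (fun i => if i ≤ N then (i.factorial : ℝ) else 0) i = i.factorial :=
  fun _ hi => if_pos hi

theorem mass_degreeTrial : (degreeTrial α v k n).mass = 1 :=
  mass_trial (table_eq _) n n 1 le_rfl 1 0 []

theorem sampleDegrees_eq : sampleDegrees α v k n = delay (1 + (4 * (n - k) + 1))
    (repeatUntil (degreeTrial α v k n) >>= fun counts =>
      expand counts 0 (fun _ => 0) >>= fun a => shuffle (n - k) a) := by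
  simp only [sampleDegrees, step_eq_det, factTable_eq, det_bind, delay_delay]
  rfl

theorem exists_of_law_degreeTrial_ne_zero (hτ : IsTail α v τ) (hτ1 : τ 1 = 1)
    {L : List (ℕ × ℕ)} (hL : (degreeTrial α v k n).law (some L) ≠ 0) :
    (∀ i ∈ ofCounts L, 1 ≤ i) ∧ (ofCounts L).card = n - k ∧ (ofCounts L).sum = n - 1 ∧
      L.length ≤ n := by
  rw [degreeTrial, ← hτ1] at hL
  obtain ⟨M, h1, h2, h3, h4, h5⟩ := exists_of_law_trial_ne_zero (table_eq _) hτ n n 1 le_rfl 0 [] L hL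
  rw [ofCounts, zero_add] at h1
  rw [h1]
  exact ⟨h2, h3, by simpa using h4, by simpa using h5⟩

theorem tsum_law_degreeTrial (hτ : IsTail α v τ) (hτ1 : τ 1 = 1) (hn : 1 ≤ n) {M : Multiset ℕ}
    (h1 : ∀ i ∈ M, 1 ≤ i) (hcard : M.card = n - k) (hsum : M.sum = n - 1) :
    (stab M : ℝ≥0∞) * ∑' L : List (ℕ × ℕ),
      (if ofCounts L = M then (degreeTrial α v k n).law (some L) else 0) =
    (n - k).factorial * (M.map (cellProb α v)).prod := by
  have h := law_trial (table_eq (n - k)) hτ n n 1 le_rfl 0 [] hn M (fun i hi => by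
    have := Multiset.le_sum_of_mem hi
    exact ⟨h1 i hi, by omega⟩) hcard (by rw [zero_add, hsum])
  rw [hτ1] at h
  simp only [one_pow, ENNReal.ofReal_one, one_mul, ofCounts, zero_add] at h
  exact h

/-- Expanding an accepted vector and shuffling gives a uniform rearrangement. -/
theorem law_expand_shuffle (hτ : IsTail α v τ) (hτ1 : τ 1 = 1) {L : List (ℕ × ℕ)}
    (hL : (degreeTrial α v k n).law (some L) ≠ 0) (a : ℕ → ℕ) :
    (expand L 0 (fun _ => 0) >>= fun b => shuffle (n - k) b).law a =
      if (∀ i, n - k ≤ i → a i = 0) ∧ ofCounts L = entries a (n - k) then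
        (stab (entries a (n - k)) : ℝ≥0∞) / ((n - k).factorial : ℝ≥0∞) else 0 := by
  obtain ⟨b, c, h1, -, h2, h3⟩ := expand_eq L 0 (fun _ => 0)
  obtain ⟨-, hcard, -⟩ := exists_of_law_degreeTrial_ne_zero hτ hτ1 hL
  rw [h1, law_det_bind, law_shuffle]
  rw [hcard] at h2 h3
  simp only [zero_add] at h2 h3
  refine if_congr (and_congr ?_ ?_) rfl rfl
  · refine forall_congr' fun i => imp_congr_right fun hi => ?_
    rw [h2 i (Or.inr hi)]
  · rw [h3]

theorem law_sampleDegrees (hτ : IsTail α v τ) (hτ1 : τ 1 = 1) (hn : 1 ≤ n) (a : ℕ → ℕ) :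
    (sampleDegrees α v k n).law a = if IsSample k n a then
      ((entries a (n - k)).map (cellProb α v)).prod * (succ (degreeTrial α v k n))⁻¹ else 0 := by
  rw [sampleDegrees_eq, law_delay, law_bind]
  have hterm : ∀ L : List (ℕ × ℕ), (repeatUntil (degreeTrial α v k n)).law L *
      (expand L 0 (fun _ => 0) >>= fun b => shuffle (n - k) b).law a =
      (if ∀ i, n - k ≤ i → a i = 0 then (stab (entries a (n - k)) : ℝ≥0∞) /
        ((n - k).factorial : ℝ≥0∞) * (succ (degreeTrial α v k n))⁻¹ else 0) *
      (if ofCounts L = entries a (n - k) then (degreeTrial α v k n).law (some L) else 0) := by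
    intro L
    rw [law_repeatUntil, succ_eq mass_degreeTrial]
    by_cases hL : (degreeTrial α v k n).law (some L) = 0
    · simp [hL]
    · rw [law_expand_shuffle hτ hτ1 hL]
      by_cases h1 : ∀ i, n - k ≤ i → a i = 0
      · by_cases h2 : ofCounts L = entries a (n - k)
        · rw [if_pos ⟨h1, h2⟩, if_pos h1, if_pos h2]; ring
        · rw [if_neg (fun h => h2 h.2), if_neg h2]; ring
      · rw [if_neg (fun h => h1 h.1), if_neg h1]; ring
  simp_rw [hterm]
  rw [ENNReal.tsum_mul_left]
  by_cases hz : ∀ i, n - k ≤ i → a i = 0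
  · rw [if_pos hz]
    by_cases hs : IsSample k n a
    · rw [if_pos hs]
      have h := tsum_law_degreeTrial (k := k) hτ hτ1 hn hs.2.1 (entries_card _ _) hs.2.2
      have hf : ((n - k).factorial : ℝ≥0∞)⁻¹ * (n - k).factorial = 1 :=
        ENNReal.inv_mul_cancel (by exact_mod_cast Nat.factorial_ne_zero _) (by simp)
      rw [div_eq_mul_inv, mul_right_comm, mul_right_comm (stab _ : ℝ≥0∞), h,
        mul_comm ((n - k).factorial : ℝ≥0∞), mul_assoc (Multiset.prod _),
        mul_comm ((n - k).factorial : ℝ≥0∞), hf, mul_one]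
    · rw [if_neg hs, ENNReal.tsum_eq_zero.2, mul_zero]
      intro L
      by_contra hne
      have h2 : ofCounts L = entries a (n - k) := by
        by_contra h'; exact hne (if_neg h')
      rw [if_pos h2] at hne
      obtain ⟨h3, -, h4, -⟩ := exists_of_law_degreeTrial_ne_zero hτ hτ1 hne
      exact hs ⟨hz, by rwa [← h2], by rwa [← h2]⟩
  · rw [if_neg hz, zero_mul, if_neg fun h => hz h.1]

theorem prod_cellProb_eq_zero (hτ : IsTail α v τ) (hτ1 : τ 1 = 1) (hn : 1 ≤ n) {M : Multiset ℕ}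
    (h1 : ∀ i ∈ M, 1 ≤ i) (hcard : M.card = n - k) (hsum : M.sum = n - 1)
    (hs : succ (degreeTrial α v k n) = 0) : (M.map (cellProb α v)).prod = 0 := by
  have h := tsum_law_degreeTrial (k := k) hτ hτ1 hn h1 hcard hsum
  rw [ENNReal.tsum_eq_zero.2, mul_zero] at h
  · exact (mul_eq_zero.1 h.symm).resolve_left (by exact_mod_cast Nat.factorial_ne_zero _)
  · intro L
    split_ifs
    · exact ENNReal.tsum_eq_zero.1 hs L
    · rfl

theorem mass_sampleDegrees (hs : succ (degreeTrial α v k n) ≠ 0) : (sampleDegrees α v k n).mass = 1 := by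
  rw [sampleDegrees_eq, mass_delay]
  refine mass_bind_eq_one (mass_repeatUntil mass_degreeTrial hs) fun L => ?_
  obtain ⟨b, c, h1, -⟩ := expand_eq L 0 (fun _ => 0)
  rw [h1, mass_det_bind, mass_shuffle]

/-- A finite sequence as an array. -/
def toArray {N : ℕ} (ξ : Fin N → ℕ) (i : ℕ) : ℕ := if h : i < N then ξ ⟨i, h⟩ else 0

theorem entries_toArray {N : ℕ} (ξ : Fin N → ℕ) :
    entries (toArray ξ) N = (Finset.univ.val : Multiset (Fin N)).map ξ := by
  have : ξ = fun i : Fin N => toArray ξ i := by funext i; simp [toArray]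
  conv_rhs => rw [this]
  rw [entries]
  have h2 : (Finset.univ.val : Multiset (Fin N)).map (fun i : Fin N => (i : ℕ)) =
      Multiset.range N := by
    have h := Fin.map_valEmbedding_univ (n := N)
    rw [Nat.Iio_eq_range] at h
    exact congrArg Finset.val h
  rw [← h2, Multiset.map_map]
  rfl

theorem law_restrict_sampleDegrees (hτ : IsTail α v τ) (hτ1 : τ 1 = 1) (hn : 1 ≤ n)
    (ξ : Fin (n - k) → ℕ) :
    ((fun (a : ℕ → ℕ) (i : Fin (n - k)) => a i) <$> sampleDegrees α v k n).law ξ =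
      (sampleDegrees α v k n).law (toArray ξ) := by
  change (sampleDegrees α v k n >>= fun a => pure (fun i : Fin (n - k) => a i)).law ξ = _
  rw [law_bind, tsum_eq_single (toArray ξ)]
  · have : (fun i : Fin (n - k) => toArray ξ i) = ξ := by funext i; simp [toArray]
    rw [pure_eq_det, law_det, if_pos this, mul_one]
  · intro a ha
    rw [pure_eq_det, law_det]
    by_cases h : (fun i : Fin (n - k) => a i) = ξ
    · have : ¬ IsSample k n a := by
        intro hs
        apply ha
        funext i
        rw [toArray]
        split_ifs with hi
        · rw [← h]
        · exact hs.1 i (not_lt.1 hi)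
      rw [law_sampleDegrees hτ hτ1 hn, if_neg this, zero_mul]
    · rw [if_neg h, mul_zero]

theorem hatStar_eq {w : PMF ℕ} (hα0 : 0 ≤ α) (hα : α < 1) (hv : v = fun j => (w j).toReal) (j : ℕ) :
    hatStar α w j = if j = 0 then 0 else cellProb α v j := by
  rw [hatStar, cellProb, hv]
  split_ifs with h
  · rfl
  · rw [ENNReal.ofReal_div_of_pos (by linarith), ENNReal.ofReal_toReal (PMF.apply_ne_top w j),
      ENNReal.ofReal_sub _ hα0, ENNReal.ofReal_one]

/-- The total weight of the sequences of length `N` with the sum `s`. -/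
noncomputable def sumWeight (p : ℕ → ℝ≥0∞) (N s : ℕ) : ℝ≥0∞ :=
  ∑' η : {η : Fin N → ℕ // ∑ i, η i = s}, ∏ i, p (η.1 i)

theorem law_sample_fin {w : PMF ℕ} (hα0 : 0 ≤ α) (hτ : IsTail α v τ) (hτ1 : τ 1 = 1) (hn : 1 ≤ n)
    (hv : v = fun j => (w j).toReal) (ξ : Fin (n - k) → ℕ) :
    (sampleDegrees α v k n).law (toArray ξ) = (if ∑ i, ξ i = n - 1 then
      ∏ i, hatStar α w (ξ i) else 0) * (succ (degreeTrial α v k n))⁻¹ := by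
  rw [law_sampleDegrees hτ hτ1 hn]
  have hsum : (entries (toArray ξ) (n - k)).sum = ∑ i, ξ i := by rw [entries_toArray]; rfl
  have hz : ∀ i, n - k ≤ i → toArray ξ i = 0 := fun i hi => by simp [toArray, not_lt.2 hi]
  by_cases hs : ∑ i, ξ i = n - 1
  · rw [if_pos hs]
    by_cases hpos : ∀ i, 1 ≤ ξ i
    · have hS : IsSample k n (toArray ξ) := ⟨hz, by
        rw [entries_toArray]; intro i hi
        obtain ⟨l, -, rfl⟩ := Multiset.mem_map.1 hi
        exact hpos l, by rw [hsum, hs]⟩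
      rw [if_pos hS, entries_toArray, Multiset.map_map]
      congr 1
      refine Finset.prod_congr rfl fun i _ => ?_
      rw [hatStar_eq hα0 hτ.lt_one hv, if_neg (Nat.one_le_iff_ne_zero.1 (hpos i))]
      rfl
    · push Not at hpos
      obtain ⟨i, hi⟩ := hpos
      have hi0 : ξ i = 0 := by omega
      have : ¬ IsSample k n (toArray ξ) := by
        intro hS
        have := hS.2.1 (ξ i) (by rw [entries_toArray]; exact Multiset.mem_map_of_mem _ (by simp))
        omega
      rw [if_neg this, Finset.prod_eq_zero (Finset.mem_univ i) (by simp [hatStar, hi0]), zero_mul]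
  · rw [if_neg hs, zero_mul, if_neg]
    intro hS
    exact hs (hsum ▸ hS.2.2)

theorem tsum_ite_sum_eq (p : ℕ → ℝ≥0∞) (N s : ℕ) :
    ∑' ξ : Fin N → ℕ, (if ∑ i, ξ i = s then ∏ i, p (ξ i) else 0) = sumWeight p N s := by
  rw [sumWeight]
  have := tsum_subtype {η : Fin N → ℕ | ∑ i, η i = s} (fun η => ∏ i, p (η i))
  refine Eq.trans ?_ this.symm
  refine tsum_congr fun ξ => ?_
  simp [Set.indicator]

/-- The success probability of a trial is the normalizing constant of the conditional law. -/
theorem succ_degreeTrial {w : PMF ℕ} (hα0 : 0 ≤ α) (hτ : IsTail α v τ) (hτ1 : τ 1 = 1) (hn : 1 ≤ n)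
    (hv : v = fun j => (w j).toReal) :
    succ (degreeTrial α v k n) = sumWeight (hatStar α w) (n - k) (n - 1) := by
  by_cases hs : succ (degreeTrial α v k n) = 0
  · rw [hs, sumWeight, eq_comm, ENNReal.tsum_eq_zero]
    rintro ⟨η, hη⟩
    by_cases hpos : ∀ i, 1 ≤ η i
    · have h := prod_cellProb_eq_zero (k := k) (M := (Finset.univ.val : Multiset _).map η) hτ hτ1 hn
        (by intro i hi
            obtain ⟨l, -, rfl⟩ := Multiset.mem_map.1 hi
            exact hpos l) (by simp) hη hs
      rw [Multiset.map_map] at h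
      refine Eq.trans (Finset.prod_congr rfl fun i _ => ?_) h
      rw [hatStar_eq hα0 hτ.lt_one hv, if_neg (Nat.one_le_iff_ne_zero.1 (hpos i))]
      rfl
    · push Not at hpos
      obtain ⟨i, hi⟩ := hpos
      have hi0 : η i = 0 := by omega
      exact Finset.prod_eq_zero (Finset.mem_univ i) (by simp [hatStar, hi0])
  · have h1 : ((fun (a : ℕ → ℕ) (i : Fin (n - k)) => a i) <$> sampleDegrees α v k n).mass = 1 := by
      change (sampleDegrees α v k n >>= fun a => pure (fun i : Fin (n - k) => a i)).mass = 1
      exact mass_bind_eq_one (mass_sampleDegrees hs) fun a => mass_det _ _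
    rw [← tsum_law] at h1
    simp_rw [law_restrict_sampleDegrees hτ hτ1 hn, law_sample_fin hα0 hτ hτ1 hn hv] at h1
    rw [ENNReal.tsum_mul_right, tsum_ite_sum_eq] at h1
    have hT : succ (degreeTrial α v k n) ≠ ⊤ :=
      ne_top_of_le_ne_top ENNReal.one_ne_top (succ_le_one mass_degreeTrial)
    rw [← ENNReal.mul_inv_cancel hs hT] at h1
    exact ((ENNReal.mul_left_inj (ENNReal.inv_ne_zero.2 hT) (ENNReal.inv_ne_top.2 hs)).1 h1).symm

theorem law_sampleDegrees_eq_condSumLaw {w : PMF ℕ} (hα0 : 0 ≤ α) (hτ : IsTail α v τ) (hτ1 : τ 1 = 1)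
    (hn : 1 ≤ n) (hv : v = fun j => (w j).toReal) (ξ : Fin (n - k) → ℕ) :
    ((fun (a : ℕ → ℕ) (i : Fin (n - k)) => a i) <$> sampleDegrees α v k n).law ξ =
      condSumLaw (hatStar α w) (n - k) (n - 1) ξ := by
  rw [law_restrict_sampleDegrees hτ hτ1 hn, law_sample_fin hα0 hτ hτ1 hn hv,
    succ_degreeTrial hα0 hτ hτ1 hn hv, condSumLaw]
  split_ifs
  · rw [div_eq_mul_inv]; rfl
  · rw [zero_mul]

/-! ### The law of the tree -/

/-- The arrays that are shifted: `n` entries, `k` of them zeros, with the sum `n - 1`. -/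
def IsArrangement (k n : ℕ) (y : ℕ → ℕ) : Prop :=
  (∀ i, n ≤ i → y i = 0) ∧ (entries y n).count 0 = k ∧ (entries y n).sum = n - 1

theorem IsArrangement.walk_eq {y : ℕ → ℕ} (h : IsArrangement k n y) (hn : 1 ≤ n) :
    walk y n = -1 := by
  rw [walk_eq_entries, h.2.2]; omega

theorem entries_sample (hk : k ≤ n) {a : ℕ → ℕ} (ha : IsSample k n a) :
    entries a n = entries a (n - k) + Multiset.replicate k 0 := by
  conv_lhs => rw [← Nat.sub_add_cancel hk, entries_add]
  rw [← entries_const, entries_congr (m := k) fun i _ => ha.1 _ (Nat.le_add_right _ _)]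

theorem algorithmA_eq : algorithmA α v k n = (sampleDegrees α v k n >>= fun a =>
    delay (1 + 3 * k) (shuffle n (fun i => if n - k ≤ i ∧ i < n - k + k then 0 else a i) >>= fun y =>
      det (treeOf n y) (6 * n + (5 * n + (buildTree_eq
        (rot n (firstMin_eq y n).choose y) n).choose)))) := by
  rw [algorithmA]
  congr 1
  funext a
  simp only [step_eq_det, det_bind, fill_eq, delay_delay]
  congr 2
  funext y
  have h1 := (firstMin_eq y n).choose_spec.1
  conv_lhs => rw [h1, det_bind, cyclicShift_eq, det_bind]
  have h2 := (buildTree_eq (rot n (firstMin_eq y n).choose y) n).choose_spec.1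
  change delay (6 * n) (delay (5 * n) (buildTree (rot n (firstMin_eq y n).choose y) n)) = _
  conv_lhs => rw [h2, delay_det, delay_det]
  rfl

/-- The number of samples with given entries. -/
theorem tsum_entries_eq {N : ℕ} {M : Multiset ℕ} (hM : M.card = N) :
    ∑' a : ℕ → ℕ, (if (∀ i, N ≤ i → a i = 0) ∧ entries a N = M then (1 : ℝ≥0∞) else 0) =
      N.factorial / stab M := by
  obtain ⟨b, hb0, hbM⟩ : ∃ b : ℕ → ℕ, (∀ i, N ≤ i → b i = 0) ∧ entries b N = M := by
    refine ⟨fun i => M.toList.getD i 0, fun i hi => List.getD_eq_default _ _ (by simpa [hM]), ?_⟩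
    have h1 : (List.range N).map (fun i => M.toList.getD i 0) = M.toList := by
      refine List.ext_getElem (by simp [hM]) fun i h1 h2 => ?_
      rw [List.getElem_map, List.getElem_range, List.getD_eq_getElem _ _ h2]
    have h2 : entries (fun i => M.toList.getD i 0) N =
      ((List.range N).map (fun i => M.toList.getD i 0) : List ℕ) := rfl
    rw [h2, h1, Multiset.coe_toList]
  have h := tsum_law (shuffle N b)
  rw [mass_shuffle] at h
  have e : ∀ a, (shuffle N b).law a = (if (∀ i, N ≤ i → a i = 0) ∧ entries a N = M then
      (1 : ℝ≥0∞) else 0) * (stab M / N.factorial) := by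
    intro a
    rw [law_shuffle, hbM]
    have hiff : ((∀ i, N ≤ i → a i = b i) ∧ M = entries a N) ↔
        ((∀ i, N ≤ i → a i = 0) ∧ entries a N = M) := by
      refine and_congr (forall_congr' fun i => imp_congr_right fun hi => by rw [hb0 i hi]) eq_comm
    rw [if_congr hiff rfl rfl]
    split_ifs with h'
    · rw [h'.2, one_mul]
    · rw [zero_mul]
  simp_rw [e] at h
  rw [ENNReal.tsum_mul_right] at h
  rw [ENNReal.eq_div_iff (by exact_mod_cast (stab_pos M).ne') (by simp), mul_comm]
  have hf0 : (N.factorial : ℝ≥0∞) ≠ 0 := by exact_mod_cast Nat.factorial_ne_zero N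
  rw [← mul_div_assoc] at h
  exact (ENNReal.div_eq_one_iff hf0 (by simp)).1 h

/-- The weight of an entry: leaves have the weight `1`. -/
noncomputable def leafProb (α : ℝ) (v : ℕ → ℝ) (i : ℕ) : ℝ≥0∞ := if i = 0 then 1 else cellProb α v i

/-- After the second permutation, the probability of an array with `k` zeros is proportional to the
product of the cell probabilities of its positive entries. -/
theorem exists_law_arrangement (hτ : IsTail α v τ) (hτ1 : τ 1 = 1) (hn : 1 ≤ n) (hk : k ≤ n) :
    ∃ κ : ℝ≥0∞, ∀ y : ℕ → ℕ, ∑' a, (sampleDegrees α v k n).law a *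
      (shuffle n (fun i => if n - k ≤ i ∧ i < n - k + k then 0 else a i)).law y =
      if IsArrangement k n y then κ * ((entries y n).map (leafProb α v)).prod else 0 := by
  refine ⟨(k.factorial * (n - k).factorial / n.factorial) * (succ (degreeTrial α v k n))⁻¹,
    fun y => ?_⟩
  have hterm : ∀ a, (sampleDegrees α v k n).law a *
      (shuffle n (fun i => if n - k ≤ i ∧ i < n - k + k then 0 else a i)).law y =
      if IsSample k n a ∧ (∀ i, n ≤ i → y i = 0) ∧
          entries a (n - k) + Multiset.replicate k 0 = entries y n then
        ((entries a (n - k)).map (cellProb α v)).prod * (succ (degreeTrial α v k n))⁻¹ *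
          (stab (entries y n) / n.factorial) else 0 := by
    intro a
    rw [law_sampleDegrees hτ hτ1 hn]
    by_cases ha : IsSample k n a
    · have hfill : (fun i => if n - k ≤ i ∧ i < n - k + k then 0 else a i) = a := by
        funext i
        split_ifs with h
        · exact (ha.1 i h.1).symm
        · rfl
      rw [if_pos ha, hfill, law_shuffle, mul_ite, mul_zero]
      refine if_congr ?_ rfl rfl
      rw [entries_sample hk ha]
      simp only [ha, true_and]
      refine and_congr_left fun _ => forall_congr' fun i => imp_congr_right fun hi => ?_
      rw [ha.1 i ((Nat.sub_le n k).trans hi)]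
    · rw [if_neg ha, if_neg (fun h => ha h.1), zero_mul]
  simp_rw [hterm]
  by_cases hy : IsArrangement k n y
  · rw [if_pos hy]
    set M := (entries y n).filter (fun i => i ≠ 0) with hM
    have hsplit : Multiset.replicate k 0 + M = entries y n := by
      have := replicate_count_add_filter 0 (entries y n)
      rwa [hy.2.1] at this
    have h0M : 0 ∉ M := by simp [hM]
    have hcardM : M.card = n - k := by
      have := congrArg Multiset.card hsplit
      rw [Multiset.card_add, Multiset.card_replicate, entries_card] at this
      omega
    have hsumM : M.sum = n - 1 := by
      have := congrArg Multiset.sum hsplit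
      rwa [Multiset.sum_add, Multiset.sum_replicate, smul_zero, zero_add, hy.2.2] at this
    have hprod : ((entries y n).map (leafProb α v)).prod = (M.map (cellProb α v)).prod := by
      rw [← hsplit, Multiset.map_add, Multiset.prod_add, Multiset.map_replicate,
        Multiset.prod_replicate, leafProb, if_pos rfl, one_pow, one_mul]
      refine congrArg Multiset.prod (Multiset.map_congr rfl fun i hi => ?_)
      rw [leafProb, if_neg (ne_of_mem_of_not_mem hi h0M)]
    have e : ∀ a, (if IsSample k n a ∧ (∀ i, n ≤ i → y i = 0) ∧
          entries a (n - k) + Multiset.replicate k 0 = entries y n then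
        ((entries a (n - k)).map (cellProb α v)).prod * (succ (degreeTrial α v k n))⁻¹ *
          ((stab (entries y n) : ℝ≥0∞) / n.factorial) else 0) =
        (if (∀ i, n - k ≤ i → a i = 0) ∧ entries a (n - k) = M then (1 : ℝ≥0∞) else 0) *
          ((M.map (cellProb α v)).prod * (succ (degreeTrial α v k n))⁻¹ *
          (stab (entries y n) / n.factorial)) := by
      intro a
      have hiff : (IsSample k n a ∧ (∀ i, n ≤ i → y i = 0) ∧
          entries a (n - k) + Multiset.replicate k 0 = entries y n) ↔
          ((∀ i, n - k ≤ i → a i = 0) ∧ entries a (n - k) = M) := by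
        rw [← hsplit, add_comm, add_right_inj]
        constructor
        · rintro ⟨h1, -, h2⟩; exact ⟨h1.1, h2⟩
        · rintro ⟨h1, h2⟩
          refine ⟨⟨h1, ?_, by rw [h2, hsumM]⟩, hy.1, h2⟩
          rw [h2]
          intro i hi
          exact Nat.one_le_iff_ne_zero.2 fun h => h0M (h ▸ hi)
      rw [if_congr hiff rfl rfl]
      split_ifs with h
      · rw [h.2, one_mul]
      · rw [zero_mul]
    simp_rw [e]
    have hstab : stab (entries y n) = k.factorial * stab M := by
      rw [← hsplit, stab_replicate_add h0M]
    rw [ENNReal.tsum_mul_right, tsum_entries_eq hcardM, hprod, hstab]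
    have hc : (stab M : ℝ≥0∞)⁻¹ * stab M = 1 :=
      ENNReal.inv_mul_cancel (by exact_mod_cast (stab_pos M).ne') (by simp)
    simp only [div_eq_mul_inv, Nat.cast_mul]
    calc _ = ((k.factorial : ℝ≥0∞) * (n - k).factorial * (n.factorial : ℝ≥0∞)⁻¹) *
          (succ (degreeTrial α v k n))⁻¹ * (M.map (cellProb α v)).prod *
          ((stab M : ℝ≥0∞)⁻¹ * stab M) := by ring
      _ = _ := by rw [hc, mul_one]
  · rw [if_neg hy]
    refine ENNReal.tsum_eq_zero.2 fun a => if_neg ?_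
    rintro ⟨h1, h2, h3⟩
    refine hy ⟨h2, ?_, ?_⟩
    · rw [← h3, Multiset.count_add, Multiset.count_replicate_self,
        Multiset.count_eq_zero_of_notMem, zero_add]
      intro h0
      have := h1.2.1 0 h0
      omega
    · rw [← h3, Multiset.sum_add, Multiset.sum_replicate, h1.2.2]; simp

theorem law_algorithmA (hτ : IsTail α v τ) (hτ1 : τ 1 = 1) (hn : 1 ≤ n) (hk : k ≤ n) :
    ∃ κ : ℝ≥0∞, ∀ t : OTree, (algorithmA α v k n).law t =
      if t.numLeaves = k ∧ t.numVertices = n then κ * (t.degrees.map (leafProb α v)).prod else 0 := by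
  obtain ⟨κ, hκ⟩ := exists_law_arrangement (v := v) (τ := τ) hτ hτ1 hn hk
  refine ⟨n * κ, fun t => ?_⟩
  have h1 : (algorithmA α v k n).law t = ∑' y, (if IsArrangement k n y then
      κ * ((entries y n).map (leafProb α v)).prod else 0) * (if treeOf n y = t then 1 else 0) := by
    rw [algorithmA_eq, law_bind]
    simp_rw [law_delay, law_bind, law_det, ← hκ, ← ENNReal.tsum_mul_left, ← ENNReal.tsum_mul_right]
    rw [ENNReal.tsum_comm]
    simp_rw [mul_assoc]
  rw [h1]
  by_cases ht : t.numLeaves = k ∧ t.numVertices = n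
  · rw [if_pos ht]
    obtain ⟨hleaf, rfl⟩ := ht
    set n := t.numVertices with hnt
    have hent : ∀ r < n, entries (rot n r (degreeArray t)) n = (t.degrees : Multiset ℕ) := by
      intro r hr
      rw [entries_rot _ hr.le, ← coe_degrees_eq_entries]
    have hsum : (t.degrees : Multiset ℕ).sum = n - 1 := by
      have := walk_eq_entries (degreeArray t) n
      rw [(walk_degreeArray t).2, ← coe_degrees_eq_entries] at this
      omega
    have harr : ∀ r < n, IsArrangement k n (rot n r (degreeArray t)) := by
      intro r hr
      refine ⟨fun i hi => if_neg (not_lt.2 hi), ?_, ?_⟩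
      · rw [hent r hr, Multiset.coe_count]; exact hleaf
      · rw [hent r hr, hsum]
    rw [tsum_eq_sum (s := (Finset.range n).image fun r => rot n r (degreeArray t))]
    · rw [Finset.sum_image (rot_degreeArray_injOn t)]
      have e : ∀ r ∈ Finset.range n, (if IsArrangement k n (rot n r (degreeArray t)) then
          κ * ((entries (rot n r (degreeArray t)) n).map (leafProb α v)).prod else 0) *
          (if treeOf n (rot n r (degreeArray t)) = t then 1 else 0) =
          κ * (t.degrees.map (leafProb α v)).prod := by
        intro r hr
        have hr' := Finset.mem_range.1 hr
        rw [if_pos (harr r hr'), if_pos (treeOf_rot_degreeArray t hr'), hent r hr', mul_one]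
        simp
      rw [Finset.sum_congr rfl e]
      simp [mul_assoc]
    · intro y hy
      by_contra hne
      rw [mul_eq_zero, not_or] at hne
      have hA : IsArrangement k n y := by by_contra h'; exact hne.1 (if_neg h')
      have hT : treeOf n y = t := by by_contra h'; exact hne.2 (if_neg h')
      obtain ⟨-, r, hr, hyr⟩ := exists_rot_of_treeOf_eq hn hA.1 (hA.walk_eq hn) hT
      exact hy (Finset.mem_image.2 ⟨r, Finset.mem_range.2 hr, hyr.symm⟩)
  · rw [if_neg ht]
    refine ENNReal.tsum_eq_zero.2 fun y => ?_
    by_contra hne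
    rw [mul_eq_zero, not_or] at hne
    have hA : IsArrangement k n y := by by_contra h'; exact hne.1 (if_neg h')
    have hT : treeOf n y = t := by by_contra h'; exact hne.2 (if_neg h')
    have hd := coe_degrees_treeOf (hA.walk_eq hn)
    rw [hT] at hd
    refine ht ⟨?_, ?_⟩
    · rw [OTree.numLeaves, ← Multiset.coe_count, hd, hA.2.1]
    · rw [OTree.numVertices, ← Multiset.coe_card, hd, entries_card]

theorem mass_algorithmA (hs : succ (degreeTrial α v k n) ≠ 0) : (algorithmA α v k n).mass = 1 := by
  rw [algorithmA_eq]
  refine mass_bind_eq_one (mass_sampleDegrees hs) fun a => ?_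
  rw [mass_delay]
  exact mass_bind_eq_one (mass_shuffle _ _) fun y => mass_det _ _

/-- Apart from the trials, the algorithm takes linear time. -/
theorem cost_algorithmA_le (hτ : IsTail α v τ) (hτ1 : τ 1 = 1) (hk : k ≤ n) (hn : 1 ≤ n)
    (hs : succ (degreeTrial α v k n) ≠ 0) :
    (algorithmA α v k n).cost ≤ (degreeTrial α v k n).cost * (succ (degreeTrial α v k n))⁻¹ +
      (50 * n : ℕ) := by
  have hms := mass_sampleDegrees hs
  have hE : ∀ L : List (ℕ × ℕ),
      (expand L 0 (fun _ => 0) >>= fun b => shuffle (n - k) b).mass = 1 := fun L => by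
    obtain ⟨b, c, h1, -⟩ := expand_eq L 0 (fun _ => 0)
    rw [h1, mass_det_bind, mass_shuffle]
  have h1 : (sampleDegrees α v k n).cost ≤ (degreeTrial α v k n).cost *
      (succ (degreeTrial α v k n))⁻¹ + (20 * n : ℕ) := by
    rw [sampleDegrees_eq]
    refine (cost_delay_le _ (mass_bind_le_one (mass_repeatUntil mass_degreeTrial hs).le
      fun L => (hE L).le)).trans ?_
    refine (add_le_add le_rfl (cost_bind_le_add (mass_repeatUntil mass_degreeTrial hs).le
      (fun L => (hE L).le) (cost_repeatUntil_le mass_degreeTrial) (d := (11 * n : ℕ)) ?_)).trans ?_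
    · intro L hL
      rw [law_repeatUntil] at hL
      have hL' : (degreeTrial α v k n).law (some L) ≠ 0 := fun h => hL (by rw [h, zero_mul])
      obtain ⟨-, h3, -, h4⟩ := exists_of_law_degreeTrial_ne_zero hτ hτ1 hL'
      obtain ⟨b, c, h5, h6, -⟩ := expand_eq L 0 (fun _ => 0)
      rw [h5]
      refine (cost_det_bind_le (mass_shuffle _ _).le).trans
        ((add_le_add le_rfl (cost_shuffle_le _ _)).trans ?_)
      norm_cast
      omega
    · rw [add_left_comm]
      gcongr
      norm_cast
      omega
  have hm2 : ∀ a : ℕ → ℕ, (delay (1 + 3 * k) (shuffle n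
      (fun i => if n - k ≤ i ∧ i < n - k + k then 0 else a i) >>= fun y =>
      det (treeOf n y) (6 * n + (5 * n + (buildTree_eq
        (rot n (firstMin_eq y n).choose y) n).choose)))).mass = 1 := fun a => by
    rw [mass_delay]
    exact mass_bind_eq_one (mass_shuffle _ _) fun y => mass_det _ _
  rw [algorithmA_eq]
  refine (cost_bind_le_add hms.le (fun a => (hm2 a).le) h1 (d := (30 * n : ℕ)) ?_).trans ?_
  · intro a _
    refine (cost_delay_le _ (mass_bind_le_one (mass_shuffle _ _).le
      fun y => (mass_det _ _).le)).trans ?_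
    refine (add_le_add le_rfl (cost_bind_le_add (mass_shuffle _ _).le
      (fun y => (mass_det _ _).le) (cost_shuffle_le _ _) (d := (16 * n : ℕ)) ?_)).trans ?_
    · intro y _
      rw [cost_det]
      have := (buildTree_eq (rot n (firstMin_eq y n).choose y) n).choose_spec.2
      norm_cast
      omega
    · norm_cast
      omega
  · rw [add_assoc]
    gcongr
    norm_cast
    omega

end Laws

end

/-! ### The conditioned Galton--Watson law -/

section

open scoped Classical
open MeasureTheory

mutual
/-- The labels of the vertices of a family tree with the root `u`, in depth-first order. -/
def labels : List ℕ → OTree → List (List ℕ)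
  | u, .node cs => u :: forestLabels u 0 cs
/-- The labels of the vertices of the family trees of the children `i, i + 1, …` of `u`. -/
def forestLabels : List ℕ → ℕ → List OTree → List (List ℕ)
  | _, _, [] => []
  | u, i, t :: ts => labels (i :: u) t ++ forestLabels u (i + 1) ts
end

mutual
theorem length_labels : ∀ (u : List ℕ) (t : OTree), (labels u t).length = t.degrees.length
  | u, .node cs => by
    rw [labels, OTree.degrees, List.length_cons, List.length_cons, length_forestLabels u 0 cs]
theorem length_forestLabels : ∀ (u : List ℕ) (i : ℕ) (ts : List OTree),
    (forestLabels u i ts).length = (OTree.forestDegrees ts).length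
  | _, _, [] => rfl
  | u, i, t :: ts => by
    rw [forestLabels, OTree.forestDegrees, List.length_append, List.length_append,
      length_labels (i :: u) t, length_forestLabels u (i + 1) ts]
end

mutual
theorem isFamilyTree_iff (L : List ℕ → ℕ) : ∀ (u : List ℕ) (t : OTree),
    IsFamilyTree L u t ↔ (labels u t).map L = t.degrees
  | u, .node cs => by
    rw [IsFamilyTree, labels, OTree.degrees, List.map_cons, List.cons.injEq,
      isFamilyForest_iff L u 0 cs]
theorem isFamilyForest_iff (L : List ℕ → ℕ) : ∀ (u : List ℕ) (i : ℕ) (ts : List OTree),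
    IsFamilyForest L u i ts ↔ (forestLabels u i ts).map L = OTree.forestDegrees ts
  | _, _, [] => by simp [IsFamilyForest, forestLabels, OTree.forestDegrees]
  | u, i, t :: ts => by
    rw [IsFamilyForest, forestLabels, OTree.forestDegrees, List.map_append,
      isFamilyTree_iff L (i :: u) t, isFamilyForest_iff L u (i + 1) ts]
    refine ⟨fun h => by rw [h.1, h.2], fun h => List.append_inj h ?_⟩
    rw [List.length_map, length_labels]
end

mutual
theorem suffix_of_mem_labels : ∀ (u : List ℕ) (t : OTree), ∀ x ∈ labels u t, u <:+ x
  | u, .node cs, x, hx => by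
    rw [labels, List.mem_cons] at hx
    rcases hx with rfl | hx
    · exact List.suffix_refl _
    · obtain ⟨j, -, hj⟩ := suffix_of_mem_forestLabels u 0 cs x hx
      exact (List.suffix_cons j u).trans hj
theorem suffix_of_mem_forestLabels : ∀ (u : List ℕ) (i : ℕ) (ts : List OTree),
    ∀ x ∈ forestLabels u i ts, ∃ j, i ≤ j ∧ (j :: u) <:+ x
  | _, _, [], x, hx => by simp [forestLabels] at hx
  | u, i, t :: ts, x, hx => by
    rw [forestLabels, List.mem_append] at hx
    rcases hx with hx | hx
    · exact ⟨i, le_rfl, suffix_of_mem_labels (i :: u) t x hx⟩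
    · obtain ⟨j, h1, h2⟩ := suffix_of_mem_forestLabels u (i + 1) ts x hx
      exact ⟨j, by omega, h2⟩
end

mutual
theorem nodup_labels : ∀ (u : List ℕ) (t : OTree), (labels u t).Nodup
  | u, .node cs => by
    rw [labels, List.nodup_cons]
    refine ⟨fun hu => ?_, nodup_forestLabels u 0 cs⟩
    obtain ⟨j, -, hj⟩ := suffix_of_mem_forestLabels u 0 cs u hu
    have := hj.length_le
    simp at this
theorem nodup_forestLabels : ∀ (u : List ℕ) (i : ℕ) (ts : List OTree), (forestLabels u i ts).Nodup
  | _, _, [] => by simp [forestLabels]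
  | u, i, t :: ts => by
    rw [forestLabels]
    refine List.Nodup.append (nodup_labels (i :: u) t) (nodup_forestLabels u (i + 1) ts) ?_
    intro x hx hx'
    have h1 := suffix_of_mem_labels (i :: u) t x hx
    obtain ⟨j, hj, h2⟩ := suffix_of_mem_forestLabels u (i + 1) ts x hx'
    have h3 := (List.suffix_of_suffix_length_le h1 h2 (by simp)).eq_of_length (by simp)
    have := (List.cons.inj h3).1
    omega
end

mutual
theorem IsFamilyTree.unique {L : List ℕ → ℕ} : ∀ (u : List ℕ) (t t' : OTree),
    IsFamilyTree L u t → IsFamilyTree L u t' → t = t'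
  | u, .node cs, .node cs', h, h' => by
    rw [IsFamilyTree] at h h'
    rw [IsFamilyForest.unique u 0 cs cs' (h.1.symm.trans h'.1) h.2 h'.2]
theorem IsFamilyForest.unique {L : List ℕ → ℕ} : ∀ (u : List ℕ) (i : ℕ) (ts ts' : List OTree),
    ts.length = ts'.length → IsFamilyForest L u i ts → IsFamilyForest L u i ts' → ts = ts'
  | _, _, [], [], _, _, _ => rfl
  | _, _, [], _ :: _, hl, _, _ => by simp at hl
  | _, _, _ :: _, [], hl, _, _ => by simp at hl
  | u, i, t :: ts, t' :: ts', hl, h, h' => by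
    rw [IsFamilyForest] at h h'
    rw [IsFamilyTree.unique (i :: u) t t' h.1 h'.1,
      IsFamilyForest.unique u (i + 1) ts ts' (by simpa using hl) h.2 h'.2]
end

/-- Distinct individuals have independent offspring numbers. -/
theorem gwMeasure_cylinder (w : PMF ℕ) {ls : List (List ℕ)} (hls : ls.Nodup) {ds : List ℕ}
    (hlen : ls.length = ds.length) :
    MeasurableSet {L : List ℕ → ℕ | ls.map L = ds} ∧
    gwMeasure w {L | ls.map L = ds} = (ds.map w).prod := by
  obtain ⟨L₀, hL₀⟩ : ∃ L₀ : List ℕ → ℕ, ls.map L₀ = ds := by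
    refine ⟨fun x => ds.getD (ls.idxOf x) 0, List.ext_getElem (by simpa) fun i h1 h2 => ?_⟩
    rw [List.getElem_map, hls.idxOf_getElem, List.getD_eq_getElem _ _ h2]
  have hset : {L : List ℕ → ℕ | ls.map L = ds} =
      Set.pi (ls.toFinset : Set (List ℕ)) (fun x => {L₀ x}) := by
    ext L
    simp only [Set.mem_ofPred_eq, ← hL₀, Set.mem_pi, List.coe_toFinset, Set.mem_singleton_iff]
    exact List.map_inj_left
  rw [hset]
  refine ⟨MeasurableSet.pi (Finset.countable_toSet _) fun _ _ => MeasurableSet.of_discrete, ?_⟩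
  rw [gwMeasure, Measure.infinitePi_pi _ fun _ _ => MeasurableSet.of_discrete]
  simp_rw [PMF.toMeasure_apply_singleton w _ (MeasurableSet.singleton _)]
  rw [← hL₀, List.map_map, List.prod_toFinset _ hls]
  rfl

theorem measurableSet_familyTreeIs (t : OTree) : MeasurableSet (familyTreeIs t) := by
  simp_rw [familyTreeIs, isFamilyTree_iff]
  exact (gwMeasure_cylinder (PMF.pure 0) (nodup_labels [] t) (length_labels [] t)).1

theorem gwMeasure_familyTreeIs (w : PMF ℕ) (t : OTree) :
    gwMeasure w (familyTreeIs t) = (t.degrees.map w).prod := by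
  simp_rw [familyTreeIs, isFamilyTree_iff]
  exact (gwMeasure_cylinder w (nodup_labels [] t) (length_labels [] t)).2

instance : Countable OTree := degrees_injective.countable

theorem familyTreeIn_eq (k n : ℕ) : familyTreeIn k n =
    ⋃ t : {t : OTree // t.numLeaves = k ∧ t.numVertices = n}, familyTreeIs t.1 := by
  ext L
  simp only [familyTreeIn, familyTreeIs, Set.mem_ofPred_eq, Set.mem_iUnion, Subtype.exists,
    exists_prop, and_assoc]

theorem measurableSet_familyTreeIn (k n : ℕ) : MeasurableSet (familyTreeIn k n) := by
  rw [familyTreeIn_eq]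
  exact MeasurableSet.iUnion fun t => measurableSet_familyTreeIs t.1

theorem gwMeasure_familyTreeIn (w : PMF ℕ) (k n : ℕ) : gwMeasure w (familyTreeIn k n) =
    ∑' t : OTree, if t.numLeaves = k ∧ t.numVertices = n then (t.degrees.map w).prod else 0 := by
  rw [familyTreeIn_eq, measure_iUnion (f := fun t : {t : OTree // t.numLeaves = k ∧ t.numVertices = n} =>
    familyTreeIs t.1) ?_ fun t => measurableSet_familyTreeIs t.1]
  · simp_rw [gwMeasure_familyTreeIs]
    have := tsum_subtype {t : OTree | t.numLeaves = k ∧ t.numVertices = n}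
      (fun t => (t.degrees.map w).prod)
    refine this.trans (tsum_congr fun t => ?_)
    simp [Set.indicator]
  · intro t t' htt'
    refine Set.disjoint_left.2 fun L h h' => htt' (Subtype.ext ?_)
    exact IsFamilyTree.unique [] t.1 t'.1 h h'

theorem condTreeLaw_eq (w : PMF ℕ) (k n : ℕ) (t : OTree) : condTreeLaw w k n t =
    if t.numLeaves = k ∧ t.numVertices = n then
      (gwMeasure w (familyTreeIn k n))⁻¹ * (t.degrees.map w).prod else 0 := by
  rw [condTreeLaw, ProbabilityTheory.cond_apply (measurableSet_familyTreeIn k n)]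
  split_ifs with h
  · have hsub : familyTreeIs t ⊆ familyTreeIn k n := fun L hL => ⟨t, h.1, h.2, hL⟩
    rw [Set.inter_eq_right.2 hsub, gwMeasure_familyTreeIs]
  · rw [show familyTreeIn k n ∩ familyTreeIs t = ∅ from ?_, measure_empty, mul_zero]
    refine Set.eq_empty_of_forall_notMem fun L hL => ?_
    obtain ⟨⟨t', h1, h2, h3⟩, h4⟩ := hL
    rw [IsFamilyTree.unique [] t' t h3 h4] at h1 h2
    exact h ⟨h1, h2⟩

/-- A pair is in `PP w` if and only if some tree with these parameters has positive weight. -/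
theorem PP_iff (w : PMF ℕ) (k n : ℕ) : PP w k n ↔
    ∃ t : OTree, t.numLeaves = k ∧ t.numVertices = n ∧ ∀ d ∈ t.degrees, w d ≠ 0 := by
  rw [PP, gwMeasure_familyTreeIn, ne_eq, ENNReal.tsum_eq_zero, not_forall]
  refine exists_congr fun t => ?_
  rw [ite_eq_right_iff, Classical.not_imp, List.prod_eq_zero_iff, and_assoc]
  simp [List.mem_map]

theorem one_le_numVertices (t : OTree) : 1 ≤ t.numVertices := by
  cases t with
  | node cs => simp [OTree.numVertices, OTree.degrees]

theorem numLeaves_le (t : OTree) : t.numLeaves ≤ t.numVertices := List.count_le_length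

theorem one_le_numLeaves (t : OTree) : 1 ≤ t.numLeaves := by
  by_contra h
  have h0 : ∀ l : List ℕ, l.count 0 = 0 → excess l ≤ 0 := by
    intro l
    induction l with
    | nil => intro _; exact le_rfl
    | cons d l ih =>
      intro hl
      rw [List.count_cons] at hl
      have h1 := ih (by omega)
      have h2 : d ≠ 0 := by rintro rfl; simp at hl
      rw [excess_cons]; omega
  have h1 := excess_degrees t
  have h2 := h0 t.degrees (by rw [OTree.numLeaves] at h; omega)
  omega

theorem sum_degrees (t : OTree) : t.degrees.sum = t.numVertices - 1 := by
  have h : ∀ l : List ℕ, excess l = l.length - l.sum := by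
    intro l
    induction l with
    | nil => rfl
    | cons d l ih => rw [excess_cons, ih, List.length_cons, List.sum_cons]; push_cast; ring
  have h1 := h t.degrees
  rw [excess_degrees] at h1
  rw [OTree.numVertices]; omega

/-- The output of the algorithm has the conditional law: both laws are proportional to the product
of the weights of the vertices, and both have the total mass `1`. -/
theorem law_algorithmA_eq_condTreeLaw {w v : PMF ℕ} {α : ℝ} {τ : ℕ → ℝ} {k n : ℕ}
    (hτ : IsTail α (fun j => (v j).toReal) τ) (hτ1 : τ 1 = 1)
    (hs : RandComp.succ (degreeTrial α (fun j => (v j).toReal) k n) ≠ 0) (hPP : PP w k n)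
    {C s : ℝ} (hC : 0 < C) (hs0 : 0 < s)
    (hv : ∀ j : ℕ, 1 ≤ j → v j = ENNReal.ofReal (C * s ^ (j - 1)) * w j) (t : OTree) :
    (algorithmA α (fun j => (v j).toReal) k n).law t = condTreeLaw w k n t := by
  obtain ⟨t₀, hk₀, hn₀, ht₀⟩ := (PP_iff w k n).1 hPP
  have hn : 1 ≤ n := hn₀ ▸ one_le_numVertices t₀
  have hk : k ≤ n := hk₀ ▸ hn₀ ▸ numLeaves_le t₀
  have hw0 : w 0 ≠ 0 := by
    refine ht₀ 0 (List.count_pos_iff.1 ?_)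
    exact one_le_numLeaves t₀
  obtain ⟨κ, hκ⟩ := law_algorithmA (k := k) hτ hτ1 hn hk
  -- the weights of the leaves and the tilting factors are the same for all trees in question
  obtain ⟨κ', hκ'⟩ : ∃ κ' : ℝ≥0∞, ∀ t : OTree, t.numLeaves = k ∧ t.numVertices = n →
      κ * (t.degrees.map (leafProb α fun j => (v j).toReal)).prod =
        κ' * (t.degrees.map w).prod := by
    have hcell : ∀ j, 1 ≤ j → cellProb α (fun j => (v j).toReal) j =
        ENNReal.ofReal (C / (1 - α)) * ENNReal.ofReal s ^ (j - 1) * w j := by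
      intro j hj
      rw [cellProb, hv j hj, ENNReal.toReal_mul,
        ENNReal.toReal_ofReal (by positivity), mul_div_right_comm, mul_div_right_comm,
        ENNReal.ofReal_mul (by have := hτ.lt_one; have : 0 < 1 - α := by linarith
                               positivity), ENNReal.ofReal_toReal (PMF.apply_ne_top w j),
        ENNReal.ofReal_mul (by have := hτ.lt_one; have : 0 < 1 - α := by linarith
                               positivity), ENNReal.ofReal_pow hs0.le]
    have hprod : ∀ l : List ℕ, w 0 ^ l.count 0 * ENNReal.ofReal s ^ (l.length - l.count 0) *
        (l.map (leafProb α fun j => (v j).toReal)).prod =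
        ENNReal.ofReal (C / (1 - α)) ^ (l.length - l.count 0) * ENNReal.ofReal s ^ l.sum *
          (l.map w).prod := by
      intro l
      induction l with
      | nil => simp
      | cons d l ih =>
        have hle : l.count 0 ≤ l.length := List.count_le_length
        rw [List.map_cons, List.map_cons, List.prod_cons, List.prod_cons, List.sum_cons,
          List.length_cons]
        by_cases hd : d = 0
        · subst hd
          rw [List.count_cons_self, leafProb, if_pos rfl, Nat.add_sub_add_right, zero_add]
          calc _ = w 0 * (w 0 ^ l.count 0 * ENNReal.ofReal s ^ (l.length - l.count 0) *
              (l.map (leafProb α fun j => (v j).toReal)).prod) := by ring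
            _ = _ := by rw [ih]; ring
        · rw [List.count_cons_of_ne hd, leafProb, if_neg hd,
            hcell d (Nat.one_le_iff_ne_zero.2 hd), Nat.sub_add_comm hle]
          obtain ⟨e, rfl⟩ := Nat.exists_eq_succ_of_ne_zero hd
          calc _ = ENNReal.ofReal (C / (1 - α)) * ENNReal.ofReal s ^ (e + 1) * w (e + 1) *
              (w 0 ^ l.count 0 * ENNReal.ofReal s ^ (l.length - l.count 0) *
              (l.map (leafProb α fun j => (v j).toReal)).prod) := by
                rw [Nat.succ_eq_add_one, Nat.add_sub_cancel]; ring
            _ = _ := by rw [ih, Nat.succ_eq_add_one]; ring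
    have hA0 : w 0 ^ k * ENNReal.ofReal s ^ (n - k) ≠ 0 :=
      mul_ne_zero (pow_ne_zero _ hw0) (pow_ne_zero _ (by simpa using hs0))
    have hAT : w 0 ^ k * ENNReal.ofReal s ^ (n - k) ≠ ⊤ :=
      ENNReal.mul_ne_top (ENNReal.pow_ne_top (PMF.apply_ne_top w 0))
        (ENNReal.pow_ne_top ENNReal.ofReal_ne_top)
    refine ⟨κ * (w 0 ^ k * ENNReal.ofReal s ^ (n - k))⁻¹ *
      (ENNReal.ofReal (C / (1 - α)) ^ (n - k) * ENNReal.ofReal s ^ (n - 1)), fun t ht => ?_⟩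
    have h := hprod t.degrees
    rw [sum_degrees, ← OTree.numVertices, ← OTree.numLeaves, ht.1, ht.2] at h
    rw [mul_assoc, ← h, mul_assoc κ, ← mul_assoc _⁻¹, ENNReal.inv_mul_cancel hA0 hAT, one_mul]
  have hlaw : ∀ t, (algorithmA α (fun j => (v j).toReal) k n).law t = κ' *
      if t.numLeaves = k ∧ t.numVertices = n then (t.degrees.map w).prod else 0 := by
    intro t
    rw [hκ t]
    split_ifs with h
    · exact hκ' t h
    · rw [mul_zero]
  have hmass := RandComp.tsum_law (algorithmA α (fun j => (v j).toReal) k n)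
  rw [mass_algorithmA hs] at hmass
  simp_rw [hlaw] at hmass
  rw [ENNReal.tsum_mul_left, ← gwMeasure_familyTreeIn] at hmass
  have hκinv : κ' = (gwMeasure w (familyTreeIn k n))⁻¹ := ENNReal.eq_inv_of_mul_eq_one_left hmass
  rw [hlaw, condTreeLaw_eq, hκinv, mul_ite, mul_zero]

end

/-! ### The shifted offspring distribution -/

section

open scoped Classical
open Filter

theorem summable_of_lt_radius {w : PMF ℕ} {r : ℝ≥0} (hr : (r : ℝ≥0∞) < radius w) :
    Summable fun i : ℕ => (w i).toReal * (r : ℝ) ^ i := by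
  have h := FormalMultilinearSeries.summable_norm_mul_pow _ hr
  refine h.congr fun i => ?_
  rw [FormalMultilinearSeries.ofScalars_norm, Real.norm_eq_abs, abs_of_nonneg ENNReal.toReal_nonneg]

theorem exists_le_geometric {u : ℕ → ℝ} {r : ℝ} (hr : 0 < r) (hu : ∀ i, 0 ≤ u i)
    (hs : Summable fun i : ℕ => u i * r ^ i) : ∃ M, 0 ≤ M ∧ ∀ i, u i ≤ M * (1 / r) ^ i := by
  refine ⟨∑' i : ℕ, u i * r ^ i, tsum_nonneg fun i => mul_nonneg (hu i) (by positivity), fun i => ?_⟩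
  have h := hs.le_tsum i fun j _ => mul_nonneg (hu j) (by positivity)
  rw [one_div, inv_pow, ← div_eq_mul_inv, le_div_iff₀ (by positivity)]
  exact h

theorem summable_pow_mul_of_le_geometric {u : ℕ → ℝ} {M x : ℝ} (hu : ∀ i, 0 ≤ u i) (hx0 : 0 ≤ x)
    (hx : x < 1) (hle : ∀ i, u i ≤ M * x ^ i) (k : ℕ) : Summable fun i : ℕ => (i : ℝ) ^ k * u i := by
  have h := (summable_pow_mul_geometric_of_norm_lt_one (R := ℝ) k (r := x)
    (by rwa [Real.norm_eq_abs, abs_of_nonneg hx0])).mul_left M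
  refine Summable.of_nonneg_of_le (fun i => mul_nonneg (by positivity) (hu i)) (fun i => ?_) h
  calc (i : ℝ) ^ k * u i ≤ (i : ℝ) ^ k * (M * x ^ i) := by gcongr; exact hle i
    _ = _ := by ring

/-- Inside the disk of convergence, the power series may be differentiated termwise. -/
theorem summable_mul_of_lt_radius {w : PMF ℕ} {r : ℝ≥0} (hr : (r : ℝ≥0∞) < radius w) :
    Summable fun i : ℕ => (i : ℝ) * ((w i).toReal * (r : ℝ) ^ i) := by
  obtain ⟨r', h1, h2⟩ := ENNReal.lt_iff_exists_nnreal_btwn.1 hr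
  have h1' : (r : ℝ) < r' := by exact_mod_cast h1
  have hr' : (0 : ℝ) < r' := r.coe_nonneg.trans_lt h1'
  obtain ⟨M, hM, hle⟩ := exists_le_geometric hr' (fun i => ENNReal.toReal_nonneg)
    (summable_of_lt_radius h2)
  have := summable_pow_mul_of_le_geometric (u := fun i : ℕ => (w i).toReal * (r : ℝ) ^ i) (M := M)
    (x := r / r') (fun i => by positivity) (by positivity) ((div_lt_one hr').2 h1') (fun i => by
      calc (w i).toReal * (r : ℝ) ^ i ≤ M * (1 / r') ^ i * (r : ℝ) ^ i := by gcongr; exact hle i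
        _ = _ := by rw [div_pow, div_pow]; ring) 1
  simpa using this

/-- A power series whose first nonvanishing coefficient is negative and which is positive at `r`
has a zero between `0` and `r`. -/
theorem exists_zero_of_powerSeries {c : ℕ → ℝ} {r : ℝ} (hr : 0 < r)
    (hs : Summable fun l : ℕ => |c l| * r ^ l) {m : ℕ} (hm0 : ∀ l < m, c l = 0) (hm : c m < 0)
    (hpos : 0 < ∑' l : ℕ, c l * r ^ l) : ∃ x, 0 < x ∧ x < r ∧ ∑' l : ℕ, c l * x ^ l = 0 := by
  have hs' : ∀ x, 0 ≤ x → x ≤ r → Summable fun l : ℕ => c l * x ^ l := fun x h0 h1 => by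
    refine Summable.of_norm_bounded hs fun l => ?_
    rw [Real.norm_eq_abs, abs_mul, abs_of_nonneg (pow_nonneg h0 l)]
    gcongr
  have hsm : Summable fun l : ℕ => |c (l + m)| * r ^ l := by
    have h := ((summable_nat_add_iff m).2 hs).mul_right (r ^ m)⁻¹
    refine h.congr fun l => ?_
    rw [pow_add]; field_simp
  have hfac : ∀ x, 0 ≤ x → x ≤ r → ∑' l : ℕ, c l * x ^ l = x ^ m * ∑' l : ℕ, c (l + m) * x ^ l := by
    intro x h0 h1
    rw [← (hs' x h0 h1).sum_add_tsum_nat_add m, Finset.sum_eq_zero fun l hl => by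
      rw [hm0 l (Finset.mem_range.1 hl), zero_mul], zero_add, ← tsum_mul_left]
    refine tsum_congr fun l => ?_
    rw [pow_add]; ring
  have hcont : ContinuousOn (fun x => ∑' l : ℕ, c (l + m) * x ^ l) (Set.Icc 0 r) := by
    refine continuousOn_tsum (fun l => by fun_prop) hsm fun l x hx => ?_
    rw [Real.norm_eq_abs, abs_mul, abs_of_nonneg (pow_nonneg hx.1 l)]
    have := pow_le_pow_left₀ hx.1 hx.2 l
    gcongr
  have h0 : ∑' l : ℕ, c (l + m) * (0 : ℝ) ^ l = c m := by
    rw [tsum_eq_single 0]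
    · simp
    · intro l hl; simp [hl]
  have hr1 : 0 < ∑' l : ℕ, c (l + m) * r ^ l := by
    rw [hfac r hr.le le_rfl] at hpos
    exact pos_of_mul_pos_right hpos (by positivity)
  obtain ⟨x, hx, hx0⟩ := intermediate_value_Icc hr.le hcont (show (0 : ℝ) ∈ Set.Icc _ _ from by
    constructor
    · simp only [h0]; exact hm.le
    · exact hr1.le)
  simp only at hx0
  have hxpos : x ≠ 0 := by rintro rfl; rw [h0] at hx0; exact hm.ne hx0
  have hxr : x ≠ r := by rintro rfl; exact hr1.ne' hx0
  exact ⟨x, lt_of_le_of_ne hx.1 hxpos.symm, lt_of_le_of_ne hx.2 hxr, by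
    rw [hfac x hx.1 hx.2, hx0, mul_zero]⟩

theorem exists_lt_psiHat {w : PMF ℕ} {α : ℝ} (hα1 : ENNReal.ofReal α < 1 - (nuHat w)⁻¹) :
    ∃ r : ℝ≥0, (r : ℝ≥0∞) < radius w ∧ (1 - ENNReal.ofReal α)⁻¹ < psiHat w r := by
  have h1 : (1 - ENNReal.ofReal α)⁻¹ < nuHat w := by
    rw [ENNReal.inv_lt_iff_inv_lt, lt_tsub_iff_right, add_comm]
    exact lt_tsub_iff_right.1 hα1
  have h2 : ∃ᶠ t in 𝓝[<] radius w, (1 - ENNReal.ofReal α)⁻¹ < psiHat w t :=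
    frequently_lt_of_lt_limsup (by isBoundedDefault) h1
  obtain ⟨t, h3, h4⟩ := (h2.and_eventually self_mem_nhdsWithin).exists
  have h5 : t < radius w := h4
  lift t to ℝ≥0 using h5.ne_top
  exact ⟨t, h5, h3⟩

theorem lt_one_of_shift {w : PMF ℕ} {α : ℝ} (hα1 : ENNReal.ofReal α < 1 - (nuHat w)⁻¹) : α < 1 := by
  have h : ENNReal.ofReal α < 1 := hα1.trans_le tsub_le_self
  rwa [ENNReal.ofReal_lt_one] at h

theorem psiHat_coe {w : PMF ℕ} {r : ℝ≥0} (hr : (r : ℝ≥0∞) < radius w) : psiHat w r =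
    ENNReal.ofReal (∑' i : ℕ, (i : ℝ) * ((w i).toReal * (r : ℝ) ^ i)) /
      ENNReal.ofReal (∑' i : ℕ, if i = 0 then 0 else (w i).toReal * (r : ℝ) ^ i) := by
  have hs0 : Summable fun i : ℕ => if i = 0 then 0 else (w i).toReal * (r : ℝ) ^ i := by
    refine Summable.of_nonneg_of_le (fun i => ?_) (fun i => ?_) (summable_of_lt_radius hr)
    · split_ifs <;> positivity
    · split_ifs <;> [positivity; exact le_rfl]
  rw [psiHat, ENNReal.ofReal_tsum_of_nonneg (fun i => by positivity) (summable_mul_of_lt_radius hr),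
    ENNReal.ofReal_tsum_of_nonneg (fun i => by split_ifs <;> positivity) hs0]
  congr 1
  · refine tsum_congr fun i => ?_
    rw [ENNReal.ofReal_mul (by positivity), ENNReal.ofReal_mul (by positivity),
      ENNReal.ofReal_toReal (PMF.apply_ne_top w i), ENNReal.ofReal_natCast,
      ENNReal.ofReal_pow (by positivity), ENNReal.ofReal_coe_nnreal, mul_assoc]
  · refine tsum_congr fun i => ?_
    split_ifs
    · simp
    · rw [ENNReal.ofReal_mul (by positivity), ENNReal.ofReal_toReal (PMF.apply_ne_top w i),
        ENNReal.ofReal_pow (by positivity), ENNReal.ofReal_coe_nnreal]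

/-- The shift exists: its mean is `1` at a zero of the power series with the coefficients
`(j (1 - α) - 1) w_j`, `j ≥ 1`. -/
theorem exists_isAlphaShift {w : PMF ℕ} {α : ℝ} (hα0 : 0 < α)
    (hα1 : ENNReal.ofReal α < 1 - (nuHat w)⁻¹)
    (hα2 : ∃ j : ℕ, 1 ≤ j ∧ w j ≠ 0 ∧ 1 - 1 / (j : ℝ) < α) : ∃ v : PMF ℕ, IsAlphaShift w α v := by
  obtain ⟨r, hr, hψ⟩ := exists_lt_psiHat hα1
  have hα := lt_one_of_shift hα1
  have hα' : 0 < 1 - α := by linarith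
  have hsA := summable_mul_of_lt_radius hr
  have hs := summable_of_lt_radius hr
  set W : ℕ → ℝ := fun i => (w i).toReal with hW
  have hW0 : ∀ i, 0 ≤ W i := fun i => ENNReal.toReal_nonneg
  set c : ℕ → ℝ := fun j => ((j : ℝ) * (1 - α) - 1) * (if j = 0 then 0 else W j) with hc
  have hs0 : Summable fun i : ℕ => if i = 0 then 0 else W i * (r : ℝ) ^ i := by
    refine Summable.of_nonneg_of_le (fun i => ?_) (fun i => ?_) hs
    · have := hW0 i; split_ifs <;> positivity
    · have := hW0 i; split_ifs <;> [positivity; exact le_rfl]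
  have hcr : ∀ x : ℝ, ∀ j, c j * x ^ j = (1 - α) * ((j : ℝ) * (W j * x ^ j)) -
      (if j = 0 then 0 else W j * x ^ j) := by
    intro x j
    simp only [hc]
    split_ifs with h
    · simp [h]
    · ring
  have hpos : 0 < ∑' j, c j * (r : ℝ) ^ j := by
    rw [tsum_congr (hcr r), (hsA.mul_left (1 - α)).tsum_sub hs0, tsum_mul_left, sub_pos]
    rw [psiHat_coe hr] at hψ
    have h := ENNReal.mul_lt_of_lt_div hψ
    have hA0 : 0 ≤ ∑' i : ℕ, (i : ℝ) * (W i * (r : ℝ) ^ i) :=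
      tsum_nonneg fun i => by have := hW0 i; positivity
    rw [← ENNReal.ofReal_one, ← ENNReal.ofReal_sub _ hα0.le, ← ENNReal.ofReal_inv_of_pos hα',
      ← ENNReal.ofReal_mul (by positivity), ENNReal.ofReal_lt_ofReal_iff'] at h
    have h' := h.1
    rwa [inv_mul_lt_iff₀ hα'] at h'
  have hrpos : (0 : ℝ) < r := by
    rcases r.coe_nonneg.eq_or_lt with h | h
    · exfalso
      have h0 : ∀ j, c j * (r : ℝ) ^ j = 0 := by
        intro j
        rcases eq_or_ne j 0 with rfl | hj
        · simp [hc]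
        · rw [← h, zero_pow hj, mul_zero]
      simp_rw [h0, tsum_zero] at hpos
      exact lt_irrefl _ hpos
    · exact h
  have hsc : Summable fun j => |c j| * (r : ℝ) ^ j := by
    refine Summable.of_nonneg_of_le (fun j => by positivity) (fun j => ?_)
      ((hsA.mul_left (1 - α)).add hs0)
    rw [← abs_of_nonneg (pow_nonneg r.coe_nonneg j), ← abs_mul, abs_of_nonneg
      (pow_nonneg r.coe_nonneg j), hcr]
    have h1 : 0 ≤ (1 - α) * ((j : ℝ) * (W j * (r : ℝ) ^ j)) := by have := hW0 j; positivity
    have h2 : 0 ≤ (if j = 0 then 0 else W j * (r : ℝ) ^ j) := by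
      have := hW0 j; split_ifs <;> positivity
    exact (abs_sub _ _).trans (by rw [abs_of_nonneg h1, abs_of_nonneg h2])
  -- the first nonvanishing coefficient belongs to the least positive element of the support
  obtain ⟨j₀, hj1, hj2, hj3⟩ := hα2
  have hex : ∃ j, 1 ≤ j ∧ w j ≠ 0 := ⟨j₀, hj1, hj2⟩
  set m := Nat.find hex with hm
  obtain ⟨hm1, hmw⟩ := Nat.find_spec hex
  have hmj : m ≤ j₀ := Nat.find_min' hex ⟨hj1, hj2⟩
  have hWm : 0 < W m := ENNReal.toReal_pos hmw (PMF.apply_ne_top w m)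
  have hm0 : ∀ l < m, c l = 0 := by
    intro l hl
    simp only [hc]
    split_ifs with h0
    · simp
    · have := Nat.find_min hex hl
      push Not at this
      simp [hW, this (Nat.one_le_iff_ne_zero.2 h0)]
  have hcm : c m < 0 := by
    simp only [hc]
    rw [if_neg (by omega)]
    refine mul_neg_of_neg_of_pos ?_ hWm
    have hj0 : (0 : ℝ) < j₀ := by exact_mod_cast hj1
    have h1 : (j₀ : ℝ) * (1 - α) < 1 := by
      rw [← lt_div_iff₀' hj0]; linarith
    have h2 : (m : ℝ) ≤ j₀ := by exact_mod_cast hmj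
    nlinarith
  obtain ⟨x, hx0, hxr, hx⟩ := exists_zero_of_powerSeries hrpos hsc hm0 hcm hpos
  have hxr' : (x.toNNReal : ℝ≥0∞) < radius w := by
    refine lt_of_le_of_lt ?_ hr
    rw [ENNReal.coe_le_coe, Real.toNNReal_le_iff_le_coe]
    exact hxr.le
  have hsA' := summable_mul_of_lt_radius hxr'
  have hs' := summable_of_lt_radius hxr'
  simp only [Real.coe_toNNReal _ hx0.le] at hsA' hs'
  have hs0' : Summable fun i : ℕ => if i = 0 then 0 else W i * x ^ i := by
    refine Summable.of_nonneg_of_le (fun i => ?_) (fun i => ?_) hs'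
    · have := hW0 i; split_ifs <;> positivity
    · have := hW0 i; split_ifs <;> [positivity; exact le_rfl]
  set b := ∑' i : ℕ, if i = 0 then 0 else W i * x ^ i with hb
  have hbpos : 0 < b := by
    refine hs0'.tsum_pos (fun i => ?_) m ?_
    · have := hW0 i; split_ifs <;> positivity
    · rw [if_neg (by omega)]; positivity
  have hAb : (1 - α) * ∑' i : ℕ, (i : ℝ) * (W i * x ^ i) = b := by
    rw [tsum_congr (hcr x), (hsA'.mul_left (1 - α)).tsum_sub hs0', tsum_mul_left] at hx
    linarith
  set C := (1 - α) * x / b with hC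
  have hCpos : 0 < C := by positivity
  have hterm : ∀ j : ℕ, j ≠ 0 → ENNReal.ofReal (C * x ^ (j - 1)) * w j =
      ENNReal.ofReal ((1 - α) / b * (W j * x ^ j)) := by
    intro j hj
    rw [← ENNReal.ofReal_toReal (PMF.apply_ne_top w j), ← ENNReal.ofReal_mul (by positivity)]
    congr 1
    obtain ⟨l, rfl⟩ := Nat.exists_eq_succ_of_ne_zero hj
    rw [Nat.succ_sub_one, hC, pow_succ]
    simp only [hW]
    ring
  let f : ℕ → ℝ≥0∞ := fun j => if j = 0 then ENNReal.ofReal α else ENNReal.ofReal (C * x ^ (j - 1)) * w j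
  have hf : ∀ j, f j = (if j = 0 then ENNReal.ofReal α else 0) +
      ENNReal.ofReal ((1 - α) / b * (if j = 0 then 0 else W j * x ^ j)) := by
    intro j
    simp only [f]
    split_ifs with h
    · simp
    · rw [hterm j h, zero_add]
  have hf1 : ∑' j, f j = 1 := by
    simp_rw [hf]
    rw [ENNReal.tsum_add, tsum_ite_eq, ← ENNReal.ofReal_tsum_of_nonneg (fun j => by
      have := hW0 j; split_ifs <;> positivity) (hs0'.mul_left _), tsum_mul_left, ← hb,
      div_mul_cancel₀ _ hbpos.ne', ← ENNReal.ofReal_add hα0.le hα'.le]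
    simp
  refine ⟨⟨f, ENNReal.summable.hasSum_iff.2 hf1⟩, rfl, ?_, C, x, hCpos, hx0, fun j hj => ?_⟩
  · change ∑' j : ℕ, (j : ℝ≥0∞) * f j = 1
    have e : ∀ j : ℕ, (j : ℝ≥0∞) * f j = ENNReal.ofReal ((1 - α) / b * ((j : ℝ) * (W j * x ^ j))) := by
      intro j
      rcases eq_or_ne j 0 with rfl | h
      · simp
      · have := hW0 j
        simp only [f, if_neg h, hterm j h]
        rw [← ENNReal.ofReal_natCast, ← ENNReal.ofReal_mul (by positivity)]
        congr 1; ring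
    simp_rw [e]
    rw [← ENNReal.ofReal_tsum_of_nonneg (fun j => by have := hW0 j; positivity)
      (hsA'.mul_left _), tsum_mul_left, div_mul_eq_mul_div, hAb, div_self hbpos.ne',
      ENNReal.ofReal_one]
  · change f j = _
    simp only [f]
    rw [if_neg (by omega)]

/-- Chebyshev's sum inequality, in the form that makes `psiHat` monotone. -/
theorem tsum_mul_tsum_le (w : PMF ℕ) {s t : ℝ≥0∞} (hst : s ≤ t) :
    (∑' i : ℕ, (i : ℝ≥0∞) * w i * s ^ i) * (∑' i : ℕ, if i = 0 then 0 else w i * t ^ i) ≤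
      (∑' i : ℕ, (i : ℝ≥0∞) * w i * t ^ i) * (∑' i : ℕ, if i = 0 then 0 else w i * s ^ i) := by
  set b : ℕ → ℝ≥0∞ := fun i => if i = 0 then 0 else w i with hb
  have e1 : ∀ x : ℝ≥0∞, ∑' i : ℕ, (i : ℝ≥0∞) * w i * x ^ i = ∑' i : ℕ, (i : ℝ≥0∞) * b i * x ^ i := by
    intro x
    refine tsum_congr fun i => ?_
    rcases eq_or_ne i 0 with rfl | h
    · simp
    · simp [hb, h]
  have e2 : ∀ x : ℝ≥0∞, (∑' i : ℕ, if i = 0 then 0 else w i * x ^ i) = ∑' i : ℕ, b i * x ^ i := by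
    intro x
    refine tsum_congr fun i => ?_
    simp only [hb]
    split_ifs <;> simp
  rw [e1, e1, e2, e2]
  have hprod : ∀ x y : ℝ≥0∞, (∑' i : ℕ, (i : ℝ≥0∞) * b i * x ^ i) * (∑' i : ℕ, b i * y ^ i) =
      ∑' i : ℕ, ∑' j : ℕ, b i * b j * ((i : ℝ≥0∞) * x ^ i * y ^ j) := by
    intro x y
    simp_rw [← ENNReal.tsum_mul_right, ← ENNReal.tsum_mul_left]
    refine tsum_congr fun i => tsum_congr fun j => by ring
  have hsymm : ∀ x y : ℝ≥0∞, 2 * ∑' i : ℕ, ∑' j : ℕ, b i * b j * ((i : ℝ≥0∞) * x ^ i * y ^ j) =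
      ∑' i : ℕ, ∑' j : ℕ, b i * b j * ((i : ℝ≥0∞) * x ^ i * y ^ j + (j : ℝ≥0∞) * x ^ j * y ^ i) := by
    intro x y
    simp_rw [mul_add, ENNReal.tsum_add]
    rw [two_mul]
    congr 1
    rw [ENNReal.tsum_comm]
    refine tsum_congr fun i => tsum_congr fun j => by ring
  have hpt : ∀ i j : ℕ, j ≤ i → (i : ℝ≥0∞) * s ^ i * t ^ j + (j : ℝ≥0∞) * s ^ j * t ^ i ≤
      (i : ℝ≥0∞) * t ^ i * s ^ j + (j : ℝ≥0∞) * t ^ j * s ^ i := by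
    intro i j hij
    obtain ⟨k, rfl⟩ := Nat.exists_eq_add_of_le hij
    have h : s ^ k ≤ t ^ k := by gcongr
    calc _ = (k : ℝ≥0∞) * (s ^ j * t ^ j) * s ^ k + (j : ℝ≥0∞) * (s ^ (j + k) * t ^ j + s ^ j * t ^ (j + k)) := by
          push_cast; ring
      _ ≤ (k : ℝ≥0∞) * (s ^ j * t ^ j) * t ^ k + (j : ℝ≥0∞) * (s ^ (j + k) * t ^ j + s ^ j * t ^ (j + k)) := by
          gcongr
      _ = _ := by push_cast; ring
  have hmain : 2 * ((∑' i : ℕ, (i : ℝ≥0∞) * b i * s ^ i) * (∑' i : ℕ, b i * t ^ i)) ≤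
      2 * ((∑' i : ℕ, (i : ℝ≥0∞) * b i * t ^ i) * (∑' i : ℕ, b i * s ^ i)) := by
    rw [hprod, hprod, hsymm, hsymm]
    refine ENNReal.tsum_le_tsum fun i => ENNReal.tsum_le_tsum fun j => mul_le_mul' le_rfl ?_
    rcases le_total j i with h | h
    · exact hpt i j h
    · have := hpt j i h
      rw [add_comm, add_comm (_ * t ^ i * s ^ j)]
      exact this
  exact (ENNReal.mul_le_mul_iff_right (by norm_num) (by norm_num)).1 hmain

/-- The parameter of a shift lies inside the disk of convergence. -/
theorem ofReal_lt_radius {w v : PMF ℕ} {α C t : ℝ}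
    (hα1 : ENNReal.ofReal α < 1 - (nuHat w)⁻¹) (hv0 : v 0 = ENNReal.ofReal α)
    (hmean : ∑' j : ℕ, (j : ℝ≥0∞) * v j = 1) (hC : 0 < C) (ht : 0 < t)
    (hv : ∀ j : ℕ, 1 ≤ j → v j = ENNReal.ofReal (C * t ^ (j - 1)) * w j) :
    ENNReal.ofReal t < radius w := by
  by_contra! hcon
  set T := ENNReal.ofReal t with hT
  set K := ENNReal.ofReal (C / t) with hK
  have hK0 : K ≠ 0 := by simp only [hK, ne_eq, ENNReal.ofReal_eq_zero, not_le]; positivity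
  have hKT : K ≠ ⊤ := ENNReal.ofReal_ne_top
  have hterm : ∀ j : ℕ, j ≠ 0 → v j = K * (w j * T ^ j) := by
    intro j hj
    rw [hv j (Nat.one_le_iff_ne_zero.2 hj), hK, hT, ← ENNReal.ofReal_pow ht.le, mul_comm (w j),
      ← mul_assoc, ← ENNReal.ofReal_mul (by positivity)]
    congr 2
    obtain ⟨l, rfl⟩ := Nat.exists_eq_succ_of_ne_zero hj
    rw [Nat.succ_sub_one, pow_succ]
    field_simp
  have hA : K * ∑' i : ℕ, (i : ℝ≥0∞) * w i * T ^ i = 1 := by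
    rw [← hmean, ← ENNReal.tsum_mul_left]
    refine tsum_congr fun j => ?_
    rcases eq_or_ne j 0 with rfl | h
    · simp
    · rw [hterm j h]; ring
  have hB : K * (∑' i : ℕ, if i = 0 then 0 else w i * T ^ i) = 1 - ENNReal.ofReal α := by
    have h := v.tsum_coe
    have h2 : ∀ j, v j = (if j = 0 then ENNReal.ofReal α else 0) +
        K * (if j = 0 then 0 else w j * T ^ j) := by
      intro j
      split_ifs with hj
      · rw [hj, hv0, mul_zero, add_zero]
      · rw [hterm j hj, zero_add]
    simp_rw [h2] at h
    rw [ENNReal.tsum_add, tsum_ite_eq, ENNReal.tsum_mul_left] at h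
    rw [← h, ENNReal.add_sub_cancel_left ENNReal.ofReal_ne_top]
  have hα : α < 1 := lt_one_of_shift hα1
  have hB0 : 1 - ENNReal.ofReal α ≠ 0 := by
    rw [ne_eq, tsub_eq_zero_iff_le, not_le]
    exact hα1.trans_le tsub_le_self
  have hBT : 1 - ENNReal.ofReal α ≠ ⊤ := ne_top_of_le_ne_top ENNReal.one_ne_top tsub_le_self
  have hψ : ∀ s ≤ T, psiHat w s ≤ (1 - ENNReal.ofReal α)⁻¹ := by
    intro s hs
    rw [psiHat]
    refine ENNReal.div_le_of_le_mul ?_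
    have h := tsum_mul_tsum_le w hs
    have h2 := mul_le_mul_right h K
    have h3 : (∑' i : ℕ, (i : ℝ≥0∞) * w i * s ^ i) * (1 - ENNReal.ofReal α) ≤
        ∑' i : ℕ, if i = 0 then 0 else w i * s ^ i := by
      rw [← hB]
      calc _ = K * ((∑' i : ℕ, (i : ℝ≥0∞) * w i * s ^ i) *
            (∑' i : ℕ, if i = 0 then 0 else w i * T ^ i)) := by ring
        _ ≤ _ := h2
        _ = (K * ∑' i : ℕ, (i : ℝ≥0∞) * w i * T ^ i) *
            (∑' i : ℕ, if i = 0 then 0 else w i * s ^ i) := by ring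
        _ = _ := by rw [hA, one_mul]
    rwa [mul_comm, ← div_eq_mul_inv, ENNReal.le_div_iff_mul_le (Or.inl hB0) (Or.inl hBT)]
  have hν : nuHat w ≤ (1 - ENNReal.ofReal α)⁻¹ := by
    refine limsup_le_of_le (by isBoundedDefault) ?_
    filter_upwards [self_mem_nhdsWithin] with s hs
    have hs' : s < radius w := hs
    exact hψ s (hs'.le.trans hcon)
  have h1 : 1 - ENNReal.ofReal α ≤ (nuHat w)⁻¹ := by
    rw [← inv_inv (1 - ENNReal.ofReal α)]
    exact ENNReal.inv_le_inv.2 hν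
  have h2 : 1 - (nuHat w)⁻¹ ≤ ENNReal.ofReal α := by
    rw [tsub_le_iff_right]
    calc (1 : ℝ≥0∞) ≤ ENNReal.ofReal α + (1 - ENNReal.ofReal α) := le_add_tsub
      _ ≤ _ := by gcongr
  exact absurd hα1 (not_lt.2 h2)

/-- A shifted distribution has geometrically decreasing weights. -/
theorem exists_shift_le_geometric {w v : PMF ℕ} {α : ℝ} (hα0 : 0 < α)
    (hα1 : ENNReal.ofReal α < 1 - (nuHat w)⁻¹) (hv : IsAlphaShift w α v) :
    ∃ K x : ℝ, 0 ≤ K ∧ 0 < x ∧ x < 1 ∧ ∀ j, (v j).toReal ≤ K * x ^ j := by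
  obtain ⟨hv0, hmean, C, t, hC, ht, hvj⟩ := hv
  have hlt := ofReal_lt_radius hα1 hv0 hmean hC ht hvj
  obtain ⟨r, h1, h2⟩ := ENNReal.lt_iff_exists_nnreal_btwn.1 hlt
  have htr : t < r := by
    rw [← ENNReal.ofReal_coe_nnreal, ENNReal.ofReal_lt_ofReal_iff'] at h1
    exact h1.1
  have hr : (0 : ℝ) < r := ht.trans htr
  obtain ⟨M, hM, hle⟩ := exists_le_geometric hr (fun i => ENNReal.toReal_nonneg)
    (summable_of_lt_radius h2)
  refine ⟨max α (C / t * M), t / r, le_max_of_le_left hα0.le, by positivity, (div_lt_one hr).2 htr,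
    fun j => ?_⟩
  rcases eq_or_ne j 0 with rfl | hj
  · rw [hv0, ENNReal.toReal_ofReal hα0.le, pow_zero, mul_one]; exact le_max_left _ _
  · rw [hvj j (Nat.one_le_iff_ne_zero.2 hj), ENNReal.toReal_mul, ENNReal.toReal_ofReal
      (by positivity)]
    obtain ⟨l, rfl⟩ := Nat.exists_eq_succ_of_ne_zero hj
    calc C * t ^ (l.succ - 1) * (w l.succ).toReal ≤ C * t ^ (l.succ - 1) *
          (M * (1 / r) ^ l.succ) := by gcongr; exact hle _
      _ = C / t * M * (t / r) ^ l.succ := by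
          rw [Nat.succ_sub_one, div_pow, div_pow, one_pow, pow_succ t]; field_simp
      _ ≤ _ := by gcongr; exact le_max_right _ _

end

/-! ### Gaussian domination of Fourier series -/

section

open MeasureTheory Filter

/-- The Fourier series `∑ j, P {j} exp (i θ j)`. -/
noncomputable def fourier (P : Measure ℕ) (θ : ℝ) : ℂ :=
  ∫ x : ℕ, Complex.exp ((θ * x : ℝ) * Complex.I) ∂P

theorem integrable_of_norm_le {E : Type*} [NormedAddCommGroup E] {P : Measure ℕ}
    [IsFiniteMeasure P] (f : ℕ → E) (C : ℝ) (h : ∀ x, ‖f x‖ ≤ C) : Integrable f P :=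
  Integrable.of_bound StronglyMeasurable.of_discrete.aestronglyMeasurable C (ae_of_all _ h)

theorem real_singleton_mul_le_integral {P : Measure ℕ} {f : ℕ → ℝ} (hf : Integrable f P)
    (h0 : ∀ x, 0 ≤ f x) (x : ℕ) : P.real {x} * f x ≤ ∫ y, f y ∂P := by
  have h := setIntegral_le_integral (s := {x}) hf (ae_of_all _ h0)
  rwa [integral_singleton, smul_eq_mul] at h

/-- The variance of `exp (i θ X)` is `1 - |E exp (i θ X)|²`; it bounds the contribution of each
atom. -/
theorem real_singleton_mul_norm_sq_le (P : Measure ℕ) [IsProbabilityMeasure P] (θ : ℝ) (x : ℕ) :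
    P.real {x} * ‖Complex.exp ((θ * x : ℝ) * Complex.I) - fourier P θ‖ ^ 2 ≤
      1 - ‖fourier P θ‖ ^ 2 := by
  set f := fourier P θ with hf
  set g : ℕ → ℂ := fun x => Complex.exp ((θ * x : ℝ) * Complex.I) with hg
  have hg1 : ∀ x, ‖g x‖ = 1 := fun x => Complex.norm_exp_ofReal_mul_I _
  have hgi : Integrable g P := integrable_of_norm_le _ 1 fun x => (hg1 x).le
  have hexp : ∀ x, ‖g x - f‖ ^ 2 = (1 + ‖f‖ ^ 2) - 2 * (g x * (starRingEnd ℂ) f).re := by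
    intro x
    rw [← Complex.normSq_eq_norm_sq, Complex.normSq_sub, Complex.normSq_eq_norm_sq, hg1,
      Complex.normSq_eq_norm_sq]
    ring
  have hi2 : Integrable (fun x => g x * (starRingEnd ℂ) f) P := hgi.mul_const _
  have hi3 : Integrable (fun x => 2 * (g x * (starRingEnd ℂ) f).re) P := hi2.re.const_mul 2
  have hint : ∫ x, ‖g x - f‖ ^ 2 ∂P = 1 - ‖f‖ ^ 2 := by
    simp_rw [hexp]
    rw [integral_sub (integrable_const _) hi3, integral_const_mul]
    have h1 : ∫ x, (g x * (starRingEnd ℂ) f).re ∂P = ‖f‖ ^ 2 := by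
      have h2 := integral_re hi2
      simp only [RCLike.re_to_complex] at h2
      rw [h2, integral_mul_const]
      change (f * (starRingEnd ℂ) f).re = _
      rw [Complex.mul_conj, Complex.ofReal_re, Complex.normSq_eq_norm_sq]
    rw [h1]
    simp
    ring
  rw [← hint]
  refine real_singleton_mul_le_integral (f := fun x => ‖g x - f‖ ^ 2) ?_ (fun x => by positivity) x
  refine integrable_of_norm_le _ ((1 + ‖f‖) ^ 2) fun x => ?_
  rw [Real.norm_of_nonneg (by positivity)]
  gcongr
  calc ‖g x - f‖ ≤ ‖g x‖ + ‖f‖ := norm_sub_le _ _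
    _ = _ := by rw [hg1]

/-- The integers `z` for which `|exp (i θ z) - 1|²` is bounded by a multiple of
`1 - |fourier P θ|²`, uniformly in `θ`. -/
noncomputable def boundedFrequencies (P : Measure ℕ) [IsProbabilityMeasure P] : AddSubgroup ℤ where
  carrier := {z | ∃ K : ℝ, ∀ θ : ℝ, ‖Complex.exp ((θ * z : ℝ) * Complex.I) - 1‖ ^ 2 ≤
    K * (1 - ‖fourier P θ‖ ^ 2)}
  zero_mem' := ⟨0, fun θ => by simp⟩
  add_mem' := by
    rintro a b ⟨K, hK⟩ ⟨L, hL⟩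
    refine ⟨2 * (K + L), fun θ => ?_⟩
    have h1 : Complex.exp ((θ * (a + b : ℤ) : ℝ) * Complex.I) - 1 =
        Complex.exp ((θ * a : ℝ) * Complex.I) * (Complex.exp ((θ * b : ℝ) * Complex.I) - 1) +
          (Complex.exp ((θ * a : ℝ) * Complex.I) - 1) := by
      rw [mul_sub, ← Complex.exp_add, ← add_mul]
      push_cast
      ring_nf
    have h2 := norm_add_le (Complex.exp ((θ * a : ℝ) * Complex.I) *
      (Complex.exp ((θ * b : ℝ) * Complex.I) - 1)) (Complex.exp ((θ * a : ℝ) * Complex.I) - 1)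
    rw [← h1, norm_mul, Complex.norm_exp_ofReal_mul_I, one_mul] at h2
    have h3 := hK θ
    have h4 := hL θ
    have h5 := pow_le_pow_left₀ (norm_nonneg _) h2 2
    nlinarith [sq_nonneg (‖Complex.exp ((θ * b : ℝ) * Complex.I) - 1‖ -
      ‖Complex.exp ((θ * a : ℝ) * Complex.I) - 1‖)]
  neg_mem' := by
    rintro a ⟨K, hK⟩
    refine ⟨K, fun θ => ?_⟩
    have h1 : Complex.exp ((θ * (-a : ℤ) : ℝ) * Complex.I) - 1 =
        -(Complex.exp ((θ * (-a : ℤ) : ℝ) * Complex.I) *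
          (Complex.exp ((θ * a : ℝ) * Complex.I) - 1)) := by
      rw [mul_sub, ← Complex.exp_add, ← add_mul]
      push_cast
      simp
    rw [h1, norm_neg, norm_mul, Complex.norm_exp_ofReal_mul_I, one_mul]
    exact hK θ

theorem natCast_mem_boundedFrequencies {P : Measure ℕ} [IsProbabilityMeasure P]
    (h0 : P {0} ≠ 0) {x : ℕ} (hx : P {x} ≠ 0) : (x : ℤ) ∈ boundedFrequencies P := by
  have p0 : 0 < P.real {0} := ENNReal.toReal_pos h0 (measure_ne_top _ _)
  have px : 0 < P.real {x} := ENNReal.toReal_pos hx (measure_ne_top _ _)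
  refine ⟨2 * ((P.real {x})⁻¹ + (P.real {0})⁻¹), fun θ => ?_⟩
  have h1 := real_singleton_mul_norm_sq_le P θ x
  have h2 := real_singleton_mul_norm_sq_le P θ 0
  simp only [Nat.cast_zero, mul_zero, Complex.ofReal_zero, zero_mul, Complex.exp_zero] at h2
  rw [← le_div_iff₀' px, div_eq_inv_mul] at h1
  rw [← le_div_iff₀' p0, div_eq_inv_mul] at h2
  have h3 := norm_sub_le (Complex.exp ((θ * x : ℝ) * Complex.I) - fourier P θ) (1 - fourier P θ)
  rw [sub_sub_sub_cancel_right] at h3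
  have h5 := pow_le_pow_left₀ (norm_nonneg _) h3 2
  simp only [Int.cast_natCast]
  nlinarith [sq_nonneg (‖Complex.exp ((θ * x : ℝ) * Complex.I) - fourier P θ‖ -
    ‖1 - fourier P θ‖)]

/-- If `P` charges `0` and its atoms have no common divisor, then its Fourier series is at most a
Gaussian on `[-π, π]`. -/
theorem exists_norm_fourier_le {P : Measure ℕ} [IsProbabilityMeasure P] (h0 : P {0} ≠ 0)
    (hgcd : Nat.setGcd {x | P {x} ≠ 0} = 1) :
    ∃ κ : ℝ, 0 < κ ∧ ∀ θ : ℝ, |θ| ≤ Real.pi → ‖fourier P θ‖ ≤ Real.exp (-κ * θ ^ 2) := by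
  have h1 : (1 : ℤ) ∈ boundedFrequencies P := by
    have h := Nat.span_singleton_setGcd {x | P {x} ≠ 0}
    rw [hgcd] at h
    have h2 : Ideal.span (((↑) : ℕ → ℤ) '' {x | P {x} ≠ 0}) ≤
        AddSubgroup.toIntSubmodule (boundedFrequencies P) := by
      refine Submodule.span_le.2 ?_
      rintro _ ⟨x, hx, rfl⟩
      exact natCast_mem_boundedFrequencies h0 hx
    rw [← h] at h2
    exact h2 (Ideal.subset_span rfl)
  obtain ⟨K, hK⟩ := h1
  have hpi := Real.pi_pos
  have hlow : ∀ θ : ℝ, |θ| ≤ Real.pi → 4 / Real.pi ^ 2 * θ ^ 2 ≤ K * (1 - ‖fourier P θ‖ ^ 2) := by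
    intro θ hθ
    refine le_trans ?_ (hK θ)
    rw [← Complex.normSq_eq_norm_sq, Complex.normSq_apply]
    simp only [Int.cast_one, mul_one, Complex.sub_re, Complex.sub_im, Complex.exp_ofReal_mul_I_re,
      Complex.exp_ofReal_mul_I_im, Complex.one_re, Complex.one_im, sub_zero]
    have h2 := Real.cos_le_one_sub_mul_cos_sq hθ
    have h3 := Real.sin_sq_add_cos_sq θ
    have h4 : 4 / Real.pi ^ 2 * θ ^ 2 = 2 * (2 / Real.pi ^ 2 * θ ^ 2) := by ring
    rw [h4]
    nlinarith
  have hf1 : ∀ θ, ‖fourier P θ‖ ≤ 1 := by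
    intro θ
    refine (norm_integral_le_integral_norm _).trans ?_
    simp_rw [Complex.norm_exp_ofReal_mul_I]
    simp
  have hKpos : 0 < K := by
    by_contra! hcon
    have h2 := hlow Real.pi (abs_of_pos hpi).le
    have h3 : 4 / Real.pi ^ 2 * Real.pi ^ 2 = 4 := by field_simp
    have h4 : 0 ≤ 1 - ‖fourier P Real.pi‖ ^ 2 := by
      have := hf1 Real.pi
      have := norm_nonneg (fourier P Real.pi)
      nlinarith
    nlinarith
  refine ⟨2 / Real.pi ^ 2 / K, by positivity, fun θ hθ => ?_⟩
  have h2 := hlow θ hθ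
  have h3 : ‖fourier P θ‖ ^ 2 ≤ 1 - 4 / Real.pi ^ 2 / K * θ ^ 2 := by
    have : 4 / Real.pi ^ 2 / K * θ ^ 2 ≤ 1 - ‖fourier P θ‖ ^ 2 := by
      rw [div_mul_eq_mul_div, div_le_iff₀' hKpos]; exact h2
    linarith
  have h4 : ‖fourier P θ‖ ^ 2 ≤ Real.exp (-(2 / Real.pi ^ 2 / K) * θ ^ 2) ^ 2 := by
    rw [← Real.exp_nat_mul]
    refine h3.trans ?_
    have h5 := Real.add_one_le_exp (((2 : ℕ) : ℝ) * (-(2 / Real.pi ^ 2 / K) * θ ^ 2))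
    refine le_trans (le_of_eq ?_) h5
    push_cast
    ring
  exact (pow_le_pow_iff_left₀ (norm_nonneg _) (Real.exp_pos _).le (by norm_num)).1 h4

/-! ### Fourier inversion -/

theorem integral_exp_int_mul (z : ℤ) :
    ∫ θ in (-Real.pi)..Real.pi, Complex.exp ((θ * z : ℝ) * Complex.I) =
      if z = 0 then 2 * (Real.pi : ℂ) else 0 := by
  split_ifs with h
  · subst h
    simp
    ring
  · have hz : (z : ℂ) * Complex.I ≠ 0 := mul_ne_zero (by exact_mod_cast h) Complex.I_ne_zero
    have e : ∀ θ : ℝ, Complex.exp ((θ * z : ℝ) * Complex.I) =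
        Complex.exp ((z : ℂ) * Complex.I * (θ : ℂ)) := by
      intro θ; congr 1; push_cast; ring
    simp_rw [e]
    rw [integral_exp_mul_complex hz]
    have e2 : Complex.exp ((z : ℂ) * Complex.I * (Real.pi : ℝ)) =
        Complex.exp ((z : ℂ) * Complex.I * ((-Real.pi : ℝ) : ℂ)) := by
      have h3 : (z : ℂ) * Complex.I * (Real.pi : ℝ) =
          (z : ℂ) * Complex.I * ((-Real.pi : ℝ) : ℂ) + (z : ℂ) * (2 * Real.pi * Complex.I) := by
        push_cast; ring
      rw [h3, Complex.exp_add, Complex.exp_int_mul_two_pi_mul_I, mul_one]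
    rw [e2, sub_self, zero_div]

/-- Fourier inversion for the sum of `N` independent variables. -/
theorem integral_fourier_pow (P : Measure ℕ) [IsProbabilityMeasure P] (N s : ℕ) :
    ∫ θ in (-Real.pi)..Real.pi, Complex.exp ((-(θ * s) : ℝ) * Complex.I) * fourier P θ ^ N =
      2 * (Real.pi : ℂ) * ((Measure.pi fun _ : Fin N => P).real {η | ∑ i, η i = s} : ℝ) := by
  set Q := Measure.pi fun _ : Fin N => P with hQ
  have h1 : ∀ θ : ℝ, Complex.exp ((-(θ * s) : ℝ) * Complex.I) * fourier P θ ^ N =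
      ∫ η, Complex.exp ((θ * ((∑ i, η i : ℕ) - s : ℤ) : ℝ) * Complex.I) ∂Q := by
    intro θ
    have h := integral_fintype_prod_eq_pow (ι := Fin N) (μ := P)
      (fun x : ℕ => Complex.exp ((θ * x : ℝ) * Complex.I))
    rw [Fintype.card_fin] at h
    rw [fourier, ← h, ← integral_const_mul]
    refine integral_congr_ae (ae_of_all _ fun η => ?_)
    simp only
    rw [← Complex.exp_sum, ← Complex.exp_add, ← Finset.sum_mul, ← add_mul]
    congr 2
    push_cast
    rw [← Finset.mul_sum]
    ring
  simp_rw [h1]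
  rw [intervalIntegral.integral_of_le (by linarith [Real.pi_pos]), integral_integral_swap]
  · have h2 : ∀ η : Fin N → ℕ, ∫ θ in Set.Ioc (-Real.pi) Real.pi,
        Complex.exp ((θ * ((∑ i, η i : ℕ) - s : ℤ) : ℝ) * Complex.I) =
        Set.indicator {η : Fin N → ℕ | ∑ i, η i = s} (fun _ => 2 * (Real.pi : ℂ)) η := by
      intro η
      rw [← intervalIntegral.integral_of_le (by linarith [Real.pi_pos]), integral_exp_int_mul,
        Set.indicator_apply]
      congr 1
      simp only [Set.mem_ofPred_eq, sub_eq_zero, Nat.cast_inj]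
    simp_rw [h2]
    rw [integral_indicator (MeasurableSet.of_discrete), setIntegral_const]
    rw [Complex.real_smul]
    ring
  · refine Integrable.of_bound (C := 1) ?_ (ae_of_all _ fun p => ?_)
    · have : Measurable (Function.uncurry fun (θ : ℝ) (η : Fin N → ℕ) =>
          Complex.exp ((θ * ((∑ i, η i : ℕ) - s : ℤ) : ℝ) * Complex.I)) := by
        refine measurable_from_prod_countable_left fun η => ?_
        simp only [Function.uncurry]
        fun_prop
      exact this.aestronglyMeasurable
    · rw [Function.uncurry, Complex.norm_exp_ofReal_mul_I]

/-- `sumWeight` is the probability that `N` independent variables with the law `q` have the sum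
`s`. -/
theorem pi_sum_eq (q : PMF ℕ) (N s : ℕ) :
    (Measure.pi fun _ : Fin N => q.toMeasure) {η | ∑ i, η i = s} = sumWeight q N s := by
  rw [← Set.biUnion_of_singleton {η : Fin N → ℕ | ∑ i, η i = s},
    measure_biUnion (Set.to_countable _) (fun a _ b _ h => by simpa using h)
      (fun _ _ => MeasurableSet.of_discrete), sumWeight]
  refine tsum_congr fun η => ?_
  rw [Measure.pi_singleton]
  refine Finset.prod_congr rfl fun i _ => ?_
  rw [PMF.toMeasure_apply_singleton _ _ MeasurableSet.of_discrete]

end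

/-! ### The local limit theorem -/

section

open MeasureTheory Filter

theorem integrable_cast_of_sq {P : Measure ℕ} [IsProbabilityMeasure P]
    (hsq : Integrable (fun x : ℕ => (x : ℝ) ^ 2) P) : Integrable (fun x : ℕ => (x : ℝ)) P := by
  refine hsq.mono StronglyMeasurable.of_discrete.aestronglyMeasurable (ae_of_all _ fun x => ?_)
  rw [Real.norm_of_nonneg (by positivity), Real.norm_of_nonneg (by positivity)]
  exact_mod_cast Nat.le_self_pow (by norm_num) x

/-- **Local limit theorem, lower bound**: a sum of `N` independent variables with finite variance
whose atoms contain `0` and have no common divisor takes each value at bounded distance from its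
mean with a probability of order at least `1 / √N`. -/
theorem exists_le_real_pi {P : Measure ℕ} [IsProbabilityMeasure P] (h0 : P {0} ≠ 0)
    (hgcd : Nat.setGcd {x | P {x} ≠ 0} = 1) (hsq : Integrable (fun x : ℕ => (x : ℝ) ^ 2) P)
    (D : ℝ) : ∃ c : ℝ, 0 < c ∧ ∃ N₀ : ℕ, ∀ N ≥ N₀, ∀ s : ℕ,
      |(s : ℝ) - N * ∫ x, (x : ℝ) ∂P| ≤ D →
        c / √N ≤ (Measure.pi fun _ : Fin N => P).real {η | ∑ i, η i = s} := by
  set μ := ∫ x, (x : ℝ) ∂P with hμ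
  have hi1 := integrable_cast_of_sq hsq
  have hvi : Integrable (fun x : ℕ => ((x : ℝ) - μ) ^ 2) P := by
    have : (fun x : ℕ => ((x : ℝ) - μ) ^ 2) = fun x : ℕ => (x : ℝ) ^ 2 - 2 * μ * x + μ ^ 2 := by
      funext x; ring
    rw [this]
    exact (hsq.sub (hi1.const_mul _)).add (integrable_const _)
  set V := ∫ x : ℕ, ((x : ℝ) - μ) ^ 2 ∂P with hV
  have hVpos : 0 < V := by
    have key : ∀ x : ℕ, P {x} ≠ 0 → (x : ℝ) ≠ μ → 0 < V := fun x hx hne => by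
      have h := real_singleton_mul_le_integral hvi (fun x => sq_nonneg _) x
      have px : 0 < P.real {x} := ENNReal.toReal_pos hx (measure_ne_top _ _)
      have h3 : 0 < ((x : ℝ) - μ) ^ 2 := by
        have := sub_ne_zero.2 hne
        positivity
      exact (mul_pos px h3).trans_le h
    obtain ⟨l, hl, hl0⟩ := Nat.exists_ne_zero_of_setGcd_ne_zero (by rw [hgcd]; exact one_ne_zero)
    by_cases h : ((0 : ℕ) : ℝ) = μ
    · refine key l hl ?_
      rw [← h]
      exact_mod_cast hl0
    · exact key 0 h0 h
  set σ := √V with hσ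
  have hσpos : 0 < σ := Real.sqrt_pos.2 hVpos
  have hσ2 : σ ^ 2 = V := Real.sq_sqrt hVpos.le
  let Y : ℕ → ℝ := fun x => ((x : ℝ) - μ) / σ
  have hY0 : ∫ x, Y x ∂P = 0 := by
    simp only [Y]
    rw [integral_div, integral_sub hi1 (integrable_const _)]
    simp [hμ]
  have hY1 : ∫ x, (Y ^ 2) x ∂P = 1 := by
    simp only [Y, Pi.pow_apply, div_pow]
    rw [integral_div, ← hV, hσ2, div_self hVpos.ne']
  have hYm : AEMeasurable Y P := Measurable.of_discrete.aemeasurable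
  set g : ℝ → ℂ := charFun (P.map Y) with hg
  have hgY : ∀ t, g t = ∫ x, Complex.exp ((t * Y x : ℝ) * Complex.I) ∂P := by
    intro t
    rw [hg, charFun_apply_real, integral_map hYm (by fun_prop)]
    simp
  have hgc : Measurable g := measurable_charFun
  have hfg : ∀ θ : ℝ, fourier P θ = Complex.exp ((θ * μ : ℝ) * Complex.I) * g (σ * θ) := by
    intro θ
    rw [fourier, hgY, ← integral_const_mul]
    refine integral_congr_ae (ae_of_all _ fun x => ?_)
    simp only
    rw [← Complex.exp_add, ← add_mul, ← Complex.ofReal_add]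
    congr 3
    simp only [Y]
    field_simp
    ring
  obtain ⟨κ, hκ, hfle⟩ := exists_norm_fourier_le h0 hgcd
  have hgle : ∀ θ : ℝ, |θ| ≤ Real.pi → ‖g (σ * θ)‖ ≤ Real.exp (-κ * θ ^ 2) := by
    intro θ hθ
    have := hfle θ hθ
    rwa [hfg, norm_mul, Complex.norm_exp_ofReal_mul_I, one_mul] at this
  have hpi := Real.pi_pos
  -- the substitution `θ = u / r N` makes the integrands converge
  let r : ℕ → ℝ := fun N => σ * √N
  let h : ℕ → ℝ → ℂ := fun N => Set.indicator (Set.Ioc (-Real.pi * r N) (Real.pi * r N))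
    (fun u => g ((√N)⁻¹ * u) ^ N)
  set b := κ / σ ^ 2 with hb
  have hbpos : 0 < b := by positivity
  have hhm : ∀ N, Measurable (h N) := fun N =>
    ((hgc.comp (measurable_const_mul _)).pow_const N).indicator measurableSet_Ioc
  have hhle : ∀ N u, ‖h N u‖ ≤ Real.exp (-b * u ^ 2) := by
    intro N u
    simp only [h, Set.indicator_apply]
    split_ifs with hu
    · have hr : 0 < r N := by
        have h1 := hu.1.trans_le hu.2
        nlinarith
      have hN : 0 < √(N : ℝ) := pos_of_mul_pos_right hr hσpos.le
      have hN2 : √(N : ℝ) ^ 2 = N := Real.sq_sqrt (Nat.cast_nonneg _)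
      have h1 : |u / r N| ≤ Real.pi := by
        rw [abs_div, abs_of_pos hr, div_le_iff₀ hr, abs_le]
        exact ⟨by linarith [hu.1], hu.2⟩
      have h2 := hgle _ h1
      have h3 : σ * (u / r N) = (√N)⁻¹ * u := by
        simp only [r]; field_simp
      rw [h3] at h2
      rw [norm_pow]
      refine (pow_le_pow_left₀ (norm_nonneg _) h2 N).trans (le_of_eq ?_)
      rw [← Real.exp_nat_mul]
      congr 1
      simp only [r, hb]
      rw [div_pow, mul_pow, hN2]
      have : (N : ℝ) ≠ 0 := by rw [← hN2]; positivity
      field_simp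
    · simp only [norm_zero]; positivity
  have hbi : Integrable fun u : ℝ => Real.exp (-b * u ^ 2) := integrable_exp_neg_mul_sq hbpos
  have hrtop : Tendsto r atTop atTop :=
    Tendsto.const_mul_atTop hσpos (Real.tendsto_sqrt_atTop.comp tendsto_natCast_atTop_atTop)
  have hlim : ∀ u : ℝ, Tendsto (fun N => h N u) atTop (𝓝 (Complex.exp (-(u : ℂ) ^ 2 / 2))) := by
    intro u
    refine (ProbabilityTheory.tendsto_charFun_inv_sqrt_mul_pow hYm hY0 hY1 u).congr' ?_
    filter_upwards [(Tendsto.const_mul_atTop hpi hrtop).eventually_gt_atTop |u|] with N hN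
    have h1 := abs_lt.1 hN
    have hu : u ∈ Set.Ioc (-Real.pi * r N) (Real.pi * r N) := ⟨by linarith, h1.2.le⟩
    exact (Set.indicator_of_mem hu fun u => g ((√N)⁻¹ * u) ^ N).symm
  have hDCT : Tendsto (fun N => ∫ u, h N u) atTop (𝓝 (∫ u : ℝ, Complex.exp (-(u : ℂ) ^ 2 / 2))) :=
    tendsto_integral_of_dominated_convergence _ (fun N => (hhm N).aestronglyMeasurable) hbi
      (fun N => ae_of_all _ (hhle N)) (ae_of_all _ hlim)
  have hgauss : ∫ u : ℝ, Complex.exp (-(u : ℂ) ^ 2 / 2) = ((√(2 * Real.pi) : ℝ) : ℂ) := by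
    have e : ∀ u : ℝ, Complex.exp (-(u : ℂ) ^ 2 / 2) = ((Real.exp (-(1 / 2) * u ^ 2) : ℝ) : ℂ) := by
      intro u; push_cast; congr 1; ring
    simp_rw [e]
    rw [integral_complex_ofReal, integral_gaussian]
    congr 3
    ring
  have h2lt : 2 < ‖∫ u : ℝ, Complex.exp (-(u : ℂ) ^ 2 / 2)‖ := by
    rw [hgauss, Complex.norm_real, Real.norm_of_nonneg (Real.sqrt_nonneg _), Real.lt_sqrt (by norm_num)]
    have := Real.pi_gt_three
    linarith
  have hJi : Integrable fun u : ℝ => |u| * Real.exp (-b * u ^ 2) := by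
    have := (integrable_mul_exp_neg_mul_sq hbpos).norm
    refine this.congr (ae_of_all _ fun u => ?_)
    simp only [norm_mul, Real.norm_eq_abs, abs_of_pos (Real.exp_pos _)]
  set J := ∫ u : ℝ, |u| * Real.exp (-b * u ^ 2) with hJ
  have hDJ : Tendsto (fun N => D * J / r N) atTop (𝓝 0) := hrtop.const_div_atTop _
  have hev : ∀ᶠ N : ℕ in atTop, 2 < ‖∫ u, h N u‖ ∧ D * J / r N < 1 ∧ 0 < r N :=
    (hDCT.norm.eventually (lt_mem_nhds h2lt)).and
      ((hDJ.eventually (gt_mem_nhds one_pos)).and (hrtop.eventually_gt_atTop 0))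
  obtain ⟨N₀, hN₀⟩ := eventually_atTop.1 hev
  refine ⟨1 / (2 * Real.pi * σ), by positivity, N₀, fun N hN s hs => ?_⟩
  obtain ⟨hN1, hN2, hr⟩ := hN₀ N hN
  have hsN : 0 < √(N : ℝ) := pos_of_mul_pos_right hr hσpos.le
  set δ := (s : ℝ) - N * μ with hδ
  let E : ℝ → ℂ := fun θ => Complex.exp ((-(θ * s) : ℝ) * Complex.I) * fourier P θ ^ N
  have hE : ∀ u, E (u / r N) = Complex.exp (Complex.I * (-(u * δ / r N) : ℝ)) *
      g ((√N)⁻¹ * u) ^ N := by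
    intro u
    simp only [E]
    rw [hfg, mul_pow, ← mul_assoc, ← Complex.exp_nat_mul, ← Complex.exp_add]
    have h3 : σ * (u / r N) = (√N)⁻¹ * u := by
      simp only [r]; field_simp
    rw [h3]
    congr 2
    simp only [hδ]
    push_cast
    ring
  have hinv : ∫ u in (-Real.pi * r N)..(Real.pi * r N), E (u / r N) =
      (r N : ℂ) * (2 * (Real.pi : ℂ) *
        ((Measure.pi fun _ : Fin N => P).real {η | ∑ i, η i = s} : ℝ)) := by
    rw [intervalIntegral.integral_comp_div _ hr.ne', mul_div_cancel_right₀ _ hr.ne',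
      mul_div_cancel_right₀ _ hr.ne', integral_fourier_pow, Complex.real_smul]
  have hinv2 : ∫ u in (-Real.pi * r N)..(Real.pi * r N), E (u / r N) =
      ∫ u, Complex.exp (Complex.I * (-(u * δ / r N) : ℝ)) * h N u := by
    rw [intervalIntegral.integral_of_le (by nlinarith), ← integral_indicator measurableSet_Ioc]
    refine integral_congr_ae (ae_of_all _ fun u => ?_)
    simp only [h, Set.indicator_apply]
    split_ifs
    · exact hE u
    · rw [mul_zero]
  have hhi : Integrable (h N) := hbi.mono' (hhm N).aestronglyMeasurable (ae_of_all _ (hhle N))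
  have hehi : Integrable fun u => Complex.exp (Complex.I * (-(u * δ / r N) : ℝ)) * h N u := by
    refine hbi.mono' (by fun_prop) (ae_of_all _ fun u => ?_)
    rw [norm_mul, mul_comm Complex.I, Complex.norm_exp_ofReal_mul_I, one_mul]
    exact hhle N u
  -- the oscillating factor is harmless, since `s` is at bounded distance from the mean
  have hdiff : ‖(∫ u, Complex.exp (Complex.I * (-(u * δ / r N) : ℝ)) * h N u) - ∫ u, h N u‖ ≤
      D * J / r N := by
    rw [← integral_sub hehi hhi]
    refine (norm_integral_le_integral_norm _).trans ?_
    have e : D * J / r N = ∫ u, D / r N * (|u| * Real.exp (-b * u ^ 2)) := by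
      rw [integral_const_mul, ← hJ]; ring
    rw [e]
    refine integral_mono (hehi.sub hhi).norm (hJi.const_mul _) fun u => ?_
    simp only
    rw [← sub_one_mul, norm_mul, ← mul_assoc]
    refine mul_le_mul ?_ (hhle N u) (norm_nonneg _) ?_
    · refine Real.norm_exp_I_mul_ofReal_sub_one_le.trans ?_
      rw [Real.norm_eq_abs, abs_neg, abs_div, abs_mul, abs_of_pos hr, div_mul_eq_mul_div,
        mul_comm |u|]
      gcongr
    · have := (abs_nonneg _).trans hs
      positivity
  have hfin : 1 ≤ ‖∫ u, Complex.exp (Complex.I * (-(u * δ / r N) : ℝ)) * h N u‖ := by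
    have h3 := norm_sub_norm_le (∫ u, h N u)
      (∫ u, Complex.exp (Complex.I * (-(u * δ / r N) : ℝ)) * h N u)
    rw [norm_sub_rev] at h3
    linarith
  rw [← hinv2, hinv, norm_mul, norm_mul, norm_mul, Complex.norm_real, Complex.norm_real,
    Complex.norm_real, Real.norm_of_nonneg hr.le, Real.norm_of_nonneg hpi.le,
    Real.norm_of_nonneg measureReal_nonneg] at hfin
  rw [div_div, div_le_iff₀ (by positivity)]
  simp only [r, Complex.norm_ofNat] at hfin
  linarith

end

/-! ### Reduction to the lattice of the support -/

section

open MeasureTheory Filter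

theorem toMeasure_singleton (p : PMF ℕ) (x : ℕ) : p.toMeasure {x} = p x :=
  PMF.toMeasure_apply_singleton _ _ MeasurableSet.of_discrete

theorem integrable_of_tsum_ne_top {p : PMF ℕ} {f : ℕ → ℕ}
    (h : ∑' j, (f j : ℝ≥0∞) * p j ≠ ⊤) : Integrable (fun x => (f x : ℝ)) p.toMeasure := by
  refine ⟨StronglyMeasurable.of_discrete.aestronglyMeasurable, ?_⟩
  rw [HasFiniteIntegral, lintegral_countable']
  refine lt_of_eq_of_lt (tsum_congr fun j => ?_) h.lt_top
  rw [toMeasure_singleton, Real.enorm_eq_ofReal (Nat.cast_nonneg _), ENNReal.ofReal_natCast]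

theorem sumWeight_ne_top (p : PMF ℕ) (N s : ℕ) : sumWeight p N s ≠ ⊤ := by
  rw [← pi_sum_eq]; exact measure_ne_top _ _

/-- The lattice spanned by the support of `p` is reduced to `ℕ`: `q` is the law of `(X - m) / d`. -/
theorem exists_lattice (p : PMF ℕ) (hnd : ∃ a b, p a ≠ 0 ∧ p b ≠ 0 ∧ a ≠ b) :
    ∃ m d : ℕ, ∃ q : PMF ℕ, d ≠ 0 ∧ (∀ l, q l = p (m + d * l)) ∧
      (∀ j, p j ≠ 0 → ∃ l, j = m + d * l) ∧ q 0 ≠ 0 ∧ Nat.setGcd {l | q l ≠ 0} = 1 := by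
  obtain ⟨a, b, ha, hb, hab⟩ := hnd
  have hex : ∃ j, p j ≠ 0 := ⟨a, ha⟩
  set m := Nat.find hex with hm
  have hpm : p m ≠ 0 := Nat.find_spec hex
  have hle : ∀ j, p j ≠ 0 → m ≤ j := fun j hj => Nat.find_min' hex hj
  set S : Set ℕ := {l | p (m + l) ≠ 0} with hS
  set d := Nat.setGcd S with hd
  have hd0 : d ≠ 0 := by
    intro h
    have h1 := Nat.setGcd_eq_zero_iff.1 h
    have h2 : ∀ j, p j ≠ 0 → j = m := by
      intro j hj
      have h3 : j - m ∈ S := by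
        simp only [hS, Set.mem_ofPred_eq]
        rwa [Nat.add_sub_cancel' (hle j hj)]
      have := h1 h3
      simp only [Set.mem_singleton_iff] at this
      have := hle j hj
      omega
    exact hab ((h2 a ha).trans (h2 b hb).symm)
  have hsupp : ∀ j, p j ≠ 0 → ∃ l, j = m + d * l := by
    intro j hj
    have h3 : j - m ∈ S := by
      simp only [hS, Set.mem_ofPred_eq]
      rwa [Nat.add_sub_cancel' (hle j hj)]
    obtain ⟨l, hl⟩ := Nat.setGcd_dvd_of_mem h3
    rw [← hd] at hl
    exact ⟨l, by have := hle j hj; omega⟩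
  have hinj : Function.Injective fun l => m + d * l := fun x y h =>
    Nat.eq_of_mul_eq_mul_left (Nat.pos_of_ne_zero hd0) (Nat.add_left_cancel h)
  have hsum : ∑' l, p (m + d * l) = 1 := by
    rw [hinj.tsum_eq (f := p) fun j hj => by
      obtain ⟨l, hl⟩ := hsupp j hj
      exact ⟨l, hl.symm⟩]
    exact p.tsum_coe
  refine ⟨m, d, ⟨fun l => p (m + d * l), ENNReal.summable.hasSum_iff.2 hsum⟩, hd0, fun l => rfl, hsupp,
    by change p (m + d * 0) ≠ 0; simpa using hpm, ?_⟩
  change Nat.setGcd {l | p (m + d * l) ≠ 0} = 1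
  set e := Nat.setGcd {l | p (m + d * l) ≠ 0} with he
  have h1 : d * e ∣ d := by
    conv_rhs => rw [hd]
    rw [Nat.dvd_setGcd_iff]
    intro l hl
    obtain ⟨l', rfl⟩ := Nat.setGcd_dvd_of_mem hl
    exact mul_dvd_mul_left d (Nat.setGcd_dvd_of_mem hl)
  have h2 : d * e ∣ d * 1 := by rwa [mul_one]
  exact Nat.dvd_one.1 (Nat.dvd_of_mul_dvd_mul_left (Nat.pos_of_ne_zero hd0) h2)

/-- The lower bound for an arbitrary nondegenerate distribution with finite variance, at the
values which the sum can take. -/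
theorem exists_le_sumWeight {p : PMF ℕ} (hsq : ∑' j : ℕ, ((j ^ 2 : ℕ) : ℝ≥0∞) * p j ≠ ⊤)
    (hnd : ∃ a b, p a ≠ 0 ∧ p b ≠ 0 ∧ a ≠ b) (D : ℝ) :
    ∃ c : ℝ, 0 < c ∧ ∃ N₀ : ℕ, ∀ N ≥ N₀, ∀ s : ℕ,
      |(s : ℝ) - N * ∫ x : ℕ, (x : ℝ) ∂p.toMeasure| ≤ D → sumWeight p N s ≠ 0 →
        ENNReal.ofReal (c / √N) ≤ sumWeight p N s := by
  obtain ⟨m, d, q, hd0, hq, hsupp, hq0, hgcd⟩ := exists_lattice p hnd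
  have hd1 : 1 ≤ d := Nat.pos_of_ne_zero hd0
  have hinj : Function.Injective fun l => m + d * l := fun x y h =>
    Nat.eq_of_mul_eq_mul_left hd1 (Nat.add_left_cancel h)
  have hqsq : ∑' l : ℕ, ((l ^ 2 : ℕ) : ℝ≥0∞) * q l ≠ ⊤ := by
    refine ne_top_of_le_ne_top hsq ?_
    refine le_trans (ENNReal.tsum_le_tsum fun l => ?_)
      (ENNReal.tsum_comp_le_tsum_of_injective hinj fun j => ((j ^ 2 : ℕ) : ℝ≥0∞) * p j)
    rw [hq]
    gcongr
    exact (Nat.le_mul_of_pos_left l hd1).trans (Nat.le_add_left _ _)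
  have hqi2 : Integrable (fun x : ℕ => (x : ℝ) ^ 2) q.toMeasure := by
    simpa using integrable_of_tsum_ne_top hqsq
  have hpi2 : Integrable (fun x : ℕ => (x : ℝ) ^ 2) p.toMeasure := by
    simpa using integrable_of_tsum_ne_top hsq
  have hqi := integrable_cast_of_sq hqi2
  have hpi := integrable_cast_of_sq hpi2
  have hmean : ∫ x : ℕ, (x : ℝ) ∂p.toMeasure = m + d * ∫ x : ℕ, (x : ℝ) ∂q.toMeasure := by
    have h1 : ∫ x : ℕ, ((m : ℝ) + d * x) ∂q.toMeasure = m + d * ∫ x : ℕ, (x : ℝ) ∂q.toMeasure := by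
      rw [integral_add (integrable_const _) (hqi.const_mul _), integral_const_mul]
      simp
    rw [← h1, PMF.integral_eq_tsum _ _ hpi,
      PMF.integral_eq_tsum _ (fun x : ℕ => (m : ℝ) + d * x)
        ((integrable_const _).add (hqi.const_mul _)),
      ← hinj.tsum_eq (f := fun j => (p j).toReal • (j : ℝ))]
    · refine tsum_congr fun l => ?_
      rw [hq]
      push_cast
      rfl
    · intro j hj
      have h2 : p j ≠ 0 := by
        intro h; simp [h] at hj
      obtain ⟨l, hl⟩ := hsupp j h2
      exact ⟨l, hl.symm⟩
  have hset : {x | q.toMeasure {x} ≠ 0} = {l | q l ≠ 0} := by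
    ext x; simp only [Set.mem_ofPred_eq, toMeasure_singleton]
  obtain ⟨c, hc, N₀, h⟩ := exists_le_real_pi (P := q.toMeasure) (by rwa [toMeasure_singleton])
    (by rw [hset, hgcd]) hqi2 D
  refine ⟨c, hc, N₀, fun N hN s hs hne => ?_⟩
  -- `s` lies in the lattice of the sums
  obtain ⟨η, hη⟩ : ∃ η : {η : Fin N → ℕ // ∑ i, η i = s}, ∏ i, p (η.1 i) ≠ 0 := by
    by_contra! hcon
    exact hne (ENNReal.tsum_eq_zero.2 hcon)
  have hηi : ∀ i, ∃ l, η.1 i = m + d * l := fun i =>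
    hsupp _ (Finset.prod_ne_zero_iff.1 hη i (Finset.mem_univ i))
  choose l hl using hηi
  have hs' : s = N * m + d * ∑ i, l i := by
    rw [← η.2, Finset.mul_sum, Finset.sum_congr rfl fun i _ => hl i, Finset.sum_add_distrib]
    simp
  have hD : |((∑ i, l i : ℕ) : ℝ) - N * ∫ x : ℕ, (x : ℝ) ∂q.toMeasure| ≤ D := by
    refine le_trans ?_ hs
    have e : (s : ℝ) - N * ∫ x : ℕ, (x : ℝ) ∂p.toMeasure =
        d * (((∑ i, l i : ℕ) : ℝ) - N * ∫ x : ℕ, (x : ℝ) ∂q.toMeasure) := by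
      rw [hmean, hs']
      push_cast
      ring
    rw [e, abs_mul, Nat.abs_cast]
    exact le_mul_of_one_le_left (abs_nonneg _) (by exact_mod_cast hd1)
  have h1 := h N hN _ hD
  rw [measureReal_def, pi_sum_eq] at h1
  refine ((ENNReal.ofReal_le_iff_le_toReal (sumWeight_ne_top q N _)).2 h1).trans ?_
  let F : {η : Fin N → ℕ // ∑ i, η i = ∑ i, l i} → {η : Fin N → ℕ // ∑ i, η i = s} := fun ζ =>
    ⟨fun i => m + d * ζ.1 i, by
      rw [Finset.sum_add_distrib, ← Finset.mul_sum, ζ.2, hs']; simp⟩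
  have hF : Function.Injective F := fun x y hxy => by
    refine Subtype.ext (funext fun i => hinj ?_)
    exact congrFun (congrArg Subtype.val hxy) i
  refine le_trans (le_of_eq (tsum_congr fun ζ => ?_))
    (ENNReal.tsum_comp_le_tsum_of_injective hF fun η => ∏ i, p (η.1 i))
  exact Finset.prod_congr rfl fun i _ => hq _

end

/-! ### The normalized shift and its tails -/

section

open MeasureTheory Filter
open RandComp

theorem tsum_ite_shift {v : PMF ℕ} {α : ℝ} (hv0 : v 0 = ENNReal.ofReal α) :
    ∑' j, (if j = 0 then 0 else v j) = 1 - ENNReal.ofReal α := by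
  have h := v.tsum_coe
  have h2 : ∀ j, v j = (if j = 0 then ENNReal.ofReal α else 0) + (if j = 0 then 0 else v j) := by
    intro j
    split_ifs with hj
    · rw [hj, hv0, add_zero]
    · rw [zero_add]
  rw [tsum_congr h2, ENNReal.tsum_add, tsum_ite_eq] at h
  rw [← h, ENNReal.add_sub_cancel_left ENNReal.ofReal_ne_top]

section Shift

variable {v : PMF ℕ} {α : ℝ}

theorem one_sub_ofReal_ne_zero (hα : α < 1) : 1 - ENNReal.ofReal α ≠ 0 := by
  rw [ne_eq, tsub_eq_zero_iff_le, not_le, ENNReal.ofReal_lt_one]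
  exact hα

theorem one_sub_ofReal_ne_top : 1 - ENNReal.ofReal α ≠ ⊤ :=
  ne_top_of_le_ne_top ENNReal.one_ne_top tsub_le_self

theorem tsum_hatStar (hα : α < 1) (hv0 : v 0 = ENNReal.ofReal α) :
    ∑' j, hatStar α v j = 1 := by
  have h : ∀ j, hatStar α v j = (if j = 0 then 0 else v j) * (1 - ENNReal.ofReal α)⁻¹ := by
    intro j
    rw [hatStar]
    split_ifs
    · rw [zero_mul]
    · rw [div_eq_mul_inv]
  simp_rw [h]
  rw [ENNReal.tsum_mul_right, tsum_ite_shift hv0,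
    ENNReal.mul_inv_cancel (one_sub_ofReal_ne_zero hα) one_sub_ofReal_ne_top]

/-- `hatStar` as a probability mass function. -/
noncomputable def hatStarPMF (hα : α < 1) (hv0 : v 0 = ENNReal.ofReal α) : PMF ℕ :=
  ⟨hatStar α v, ENNReal.summable.hasSum_iff.2 (tsum_hatStar hα hv0)⟩

theorem tsum_mul_hatStar (hmean : ∑' j : ℕ, (j : ℝ≥0∞) * v j = 1) :
    ∑' j : ℕ, (j : ℝ≥0∞) * hatStar α v j = (1 - ENNReal.ofReal α)⁻¹ := by
  have h : ∀ j : ℕ, (j : ℝ≥0∞) * hatStar α v j = (j : ℝ≥0∞) * v j * (1 - ENNReal.ofReal α)⁻¹ := by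
    intro j
    rw [hatStar]
    split_ifs with hj
    · simp [hj]
    · rw [div_eq_mul_inv, mul_assoc]
  simp_rw [h]
  rw [ENNReal.tsum_mul_right, hmean, one_mul]

/-- The mean of `hatStar` exceeds an element of its support, so it has a second one. -/
theorem exists_ne_support_hatStar (hα0 : 0 < α) (hα : α < 1) (hv0 : v 0 = ENNReal.ofReal α)
    (hmean : ∑' j : ℕ, (j : ℝ≥0∞) * v j = 1)
    (hj : ∃ j : ℕ, 1 ≤ j ∧ v j ≠ 0 ∧ 1 - 1 / (j : ℝ) < α) :
    ∃ a b, hatStar α v a ≠ 0 ∧ hatStar α v b ≠ 0 ∧ a ≠ b := by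
  obtain ⟨j, hj1, hvj, hjα⟩ := hj
  have hpj : hatStar α v j ≠ 0 := by
    rw [hatStar, if_neg (by omega)]
    exact (ENNReal.div_pos hvj one_sub_ofReal_ne_top).ne'
  by_contra! hcon
  have h1 : ∑' i : ℕ, (i : ℝ≥0∞) * hatStar α v i = j := by
    have h2 : ∀ i : ℕ, (i : ℝ≥0∞) * hatStar α v i = (j : ℝ≥0∞) * hatStar α v i := by
      intro i
      by_cases h : hatStar α v i = 0
      · rw [h, mul_zero, mul_zero]
      · rw [hcon i j h hpj]
    simp_rw [h2]
    rw [ENNReal.tsum_mul_left, tsum_hatStar hα hv0, mul_one]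
  rw [tsum_mul_hatStar hmean, ← ENNReal.ofReal_one, ← ENNReal.ofReal_sub _ hα0.le,
    ← ENNReal.ofReal_inv_of_pos (by linarith), ← ENNReal.ofReal_natCast,
    ENNReal.ofReal_eq_ofReal_iff (by rw [inv_nonneg]; linarith) (by positivity)] at h1
  rw [← h1, one_div, inv_inv] at hjα
  linarith

/-- The tail probabilities `P(X ≥ j)` of `hatStar`, for `j ≥ 1`. -/
noncomputable def tail (α : ℝ) (v : PMF ℕ) (j : ℕ) : ℝ := ∑' i, (v (i + j)).toReal / (1 - α)

theorem summable_toReal (v : PMF ℕ) : Summable fun j => (v j).toReal :=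
  ENNReal.summable_toReal v.tsum_coe_ne_top

theorem isTail_tail (hα : α < 1) : IsTail α (fun j => (v j).toReal) (tail α v) where
  lt_one := hα
  nonneg _ := ENNReal.toReal_nonneg
  tail_nonneg j := tsum_nonneg fun i => div_nonneg ENNReal.toReal_nonneg (by linarith)
  tail_succ j := by
    have hs : Summable fun i => (v (i + j)).toReal / (1 - α) :=
      ((summable_nat_add_iff j).2 (summable_toReal v)).div_const _
    have h := hs.tsum_eq_zero_add
    rw [tail, tail, h, zero_add, add_sub_cancel_left]
    refine tsum_congr fun i => ?_
    rw [add_assoc, add_comm 1 j]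

theorem tail_one (hα0 : 0 < α) (hα : α < 1) (hv0 : v 0 = ENNReal.ofReal α) : tail α v 1 = 1 := by
  have h := (isTail_tail (v := v) hα).tail_succ 0
  have h0 : tail α v 0 = 1 / (1 - α) := by
    rw [tail, tsum_div_const]
    congr 1
    simp only [add_zero]
    rw [← ENNReal.tsum_toReal_eq fun j => PMF.apply_ne_top v j, v.tsum_coe, ENNReal.toReal_one]
  rw [zero_add, h0, hv0, ENNReal.toReal_ofReal hα0.le, ← sub_div, div_self (by linarith)] at h
  exact h

/-- The square roots of the tails have bounded sums, which is what `cost_trial_le` asks for. -/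
theorem exists_sum_sqrt_tail_le {K x : ℝ} (hα : α < 1) (hK : 0 ≤ K) (hx0 : 0 < x) (hx : x < 1)
    (hle : ∀ j, (v j).toReal ≤ K * x ^ j) :
    ∃ G : ℝ, 0 ≤ G ∧ ∀ n, ∑ l ∈ Finset.range n, √(tail α v (1 + l)) ≤ G := by
  have hα' : 0 < 1 - α := by linarith
  have h1 : ∀ j, tail α v j ≤ K / (1 - α) / (1 - x) * x ^ j := by
    intro j
    have hg := (hasSum_geometric_of_lt_one hx0.le hx).mul_left (K / (1 - α) * x ^ j)
    have h2 : tail α v j ≤ K / (1 - α) * x ^ j * (1 - x)⁻¹ := by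
      rw [← hg.tsum_eq]
      refine Summable.tsum_le_tsum (fun i => ?_) (((summable_nat_add_iff j).2
        (summable_toReal v)).div_const _) hg.summable
      calc (v (i + j)).toReal / (1 - α) ≤ K * x ^ (i + j) / (1 - α) := by gcongr; exact hle _
        _ = _ := by rw [pow_add]; ring
    refine h2.trans (le_of_eq ?_)
    ring
  set A := √(K / (1 - α) / (1 - x)) with hA
  have hy : √x < 1 := by rw [Real.sqrt_lt' one_pos]; simpa using hx
  have h2 : ∀ l, √(tail α v (1 + l)) ≤ A * √x ^ l := by
    intro l
    have h3 : tail α v (1 + l) ≤ K / (1 - α) / (1 - x) * (√x ^ l) ^ 2 := by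
      refine (h1 _).trans ?_
      have : 0 < 1 - x := by linarith
      rw [← pow_mul, mul_comm l 2, pow_mul, Real.sq_sqrt hx0.le]
      gcongr ?_ * ?_
      exact pow_le_pow_of_le_one hx0.le hx.le (by omega)
    refine (Real.sqrt_le_sqrt h3).trans (le_of_eq ?_)
    rw [Real.sqrt_mul' _ (by positivity), Real.sqrt_sq (by positivity)]
  have hg := (hasSum_geometric_of_lt_one (Real.sqrt_nonneg x) hy).mul_left A
  refine ⟨A * (1 - √x)⁻¹, mul_nonneg (Real.sqrt_nonneg _) (by rw [inv_nonneg]; linarith), fun n => ?_⟩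
  refine (Finset.sum_le_sum fun l _ => h2 l).trans ?_
  rw [← hg.tsum_eq]
  exact hg.summable.sum_le_tsum _ fun l _ => by positivity

theorem tsum_sq_mul_hatStar_ne_top {K x : ℝ} (hα : α < 1) (hx0 : 0 < x) (hx : x < 1)
    (hle : ∀ j, (v j).toReal ≤ K * x ^ j) : ∑' j : ℕ, ((j ^ 2 : ℕ) : ℝ≥0∞) * hatStar α v j ≠ ⊤ := by
  have hs := summable_pow_mul_of_le_geometric (fun i => ENNReal.toReal_nonneg) hx0.le hx hle 2
  have h1 : ∑' j : ℕ, ((j ^ 2 : ℕ) : ℝ≥0∞) * v j ≠ ⊤ := by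
    have e : ∀ j : ℕ, ((j ^ 2 : ℕ) : ℝ≥0∞) * v j = ENNReal.ofReal ((j : ℝ) ^ 2 * (v j).toReal) := by
      intro j
      rw [ENNReal.ofReal_mul (by positivity), ENNReal.ofReal_toReal (PMF.apply_ne_top v j),
        ← Nat.cast_pow, ENNReal.ofReal_natCast]
    simp_rw [e]
    exact hs.tsum_ofReal_ne_top
  refine ne_top_of_le_ne_top (ENNReal.mul_ne_top h1
    (ENNReal.inv_ne_top.2 (one_sub_ofReal_ne_zero hα))) ?_
  rw [← ENNReal.tsum_mul_right]
  refine ENNReal.tsum_le_tsum fun j => ?_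
  rw [mul_assoc, ← div_eq_mul_inv]
  gcongr
  rw [hatStar]
  split_ifs
  · exact bot_le
  · exact le_rfl

theorem integral_hatStarPMF (hα0 : 0 < α) (hα : α < 1) (hv0 : v 0 = ENNReal.ofReal α)
    (hmean : ∑' j : ℕ, (j : ℝ≥0∞) * v j = 1) :
    ∫ x : ℕ, (x : ℝ) ∂(hatStarPMF hα hv0).toMeasure = 1 / (1 - α) := by
  rw [integral_eq_lintegral_of_nonneg_ae (ae_of_all _ fun x => Nat.cast_nonneg x)
    StronglyMeasurable.of_discrete.aestronglyMeasurable, lintegral_countable']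
  have h : ∀ j : ℕ, ENNReal.ofReal (j : ℝ) * (hatStarPMF hα hv0).toMeasure {j} =
      (j : ℝ≥0∞) * hatStar α v j := by
    intro j
    rw [toMeasure_singleton, ENNReal.ofReal_natCast]
    rfl
  simp_rw [h]
  rw [tsum_mul_hatStar hmean, ← ENNReal.ofReal_one, ← ENNReal.ofReal_sub _ hα0.le,
    ENNReal.toReal_inv, ENNReal.toReal_ofReal (by linarith), one_div]

end Shift

/-! ### The probability that a trial is accepted -/

theorem sumWeight_length_sum_ne_zero {p : ℕ → ℝ≥0∞} {L : List ℕ} (h : ∀ d ∈ L, p d ≠ 0) :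
    sumWeight p L.length L.sum ≠ 0 := by
  rw [sumWeight, ne_eq, ENNReal.tsum_eq_zero, not_forall]
  refine ⟨⟨L.get, ?_⟩, ?_⟩
  · rw [← List.sum_ofFn, List.ofFn_get]
  · exact Finset.prod_ne_zero_iff.2 fun i _ => h _ (List.get_mem L i)

/-- The outdegrees of the inner vertices of a possible tree are a possible outcome of a trial. -/
theorem sumWeight_ne_zero_of_PP {w v : PMF ℕ} {α : ℝ} (hvw : ∀ j, 1 ≤ j → w j ≠ 0 → v j ≠ 0)
    {k n : ℕ} (h : PP w k n) : sumWeight (hatStar α v) (n - k) (n - 1) ≠ 0 := by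
  obtain ⟨t, hk, hn, ht⟩ := (PP_iff w k n).1 h
  set L := t.degrees.filter (fun d => decide (d ≠ 0)) with hL
  have hlen : L.length = n - k := by
    have h1 := List.length_eq_length_filter_add (l := t.degrees) (fun d => decide (d ≠ 0))
    have h2 : (t.degrees.filter fun d => !decide (d ≠ 0)).length = k := by
      rw [← hk, OTree.numLeaves, List.count_eq_length_filter]
      congr 2
      funext d
      rw [Bool.eq_iff_iff]
      simp
    rw [h2, ← hL] at h1
    rw [OTree.numVertices] at hn
    omega
  have hsum : L.sum = n - 1 := by
    have h1 : ∀ l : List ℕ, (l.filter fun d => decide (d ≠ 0)).sum = l.sum := by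
      intro l
      induction l with
      | nil => rfl
      | cons d l ih =>
        rw [List.filter_cons]
        split_ifs with hd
        · rw [List.sum_cons, List.sum_cons, ih]
        · simp only [ne_eq, decide_not, Bool.not_eq_eq_eq_not, Bool.not_true,
            decide_eq_false_iff_not, not_not] at hd
          rw [ih, List.sum_cons, hd, zero_add]
    rw [hL, h1, sum_degrees, hn]
  rw [← hlen, ← hsum]
  refine sumWeight_length_sum_ne_zero fun d hd => ?_
  have h1 := List.mem_filter.1 hd
  have hd0 : d ≠ 0 := by simpa using h1.2
  rw [hatStar, if_neg hd0]
  exact (ENNReal.div_pos (hvw d (by omega) (ht d h1.1)) one_sub_ofReal_ne_top).ne'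

/-- A possible trial is accepted after `O(√n)` repetitions on average: for large `n` by the local
limit theorem, and the remaining pairs are finitely many. -/
theorem exists_inv_sumWeight_le {w v : PMF ℕ} {α : ℝ} (hα0 : 0 < α) (hα : α < 1)
    (hv0 : v 0 = ENNReal.ofReal α) (hmean : ∑' j : ℕ, (j : ℝ≥0∞) * v j = 1)
    (hsq : ∑' j : ℕ, ((j ^ 2 : ℕ) : ℝ≥0∞) * hatStar α v j ≠ ⊤)
    (hnd : ∃ a b, hatStar α v a ≠ 0 ∧ hatStar α v b ≠ 0 ∧ a ≠ b)
    (hvw : ∀ j, 1 ≤ j → w j ≠ 0 → v j ≠ 0) (B : ℝ) :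
    ∃ A : ℝ, 0 ≤ A ∧ ∀ k n : ℕ, PP w k n → |(k : ℝ) - α * n| ≤ B →
      (sumWeight (hatStar α v) (n - k) (n - 1))⁻¹ ≤ ENNReal.ofReal (A * √n) := by
  have hα' : 0 < 1 - α := by linarith
  obtain ⟨c, hc, N₀, h⟩ := exists_le_sumWeight (p := hatStarPMF hα hv0) hsq hnd (B / (1 - α) + 1)
  rw [integral_hatStarPMF hα0 hα hv0 hmean] at h
  set M := ⌈((N₀ : ℝ) + 1 + B) / (1 - α)⌉₊ with hM
  let f : ℕ × ℕ → ℝ := fun z => (sumWeight (hatStar α v) (z.2 - z.1) (z.2 - 1))⁻¹.toReal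
  have hf : ∀ z, 0 ≤ f z := fun z => ENNReal.toReal_nonneg
  set S := ∑ z ∈ Finset.range (M + 1) ×ˢ Finset.range (M + 1), f z with hS
  have hS0 : 0 ≤ S := Finset.sum_nonneg fun z _ => hf z
  refine ⟨max S (1 / c), le_max_of_le_left hS0, fun k n hPP hkn => ?_⟩
  have hne := sumWeight_ne_zero_of_PP (α := α) hvw hPP
  obtain ⟨t, hk, hn, -⟩ := (PP_iff w k n).1 hPP
  have hn1 : 1 ≤ n := hn ▸ one_le_numVertices t
  have hkn' : k ≤ n := hk ▸ hn ▸ numLeaves_le t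
  have hsn : 1 ≤ √(n : ℝ) := by rw [Real.one_le_sqrt]; exact_mod_cast hn1
  have habs := abs_le.1 hkn
  rcases le_or_gt (N₀ + 1) (n - k) with hN | hN
  · have hNpos : (0 : ℝ) < (n - k : ℕ) := by exact_mod_cast (by omega : 0 < n - k)
    have hs : |((n - 1 : ℕ) : ℝ) - (n - k : ℕ) * (1 / (1 - α))| ≤ B / (1 - α) + 1 := by
      rw [Nat.cast_sub hn1, Nat.cast_sub hkn', Nat.cast_one]
      have e : (n : ℝ) - 1 - (n - k) * (1 / (1 - α)) = ((k : ℝ) - α * n) / (1 - α) - 1 := by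
        field_simp; ring
      rw [e]
      refine (abs_sub _ _).trans ?_
      rw [abs_div, abs_of_pos hα', abs_one]
      gcongr
    have h1 := h (n - k) (by omega) (n - 1) hs hne
    rw [ENNReal.inv_le_iff_inv_le, ← ENNReal.ofReal_inv_of_pos (by positivity)]
    refine le_trans (ENNReal.ofReal_le_ofReal ?_) h1
    have h2 : √((n - k : ℕ) : ℝ) ≤ √(n : ℝ) := Real.sqrt_le_sqrt (by exact_mod_cast Nat.sub_le n k)
    have h3 : 0 < √((n - k : ℕ) : ℝ) := Real.sqrt_pos.2 hNpos
    calc (max S (1 / c) * √n)⁻¹ ≤ (1 / c * √((n - k : ℕ) : ℝ))⁻¹ := by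
          gcongr; exact le_max_right _ _
      _ = _ := by field_simp
  · have hnM : n ≤ M := by
      have h1 : (n : ℝ) ≤ ((N₀ : ℝ) + 1 + B) / (1 - α) := by
        rw [le_div_iff₀ hα']
        have h2 : ((n - k : ℕ) : ℝ) ≤ (N₀ : ℝ) + 1 := by exact_mod_cast hN.le
        rw [Nat.cast_sub hkn'] at h2
        linarith
      exact Nat.cast_le.1 (h1.trans (Nat.le_ceil _))
    have h1 : f (k, n) ≤ S := Finset.single_le_sum (fun z _ => hf z)
      (Finset.mem_product.2 ⟨Finset.mem_range.2 (by simp only; omega), Finset.mem_range.2 (by simp only; omega)⟩)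
    rw [← ENNReal.ofReal_toReal (ENNReal.inv_ne_top.2 hne)]
    refine ENNReal.ofReal_le_ofReal (h1.trans ?_)
    have h2 := le_max_left S (1 / c)
    nlinarith

end

end ConditionedGW

theorem theorem4 (w : PMF ℕ)
    (hmean : ∑' j : ℕ, (j : ℝ≥0∞) * w j = 1)
    (hexp : ∃ a : ℝ, 0 < a ∧ ∑' j : ℕ, ENNReal.ofReal (Real.exp (a * j)) * w j ≠ ⊤)
    (hw1 : w 1 ≠ 1)
    (α : ℝ) (hα0 : 0 < α) (hα1 : ENNReal.ofReal α < 1 - (nuHat w)⁻¹)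
    (hα2 : ∃ j : ℕ, 1 ≤ j ∧ w j ≠ 0 ∧ 1 - 1 / (j : ℝ) < α) :
    (∃ v : PMF ℕ, IsAlphaShift w α v) ∧
    ∀ v : PMF ℕ, IsAlphaShift w α v →
      (∀ k n : ℕ, PP w k n →
        (∀ ξ : Fin (n - k) → ℕ,
          ((fun (a : ℕ → ℕ) (i : Fin (n - k)) => a i) <$>
            sampleDegrees α (fun j => (v j).toReal) k n).law ξ =
              condSumLaw (hatStar α v) (n - k) (n - 1) ξ) ∧
        (∀ t : OTree, (algorithmA α (fun j => (v j).toReal) k n).law t = condTreeLaw w k n t)) ∧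
      (∀ B : ℝ, ∃ C : ℝ≥0, ∀ k n : ℕ, PP w k n → |(k : ℝ) - α * n| ≤ B →
        (algorithmA α (fun j => (v j).toReal) k n).expTime ≤ (C : ℝ≥0∞) * n) := by
  refine ⟨exists_isAlphaShift hα0 hα1 hα2, fun v hv => ?_⟩
  have hα := lt_one_of_shift hα1
  obtain ⟨K, x, hK, hx0, hx, hle⟩ := exists_shift_le_geometric hα0 hα1 hv
  obtain ⟨hv0, hvmean, C, s, hC, hs, hvj⟩ := hv
  have hτ := isTail_tail (v := v) hα
  have hτ1 := tail_one hα0 hα hv0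
  have hvw : ∀ j, 1 ≤ j → w j ≠ 0 → v j ≠ 0 := fun j hj hw => by
    rw [hvj j hj]
    refine mul_ne_zero ?_ hw
    rw [ne_eq, ENNReal.ofReal_eq_zero, not_le]
    positivity
  have hbasic : ∀ k n, PP w k n → 1 ≤ n ∧ k ≤ n := fun k n h => by
    obtain ⟨t, hk, hn, -⟩ := (PP_iff w k n).1 h
    exact ⟨hn ▸ one_le_numVertices t, hk ▸ hn ▸ numLeaves_le t⟩
  have hsucc : ∀ k n, PP w k n → RandComp.succ (degreeTrial α (fun j => (v j).toReal) k n) =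
      sumWeight (hatStar α v) (n - k) (n - 1) := fun k n h =>
    succ_degreeTrial hα0.le hτ hτ1 (hbasic k n h).1 rfl
  have hsucc0 : ∀ k n, PP w k n →
      RandComp.succ (degreeTrial α (fun j => (v j).toReal) k n) ≠ 0 := fun k n h => by
    rw [hsucc k n h]
    exact sumWeight_ne_zero_of_PP hvw h
  refine ⟨fun k n hPP => ⟨fun ξ => ?_, fun t => ?_⟩, fun B => ?_⟩
  · exact law_sampleDegrees_eq_condSumLaw hα0.le hτ hτ1 (hbasic k n hPP).1 rfl ξ
  · exact law_algorithmA_eq_condTreeLaw hτ hτ1 (hsucc0 k n hPP) hPP hC hs hvj t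
  obtain ⟨G, hG, hsum⟩ := exists_sum_sqrt_tail_le hα hK hx0 hx hle
  obtain ⟨A, hA, hinv⟩ := exists_inv_sumWeight_le hα0 hα hv0 hvmean
    (tsum_sq_mul_hatStar_ne_top hα hx0 hx hle)
    (exists_ne_support_hatStar hα0 hα hv0 hvmean (by
      obtain ⟨j, h1, h2, h3⟩ := hα2
      exact ⟨j, h1, hvw j h1 h2, h3⟩)) hvw B
  refine ⟨((5 + 150 * G) * A + 50).toNNReal, fun k n hPP hkn => ?_⟩
  obtain ⟨hn, hk⟩ := hbasic k n hPP
  have hs0 := hsucc0 k n hPP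
  rw [RandComp.expTime_eq_cost (mass_algorithmA hs0)]
  refine (cost_algorithmA_le hτ hτ1 hk hn hs0).trans ?_
  have hcost : (degreeTrial α (fun j => (v j).toReal) k n).cost ≤
      ENNReal.ofReal ((5 + 150 * G) * √n) := by
    have h := cost_trial_le (table_eq (n - k)) hτ n n 1 le_rfl 0 [] (Or.inr (by
      rw [hτ1]; exact one_pos))
    rw [hτ1, Real.sqrt_one, div_one] at h
    refine h.trans (ENNReal.ofReal_le_ofReal ?_)
    have h1 : √((n - k : ℕ) : ℝ) ≤ √(n : ℝ) := Real.sqrt_le_sqrt (by exact_mod_cast Nat.sub_le n k)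
    have h2 : 1 ≤ √(n : ℝ) := by rw [Real.one_le_sqrt]; exact_mod_cast hn
    calc 5 + 150 * √((n - k : ℕ) : ℝ) * ∑ l ∈ Finset.range n, √(tail α v (1 + l))
        ≤ 5 * √(n : ℝ) + 150 * √(n : ℝ) * G := by
          gcongr
          · linarith
          · exact hsum n
      _ = _ := by ring
  have hi := hinv k n hPP hkn
  rw [← hsucc k n hPP] at hi
  calc _ ≤ ENNReal.ofReal ((5 + 150 * G) * √n) * ENNReal.ofReal (A * √n) + (50 * n : ℕ) := by
        gcongr
    _ = ENNReal.ofReal (((5 + 150 * G) * A + 50) * n) := by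
        rw [← ENNReal.ofReal_mul (by positivity), ← ENNReal.ofReal_natCast,
          ← ENNReal.ofReal_add (by positivity) (by positivity)]
        congr 1
        have h : √(n : ℝ) * √(n : ℝ) = n := Real.mul_self_sqrt (Nat.cast_nonneg n)
        calc _ = (5 + 150 * G) * A * (√(n : ℝ) * √(n : ℝ)) + ((50 * n : ℕ) : ℝ) := by ring
          _ = _ := by rw [h]; push_cast; ring
    _ = _ := by
        rw [ENNReal.ofReal_mul (by positivity), ENNReal.ofReal_natCast]
        rfl
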